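/- Fix integers $k,q\ge 2$, a probability vector $\pi=(\pi_i)_{i\in[q]}$ with $\pi_i>0$ for all $i\in[q]=\{1,\dots,q\}$, a finite set $\Psi$ of functions $\psi:[q]^k\to\mathbb R_{>0}$ and a probability vector $p=(p(\psi))_{\psi\in\Psi}$ with all $p(\psi)>0$. Assume that for every $\psi\in\Psi$ and every permutation $\theta$ of $\{1,\dots,k\}$ the function $\psi^\theta(\sigma_1,\dots,\sigma_k)=\psi(\sigma_{\theta(1)},\dots,\sigma_{\theta(k)})$ belongs to $\Psi$ and $p(\psi^\theta)=p(\psi)$. *Planted model.* For $n\ge 1$ and $d>0$ let $\sigma^\star=(\sigma^\star_v)_{v\in V}$, $V=\{1,\dots,n\}$, be i.i.d. with law $\pi$, and independently let $m\sim\mathrm{Poi}(dn/k)$. Given $\sigma^\star=\sigma$ and $m$, the factor graph $G^\star$ consists of $m$ labelled clauses $a=1,\dots,m$; clause $a$ is a pair $(\delta a,\psi_a)\in V^k\times\Psi$, and the clauses are independent with $$\mathbb P\big(\delta a=(v_1,\dots,v_k),\ \psi_a=\psi\big)=\frac{p(\psi)\,\psi(\sigma_{v_1},\dots,\sigma_{v_k})}{\sum_{\psi'\in\Psi}p(\psi')\sum_{v'\in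 V^k}\psi'(\sigma_{v'_1},\dots,\sigma_{v'_k})}.$$ *Weak recovery.* For $\sigma^1,\sigma^2\in[q]^V$ let $$A(\sigma^1,\sigma^2)=\max_{\Gamma\in S_q}\frac1q\sum_{i=1}^q\frac{|\{v:\sigma^1_v=i,\ \sigma^2_v=\Gamma(i)\}|}{|\{v:\sigma^1_v=i\}|}$$ (with $0/0=0$). Weak recovery is possible at $d$ if there are $\varepsilon>0$ and estimators $\hat\sigma_n$, mapping factor graphs on $n$ variables to $[q]^V$, with $\limsup_{n\to\infty}\mathbb E\big[A(\sigma^\star,\hat\sigma_n(G^\star))\big]\ge \frac1q+\varepsilon$. Let $$d_*=d_*(p,\pi)=\inf\{d>0:\text{weak recovery is possible at } d\}\in[0,\infty],\qquad \inf\emptyset=\infty.$$ *Symmetry condition.* With $\sigma=(\sigma_1,\dots,\sigma_k)\sim\pi^{\otimes k}$, say that (SYM) holds if $$\mathbb E_\pi[\psi(\sigma)\mid\sigma_s=\tau]=\mathbb E_\pi[\psi(\sigma)]\qquad\text{for all }\psi\in\Psi,\ 1\le s\le k,\ \tau\in[q].$$ **Proposition.** (i) If (SYM) does not hold, then weak recovery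 is possible at every $d>0$; consequently $d_*=0$. (ii) If (SYM) holds and at least one $\psi\in\Psi$ is not constant, then $\frac1{k-1}\le d_*<\infty$. -/

import Mathlib

noncomputable section

namespace PlantedFactor

/-- A weight function `ψ : [q]^k → ℝ` (positivity is imposed where weight functions are used). -/
abbrev Weight (k q : ℕ) : Type := (Fin k → Fin q) → ℝ

variable {k q : ℕ}

/-- The weight function `ψ^θ (σ_1, …, σ_k) = ψ (σ_{θ(1)}, …, σ_{θ(k)})`. -/
def Weight.permute (ψ : Weight k q) (θ : Equiv.Perm (Fin k)) : Weight k q :=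
  fun x => ψ (fun s => x (θ s))

/-- `p` is a probability vector on the finite set `Ψ` of positive weight functions, charging every
element of `Ψ`, and `Ψ` and `p` are invariant under permuting the `k` arguments. (The values of `p`
outside `Ψ` are never used.) -/
structure IsWeightPrior (Ψ : Finset (Weight k q)) (p : Weight k q → ℝ) : Prop where
  weight_pos : ∀ ψ ∈ Ψ, ∀ x, 0 < ψ x
  pos : ∀ ψ ∈ Ψ, 0 < p ψ
  sum_eq_one : ∑ ψ ∈ Ψ, p ψ = 1
  permute_mem : ∀ ψ ∈ Ψ, ∀ θ : Equiv.Perm (Fin k), ψ.permute θ ∈ Ψ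
  permute_eq : ∀ ψ ∈ Ψ, ∀ θ : Equiv.Perm (Fin k), p (ψ.permute θ) = p ψ

/-- `π` is a probability vector on the communities `[q]`, every community having positive mass. -/
structure IsCommunityPrior (π : Fin q → ℝ) : Prop where
  pos : ∀ i, 0 < π i
  sum_eq_one : ∑ i, π i = 1

/-- A clause on the variables `Fin n`: its ordered neighbourhood `δa` in `V^k` (repetitions
are allowed) together with its weight function. -/
abbrev Clause (Ψ : Finset (Weight k q)) (n : ℕ) : Type := (Fin k → Fin n) × {ψ // ψ ∈ Ψ}

/-- A factor graph on the variables `Fin n`: a number `m` of clauses and the `m` (labelled)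
clauses themselves. -/
abbrev FactorGraph (Ψ : Finset (Weight k q)) (n : ℕ) : Type := Σ m : ℕ, Fin m → Clause Ψ n

/-- The law of one clause of the planted model given the planted assignment `σ`:
`P(δa = v, ψ_a = ψ) = p(ψ) ψ(σ_v) / ∑_{ψ'} p(ψ') ∑_{v'} ψ'(σ_{v'})`. -/
def clauseProb (Ψ : Finset (Weight k q)) (p : Weight k q → ℝ) {n : ℕ} (σ : Fin n → Fin q)
    (c : Clause Ψ n) : ℝ :=
  p c.2.1 * c.2.1 (fun s => σ (c.1 s)) /
    ∑ ψ ∈ Ψ, p ψ * ∑ v : Fin k → Fin n, ψ (fun s => σ (v s))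

/-- `P(σ⋆ = σ, G⋆(n, m, σ⋆) = g)`, the joint law of the planted assignment and of the planted
factor graph with a given number `m` of clauses: the communities are i.i.d. from `π` and, given
them, the clauses are i.i.d. from `clauseProb`. -/
def plantedProb (Ψ : Finset (Weight k q)) (p : Weight k q → ℝ) (π : Fin q → ℝ) {n m : ℕ}
    (σ : Fin n → Fin q) (g : Fin m → Clause Ψ n) : ℝ :=
  (∏ v, π (σ v)) * ∏ a, clauseProb Ψ p σ (g a)

/-- The overlap `A(σ¹, σ²)`, maximised over the permutations of the communities. (The ratio of a
community that is empty in `σ¹` is read as `0`.) -/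
def overlap {n : ℕ} (σ₁ σ₂ : Fin n → Fin q) : ℝ :=
  ⨆ Γ : Equiv.Perm (Fin q), (1 / (q : ℝ)) * ∑ i : Fin q,
    ((Finset.univ.filter fun v => σ₁ v = i ∧ σ₂ v = Γ i).card : ℝ) /
      ((Finset.univ.filter fun v => σ₁ v = i).card : ℝ)

/-- `E[A(σ⋆, σ̂(G⋆))]` for `G⋆` from the planted model with `n` variables and a `Poi(dn/k)` number
of clauses, where `σ̂` is an estimator for `n` variables. -/
def expectedOverlap (Ψ : Finset (Weight k q)) (p : Weight k q → ℝ) (π : Fin q → ℝ) (d : ℝ) (n : ℕ)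
    (est : FactorGraph Ψ n → (Fin n → Fin q)) : ℝ :=
  ∫ m : ℕ, (∑ σ : Fin n → Fin q, ∑ g : Fin m → Clause Ψ n,
      plantedProb Ψ p π σ g * overlap σ (est ⟨m, g⟩))
    ∂(ProbabilityTheory.poissonMeasure (d * n / k).toNNReal)

/-- Weak recovery is possible at `d`. -/
def WeakRecoveryPossible (Ψ : Finset (Weight k q)) (p : Weight k q → ℝ) (π : Fin q → ℝ)
    (d : ℝ) : Prop :=
  ∃ ε : ℝ, 0 < ε ∧ ∃ est : ∀ n : ℕ, FactorGraph Ψ n → (Fin n → Fin q),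
    1 / (q : ℝ) + ε ≤
      Filter.limsup (fun n : ℕ => expectedOverlap Ψ p π d n (est n)) Filter.atTop

/-- The weak recovery threshold `d⋆(p, π)`, the infimum of the `d > 0` at which weak recovery is
possible, as an extended real number (so it is `⊤` if there is no such `d`). -/
def weakRecoveryThreshold (Ψ : Finset (Weight k q)) (p : Weight k q → ℝ) (π : Fin q → ℝ) : EReal :=
  sInf ((fun d : ℝ => (d : EReal)) '' {d : ℝ | 0 < d ∧ WeakRecoveryPossible Ψ p π d})

/-- `E_π[ψ(σ)]` for `σ = (σ_1, …, σ_k)` with i.i.d. entries from `π`. -/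
def mean (π : Fin q → ℝ) (ψ : Weight k q) : ℝ :=
  ∑ x : Fin k → Fin q, (∏ j, π (x j)) * ψ x

/-- `E_π[ψ(σ) | σ_s = τ]`. -/
def condMean (π : Fin q → ℝ) (ψ : Weight k q) (s : Fin k) (τ : Fin q) : ℝ :=
  (∑ x : Fin k → Fin q, if x s = τ then (∏ j, π (x j)) * ψ x else 0) / π τ

/-- The symmetry condition: for every weight function `ψ ∈ Ψ`, the conditional expectation
`E_π[ψ(σ) | σ_s = τ]` equals `E_π[ψ(σ)]` for every position `s` and community `τ`. -/
def SYM (Ψ : Finset (Weight k q)) (π : Fin q → ℝ) : Prop :=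
  ∀ ψ ∈ Ψ, ∀ (s : Fin k) (τ : Fin q), condMean π ψ s τ = mean π ψ

end PlantedFactor

end

noncomputable section

namespace PlantedFactor

/-! Part (i). If (SYM) fails, some conditional mean of some `ψ` at some position `s` is larger for a
community `i₂` than for `i₁`. Whether a variable of community `i` sits in position `s` of some
clause carrying `ψ` is then a biased test: by Poisson thinning the number of such clauses is
asymptotically Poisson, with a mean proportional to that conditional mean. Guessing `i₂` on a hit
and `i₁` otherwise gains a fixed amount over `1/q` at every `d > 0`
(`weakRecoveryPossible_of_not_sym`).

Part (ii), finiteness. Score an assignment by summing a fixed nonconstant `ψ` over the clauses that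
carry it. If `σ'` is nearly independent of the planted `σ`, its expected gain per clause over `σ` is
a positive multiple of roughly `(E ψ)² - E ψ²`, which is negative by strict Jensen. A Chernoff bound
beats the union bound over the `q ^ n` assignments once `d` is large, so the best-scoring balanced
assignment is not nearly independent of `σ`. A statement about matrices
(`abs_sub_le_of_perm_sum_le`) shows that overlap close to `1/q` would force near independence.

Part (ii), lower bound. For `d < 1/(k-1)` the clause hypergraph is subcritical: a typical variable
lies in a tree component of bounded size. Given the graph, the weight of `σ` is a product of local
factors times `wmean (emp σ) ^ (-m)`. The local factors alone would leave the root of a tree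
distributed as `π` and independent of the other components, since under (SYM) each leaf clause
integrates to a constant (`Explored.prodExp_eq_zero`). The remaining factor is global, but (SYM)
also makes `wmean` stationary at `π`; changing boundedly many entries thus changes it by a factor `1
+ o(1/n)`, which is harmless even to the power `m = O(n)` (`exists_ratio_bound`). So communities of
distinct components are almost uncorrelated given the graph, every class of an estimator has a
centred community count with second moment `o(n²)` (`eventually_second_moment_le`), and the overlap
cannot exceed `1/q + o(1)` in expectation. -/

/-- The expectation of `F` over independent coordinates of law `w`, as a finite sum. -/
def prodExp {ι α : Type*} [Fintype ι] [DecidableEq ι] [Fintype α] (w : α → ℝ)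
    (F : (ι → α) → ℝ) : ℝ :=
  ∑ x, (∏ i, w (x i)) * F x

/-! ### Finite product expectations and a uniform Chernoff bound -/

section ProdExp

variable {ι α : Type*} [Fintype ι] [DecidableEq ι] [Fintype α] {w : α → ℝ}

theorem prodExp_prod (w : α → ℝ) (h : ι → α → ℝ) :
    prodExp w (fun x : ι → α => ∏ i, h i (x i)) = ∏ i, ∑ a, w a * h i a := by
  classical
  simp only [prodExp, ← Finset.prod_mul_distrib]
  rw [Finset.prod_univ_sum, Fintype.piFinset_univ]

theorem prodExp_const (hw : ∑ a, w a = 1) (c : ℝ) :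
    prodExp w (fun _ : ι → α => c) = c := by
  have h := prodExp_prod (ι := ι) w (fun _ _ => (1 : ℝ))
  simp only [mul_one, hw, Finset.prod_const_one] at h
  have : prodExp w (fun _ : ι → α => c) = prodExp w (fun _ : ι → α => (1 : ℝ)) * c := by
    simp only [prodExp, Finset.sum_mul, mul_one]
  rw [this, h, one_mul]

theorem prodExp_mono (hw : ∀ a, 0 ≤ w a) {F G : (ι → α) → ℝ} (h : ∀ x, F x ≤ G x) :
    prodExp w F ≤ prodExp w G :=
  Finset.sum_le_sum fun x _ => mul_le_mul_of_nonneg_left (h x) (Finset.prod_nonneg fun _ _ => hw _)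

theorem prodExp_nonneg (hw : ∀ a, 0 ≤ w a) {F : (ι → α) → ℝ} (h : ∀ x, 0 ≤ F x) :
    0 ≤ prodExp w F :=
  Finset.sum_nonneg fun x _ => mul_nonneg (Finset.prod_nonneg fun _ _ => hw _) (h x)

theorem prodExp_add (F G : (ι → α) → ℝ) :
    prodExp w (fun x => F x + G x) = prodExp w F + prodExp w G := by
  simp only [prodExp, mul_add, Finset.sum_add_distrib]

theorem prodExp_sub (F G : (ι → α) → ℝ) :
    prodExp w (fun x => F x - G x) = prodExp w F - prodExp w G := by
  simp only [prodExp, mul_sub, Finset.sum_sub_distrib]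

theorem prodExp_const_mul (c : ℝ) (F : (ι → α) → ℝ) :
    prodExp w (fun x => c * F x) = c * prodExp w F := by
  simp only [prodExp, Finset.mul_sum]
  exact Finset.sum_congr rfl fun x _ => by ring

theorem prodExp_mul_const (c : ℝ) (F : (ι → α) → ℝ) :
    prodExp w (fun x => F x * c) = prodExp w F * c := by
  simp only [mul_comm _ c, prodExp_const_mul]

theorem prodExp_sum {β : Type*} (s : Finset β) (F : β → (ι → α) → ℝ) :
    prodExp w (fun x => ∑ b ∈ s, F b x) = ∑ b ∈ s, prodExp w (F b) := by
  simp only [prodExp, Finset.mul_sum]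
  exact Finset.sum_comm

theorem prodExp_le_const (hw : ∀ a, 0 ≤ w a) (hw1 : ∑ a, w a = 1) {F : (ι → α) → ℝ} {c : ℝ}
    (h : ∀ x, F x ≤ c) : prodExp w F ≤ c :=
  (prodExp_mono hw h).trans_eq (prodExp_const hw1 c)

theorem const_le_prodExp (hw : ∀ a, 0 ≤ w a) (hw1 : ∑ a, w a = 1) {F : (ι → α) → ℝ} {c : ℝ}
    (h : ∀ x, c ≤ F x) : c ≤ prodExp w F :=
  (prodExp_const hw1 c).symm.le.trans (prodExp_mono hw h)

theorem abs_prodExp_le (hw : ∀ a, 0 ≤ w a) (F : (ι → α) → ℝ) :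
    |prodExp w F| ≤ prodExp w (fun x => |F x|) := by
  refine (Finset.abs_sum_le_sum_abs _ _).trans_eq (Finset.sum_congr rfl fun x _ => ?_)
  rw [abs_mul, abs_of_nonneg (Finset.prod_nonneg fun _ _ => hw _)]

/-- Resampling a single coordinate does not change the expectation. -/
theorem prodExp_update (hw : ∑ a, w a = 1) (i : ι) (F : (ι → α) → ℝ) :
    prodExp w (fun x => ∑ a, w a * F (Function.update x i a)) = prodExp w F := by
  simp only [prodExp]
  let e := Equiv.funSplitAt i α
  have key : ∀ G : (ι → α) → ℝ, ∑ x, (∏ j, w (x j)) * G x =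
      ∑ y : {j // j ≠ i} → α, (∏ j, w (y j)) * ∑ b, w b * G (e.symm (b, y)) := by
    intro G
    rw [← Equiv.sum_comp e.symm, Fintype.sum_prod_type, Finset.sum_comm]
    refine Finset.sum_congr rfl fun y _ => ?_
    rw [Finset.mul_sum]
    refine Finset.sum_congr rfl fun b _ => ?_
    have : ∏ j, w (e.symm (b, y) j) = w b * ∏ j : {j // j ≠ i}, w (y j) := by
      rw [Fintype.prod_eq_mul_prod_subtype_ne _ i]
      congr 1
      · simp [e, Equiv.funSplitAt, Equiv.piSplitAt]
      · refine Finset.prod_congr rfl fun j _ => ?_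
        simp [e, Equiv.funSplitAt, Equiv.piSplitAt, j.2]
    rw [this]; ring
  rw [key, key]
  refine Finset.sum_congr rfl fun y _ => ?_
  congr 1
  have : ∀ b a, Function.update (e.symm (b, y)) i a = e.symm (a, y) := by
    intro b a
    ext1 j
    by_cases hj : j = i
    · subst hj; simp [e, Equiv.funSplitAt, Equiv.piSplitAt]
    · simp [e, Equiv.funSplitAt, Equiv.piSplitAt, hj]
  simp only [this]
  rw [← Finset.sum_mul, hw, one_mul]

end ProdExp

/-- Conditioning on one of the coordinates. -/
theorem prodExp_succAbove {α : Type*} [Fintype α] (w : α → ℝ) {m : ℕ} (a : Fin (m + 1))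
    (F : (Fin (m + 1) → α) → ℝ) :
    prodExp w F = ∑ c, w c * prodExp w (fun g : Fin m → α => F (a.insertNth c g)) := by
  simp only [prodExp]
  rw [← Equiv.sum_comp (Fin.insertNthEquiv (fun _ => α) a), Fintype.sum_prod_type]
  refine Finset.sum_congr rfl fun c _ => ?_
  rw [Finset.mul_sum]
  refine Finset.sum_congr rfl fun g _ => ?_
  have h : Fin.insertNthEquiv (fun _ => α) a (c, g) = a.insertNth c g := rfl
  simp only [h, Fin.prod_univ_succAbove _ a, Fin.insertNth_apply_same,
    Fin.insertNth_apply_succAbove]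
  ring

/-- A Chernoff bound: the sum of `m` i.i.d. bounded variables of negative mean is nonnegative with
exponentially small probability, with a rate depending only on the bounds. -/
theorem exists_chernoff_rate {K c : ℝ} (hK : 0 < K) (hc : 0 < c) :
    ∃ r : ℝ, 0 < r ∧ r < 1 ∧ ∀ {α : Type} [Fintype α] (w Y : α → ℝ), (∀ a, 0 ≤ w a) →
      ∑ a, w a = 1 → (∀ a, |Y a| ≤ K) → ∑ a, w a * Y a ≤ -c → ∀ m : ℕ,
      prodExp w (fun x : Fin m → α => if 0 ≤ ∑ i, Y (x i) then (1 : ℝ) else 0) ≤ r ^ m := by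
  -- `t * K ≤ 1` permits the quadratic bound on `exp`, and `t * K ^ 2 ≤ c / 2` keeps the quadratic
  -- term below half of the drift `t * c`; the other half is the rate.
  set t := min (1 / K) (c / (2 * K ^ 2)) with ht
  have ht0 : 0 < t := lt_min (by positivity) (by positivity)
  have htK : t * K ≤ 1 := by
    have := mul_le_mul_of_nonneg_right (min_le_left (1 / K) (c / (2 * K ^ 2))) hK.le
    rwa [div_mul_cancel₀ _ hK.ne'] at this
  have htc : t * K ^ 2 ≤ c / 2 := by
    have := mul_le_mul_of_nonneg_right (min_le_right (1 / K) (c / (2 * K ^ 2))) (sq_nonneg K)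
    refine this.trans_eq ?_
    field_simp
  refine ⟨Real.exp (-(t * c / 2)), Real.exp_pos _, by rw [Real.exp_lt_one_iff]; nlinarith, ?_⟩
  intro α _ w Y hw hw1 hY hE m
  have h1 : ∀ x : Fin m → α, (if 0 ≤ ∑ i, Y (x i) then (1 : ℝ) else 0) ≤
      ∏ i, Real.exp (t * Y (x i)) := by
    intro x
    rw [← Real.exp_sum, ← Finset.mul_sum]
    split_ifs with h
    · exact Real.one_le_exp (mul_nonneg ht0.le h)
    · exact (Real.exp_pos _).le
  refine (prodExp_mono hw h1).trans ?_
  rw [prodExp_prod w (fun _ a => Real.exp (t * Y a)), Finset.prod_const, Finset.card_univ,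
    Fintype.card_fin]
  refine pow_le_pow_left₀ (Finset.sum_nonneg fun a _ => mul_nonneg (hw a) (Real.exp_pos _).le) ?_ m
  have h2 : ∀ a, Real.exp (t * Y a) ≤ 1 + t * Y a + t * (c / 2) := by
    intro a
    have hab : |t * Y a| ≤ 1 := by
      rw [abs_mul, abs_of_pos ht0]
      exact (mul_le_mul_of_nonneg_left (hY a) ht0.le).trans htK
    have := (abs_le.1 (Real.abs_exp_sub_one_sub_id_le hab)).2
    have h3 : (Y a) ^ 2 ≤ K ^ 2 := sq_le_sq' (neg_le_of_abs_le (hY a)) (le_of_abs_le (hY a))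
    have h4 : t * (t * (Y a) ^ 2) ≤ t * (c / 2) := by
      refine mul_le_mul_of_nonneg_left (le_trans ?_ htc) ht0.le
      exact mul_le_mul_of_nonneg_left h3 ht0.le
    nlinarith
  calc ∑ a, w a * Real.exp (t * Y a) ≤ ∑ a, w a * (1 + t * Y a + t * (c / 2)) :=
        Finset.sum_le_sum fun a _ => mul_le_mul_of_nonneg_left (h2 a) (hw a)
    _ = (1 + t * (c / 2)) * ∑ a, w a + t * ∑ a, w a * Y a := by
        rw [Finset.mul_sum, Finset.mul_sum, ← Finset.sum_add_distrib]
        exact Finset.sum_congr rfl fun a _ => by ring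
    _ ≤ -(t * c / 2) + 1 := by
        rw [hw1]; nlinarith
    _ ≤ _ := Real.add_one_le_exp _

/-! ### Generating function and upper tail of Poisson laws -/

section Poisson

open ProbabilityTheory MeasureTheory Filter Topology

theorem integrable_poissonMeasure_of_abs_le (l : NNReal) {F : ℕ → ℝ} {C : ℝ}
    (h : ∀ m, |F m| ≤ C) : Integrable F (poissonMeasure l) :=
  Integrable.of_bound (by fun_prop) C (Eventually.of_forall h)

/-- The probability generating function of a Poisson law. -/
theorem hasSum_poisson_pow (l : NNReal) (r : ℝ) :
    HasSum (fun m : ℕ => Real.exp (-l) * l ^ m / (m.factorial : ℝ) * r ^ m)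
      (Real.exp (l * (r - 1))) := by
  have := (NormedSpace.expSeries_div_hasSum_exp ((l : ℝ) * r)).mul_left (Real.exp (-l))
  rw [← Real.exp_eq_exp_ℝ, ← Real.exp_add] at this
  convert! this using 1
  · ext m; rw [mul_pow]; ring
  · ring_nf

theorem integral_poissonMeasure_pow (l : NNReal) (r : ℝ) :
    ∫ m : ℕ, r ^ m ∂(poissonMeasure l) = Real.exp (l * (r - 1)) := by
  rw [integral_poissonMeasure]
  exact (hasSum_poisson_pow l r).tsum_eq

theorem integrable_poissonMeasure_pow (l : NNReal) {r : ℝ} (hr : 0 ≤ r) :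
    Integrable (fun m : ℕ => r ^ m) (poissonMeasure l) := by
  rw [integrable_poissonMeasure_iff]
  convert! (hasSum_poisson_pow l r).summable using 2
  rw [Real.norm_of_nonneg (pow_nonneg hr _)]

/-- The upper tail of Poisson laws with rate growing linearly. -/
theorem exists_poisson_tail {η : ℝ} (hη : 0 < η) :
    ∃ c : ℝ, 0 < c ∧ ∀ l : NNReal,
      ∫ m : ℕ, (if (1 + η) * l < m then (1 : ℝ) else 0) ∂(poissonMeasure l) ≤
        Real.exp (-(c * l)) := by
  -- Exponential Markov inequality with parameter `t`: the exponent is at most `l * (t + t ^ 2) - t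
  -- * (1 + η) * l`, which `2 * t ≤ η` brings below `-t ^ 2 * l`.
  obtain ⟨t, ht0, ht1, htη⟩ : ∃ t : ℝ, 0 < t ∧ t ≤ 1 ∧ 2 * t ≤ η :=
    ⟨min 1 (η / 2), lt_min one_pos (by positivity), min_le_left _ _,
      by linarith [min_le_right 1 (η / 2)]⟩
  have hexp : Real.exp t ≤ 1 + t + t ^ 2 := by
    have := (abs_le.1 (Real.abs_exp_sub_one_sub_id_le (x := t) (by rwa [abs_of_pos ht0]))).2
    linarith
  refine ⟨t ^ 2, by positivity, fun l => ?_⟩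
  have h1 : ∀ m : ℕ, (if (1 + η) * l < m then (1 : ℝ) else 0) ≤
      Real.exp (-(t * ((1 + η) * l))) * (Real.exp t) ^ m := by
    intro m
    rw [← Real.exp_nat_mul, ← Real.exp_add]
    split_ifs with h
    · exact Real.one_le_exp (by nlinarith)
    · exact (Real.exp_pos _).le
  have h2 : Integrable (fun m : ℕ => Real.exp (-(t * ((1 + η) * l))) * (Real.exp t) ^ m)
      (poissonMeasure l) := (integrable_poissonMeasure_pow l (Real.exp_pos _).le).const_mul _
  refine (integral_mono (integrable_poissonMeasure_of_abs_le (C := 1) l fun m => ?_) h2 h1).trans ?_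
  · split_ifs <;> simp
  rw [integral_const_mul, integral_poissonMeasure_pow, ← Real.exp_add, Real.exp_le_exp]
  have hl : (0 : ℝ) ≤ l := l.2
  have : (l : ℝ) * (Real.exp t - 1) ≤ l * (t + t ^ 2) :=
    mul_le_mul_of_nonneg_left (by linarith) hl
  nlinarith [mul_nonneg hl (mul_nonneg ht0.le (sub_nonneg.2 htη))]

end Poisson

open Filter Topology

/-! ### Empirical distributions and their concentration -/

section Empirical

variable {α : Type} [Fintype α] [DecidableEq α] {n : ℕ}

/-- The empirical distribution of `τ`. -/
def emp (τ : Fin n → α) (i : α) : ℝ :=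
  ((Finset.univ.filter fun v => τ v = i).card : ℝ) / n

theorem emp_nonneg (τ : Fin n → α) (i : α) : 0 ≤ emp τ i := by
  unfold emp; positivity

theorem card_eq_mul_emp (hn : 0 < n) (τ : Fin n → α) (i : α) :
    ((Finset.univ.filter fun v => τ v = i).card : ℝ) = n * emp τ i := by
  have : (n : ℝ) ≠ 0 := by positivity
  unfold emp; field_simp

theorem mul_emp (hn : 0 < n) (τ : Fin n → α) (i : α) :
    n * emp τ i = ∑ v, if τ v = i then (1 : ℝ) else 0 := by
  rw [← card_eq_mul_emp hn, Finset.sum_boole]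

theorem sum_emp (hn : 0 < n) (τ : Fin n → α) : ∑ i, emp τ i = 1 := by
  have hn' : (n : ℝ) ≠ 0 := by positivity
  have : (n : ℝ) * ∑ i, emp τ i = n * 1 := by
    rw [Finset.mul_sum]
    simp only [mul_emp hn]
    rw [Finset.sum_comm]
    simp
  exact mul_left_cancel₀ hn' this

/-- Summing over vectors of variables amounts to independent draws from the empirical law. -/
theorem sum_comp_eq {k : ℕ} (hn : 0 < n) (τ : Fin n → α) (F : (Fin k → α) → ℝ) :
    ∑ v : Fin k → Fin n, F (fun j => τ (v j)) = (n : ℝ) ^ k * prodExp (emp τ) F := by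
  have h1 : ∀ v : Fin k → Fin n, F (fun j => τ (v j)) =
      ∑ x : Fin k → α, (∏ j, if τ (v j) = x j then (1 : ℝ) else 0) * F x := by
    intro v
    rw [Finset.sum_eq_single (fun j => τ (v j))]
    · simp
    · intro x _ hx
      have : ∃ j, τ (v j) ≠ x j := by
        by_contra! h
        exact hx (funext h).symm
      obtain ⟨j, hj⟩ := this
      rw [Finset.prod_eq_zero (Finset.mem_univ j) (by simp [hj]), zero_mul]
    · simp
  simp only [h1]
  rw [Finset.sum_comm]
  simp only [← Finset.sum_mul, prodExp, Finset.mul_sum]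
  refine Finset.sum_congr rfl fun x _ => ?_
  rw [← mul_assoc]
  congr 1
  have := Finset.prod_univ_sum (fun _ : Fin k => (Finset.univ : Finset (Fin n)))
    (fun j u => if τ u = x j then (1 : ℝ) else 0)
  rw [Fintype.piFinset_univ] at this
  rw [← this]
  simp only [← mul_emp hn]
  rw [Finset.prod_mul_distrib, Finset.prod_const, Finset.card_univ, Fintype.card_fin]

/-- The expectation of `F` for independent entries of law `μ`, except that entry `s` equals `i`. -/
def pinned {k : ℕ} (μ : α → ℝ) (s : Fin k) (i : α) (F : (Fin k → α) → ℝ) : ℝ :=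
  ∑ x : Fin k → α, if x s = i then (∏ j ∈ Finset.univ.erase s, μ (x j)) * F x else 0

/-- Fixing entry `s` removes one of the `k` free draws, hence the factor `n ^ k / n`. Only the
community of `w` matters, which makes hit probabilities a function of the community. -/
theorem sum_pinned_comp_eq {k : ℕ} (hn : 0 < n) (τ : Fin n → α) (s : Fin k) (w : Fin n)
    (F : (Fin k → α) → ℝ) :
    ∑ v : Fin k → Fin n, (if v s = w then F (fun j => τ (v j)) else 0) =
      (n : ℝ) ^ k / n * pinned (emp τ) s (τ w) F := by
  have hn' : (n : ℝ) ≠ 0 := by positivity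
  -- The constraint `v s = w` is absorbed into the factor of index `s`, so that the sum over `v`
  -- still factorises over positions.
  have h1 : ∀ v : Fin k → Fin n, (if v s = w then F (fun j => τ (v j)) else 0) =
      ∑ x : Fin k → α, (∏ j, if (j = s → v j = w) ∧ τ (v j) = x j then (1 : ℝ) else 0) * F x := by
    intro v
    rw [Finset.sum_eq_single (fun j => τ (v j))]
    · split_ifs with h
      · rw [Finset.prod_eq_one, one_mul]
        intro j _
        rw [if_pos]
        exact ⟨fun hj => hj ▸ h, rfl⟩
      · rw [Finset.prod_eq_zero (Finset.mem_univ s), zero_mul]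
        rw [if_neg]
        exact fun h' => h (h'.1 rfl)
    · intro x _ hx
      have : ∃ j, τ (v j) ≠ x j := by
        by_contra! h
        exact hx (funext h).symm
      obtain ⟨j, hj⟩ := this
      rw [Finset.prod_eq_zero (Finset.mem_univ j) (by simp [hj]), zero_mul]
    · simp
  simp only [h1]
  rw [Finset.sum_comm]
  simp only [← Finset.sum_mul, pinned, Finset.mul_sum]
  refine Finset.sum_congr rfl fun x _ => ?_
  have := Finset.prod_univ_sum (fun _ : Fin k => (Finset.univ : Finset (Fin n)))
    (fun j u => if (j = s → u = w) ∧ τ u = x j then (1 : ℝ) else 0)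
  rw [Fintype.piFinset_univ] at this
  rw [← this, ← Finset.mul_prod_erase _ _ (Finset.mem_univ s)]
  have h2 : ∏ j ∈ Finset.univ.erase s,
      ∑ u : Fin n, (if (j = s → u = w) ∧ τ u = x j then (1 : ℝ) else 0) =
      ∏ j ∈ Finset.univ.erase s, (n * emp τ (x j)) := by
    refine Finset.prod_congr rfl fun j hj => ?_
    rw [mul_emp hn]
    simp [Finset.ne_of_mem_erase hj]
  have h3 : ∑ u : Fin n, (if (s = s → u = w) ∧ τ u = x s then (1 : ℝ) else 0) =
      if x s = τ w then 1 else 0 := by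
    rw [Finset.sum_eq_single w]
    · simp [eq_comm]
    · intro u _ hu; simp [hu]
    · simp
  rw [h2, h3, Finset.prod_mul_distrib, Finset.prod_const, Finset.card_erase_of_mem
    (Finset.mem_univ s), Finset.card_univ, Fintype.card_fin]
  have hk : (n : ℝ) ^ k = n ^ (k - 1) * n := by
    rw [← pow_succ, Nat.sub_add_cancel (s.pos)]
  rw [hk, mul_div_cancel_right₀ _ hn']
  split_ifs <;> ring

theorem continuous_prodExp {k : ℕ} (F : (Fin k → α) → ℝ) :
    Continuous fun μ : α → ℝ => prodExp μ F := by
  unfold prodExp; fun_prop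

theorem continuous_pinned {k : ℕ} (s : Fin k) (i : α) (F : (Fin k → α) → ℝ) :
    Continuous fun μ : α → ℝ => pinned μ s i F := by
  unfold pinned
  refine continuous_finsetSum _ fun x _ => ?_
  split_ifs <;> fun_prop

/-- A law of large numbers for empirical distributions, with an exponential rate. -/
theorem exists_emp_rate {π : α → ℝ} (hπ : ∀ i, 0 ≤ π i) (hπ1 : ∑ i, π i = 1) {δ : ℝ} (hδ : 0 < δ) :
    ∃ r : ℝ, 0 < r ∧ r < 1 ∧ ∀ n : ℕ, 0 < n → ∀ i : α,
      prodExp (ι := Fin n) π (fun σ => if δ ≤ |emp σ i - π i| then (1 : ℝ) else 0) ≤ 2 * r ^ n := by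
  -- The variables are `±(1{σ v = i} - π i) - δ`: bounded by `1 + δ`, with mean exactly `-δ`. The
  -- two signs give the two tails.
  obtain ⟨r, hr0, hr1, hr⟩ := exists_chernoff_rate (K := 1 + δ) (by positivity) hδ
  refine ⟨r, hr0, hr1, fun n hn i => ?_⟩
  have hn' : (0 : ℝ) < n := by exact_mod_cast hn
  have hi1 : π i ≤ 1 := hπ1 ▸ Finset.single_le_sum (fun j _ => hπ j) (Finset.mem_univ i)
  have hmean : ∑ a, π a * (if a = i then (1 : ℝ) else 0) = π i := by simp
  have key : ∀ e : ℝ, |e| = 1 → prodExp (ι := Fin n) π (fun σ =>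
      if 0 ≤ ∑ v, (e * ((if σ v = i then (1 : ℝ) else 0) - π i) - δ) then (1 : ℝ) else 0) ≤
      r ^ n := by
    intro e he
    refine hr π (fun a => e * ((if a = i then (1 : ℝ) else 0) - π i) - δ) hπ hπ1 ?_ ?_ n
    · intro a
      refine (abs_sub _ _).trans ?_
      rw [abs_mul, he, one_mul, abs_of_pos hδ]
      gcongr
      rw [abs_le]
      have := hπ i
      split_ifs <;> constructor <;> linarith
    · have : ∑ a, π a * (e * ((if a = i then (1 : ℝ) else 0) - π i) - δ) =
          e * (∑ a, π a * (if a = i then (1 : ℝ) else 0)) - e * π i * ∑ a, π a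
            - δ * ∑ a, π a := by
        simp only [Finset.mul_sum, ← Finset.sum_sub_distrib]
        exact Finset.sum_congr rfl fun a _ => by ring
      rw [this, hmean, hπ1]
      linarith
  have hsum : ∀ (e : ℝ) (σ : Fin n → α),
      ∑ v, (e * ((if σ v = i then (1 : ℝ) else 0) - π i) - δ) = n * (e * (emp σ i - π i) - δ) := by
    intro e σ
    rw [Finset.sum_sub_distrib, ← Finset.mul_sum, Finset.sum_sub_distrib, ← mul_emp hn]
    simp only [Finset.sum_const, Finset.card_univ, Fintype.card_fin, nsmul_eq_mul]
    ring
  refine (prodExp_mono hπ (G := fun σ =>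
    (if 0 ≤ ∑ v, ((1 : ℝ) * ((if σ v = i then (1 : ℝ) else 0) - π i) - δ) then (1 : ℝ) else 0) +
    (if 0 ≤ ∑ v, ((-1 : ℝ) * ((if σ v = i then (1 : ℝ) else 0) - π i) - δ)
      then (1 : ℝ) else 0)) ?_).trans ?_
  · intro σ
    simp only [hsum]
    by_cases h : δ ≤ |emp σ i - π i|
    · rw [if_pos h]
      rcases le_abs.1 h with h' | h'
      · rw [if_pos (mul_nonneg hn'.le (by linarith))]
        split_ifs <;> norm_num
      · rw [add_comm, if_pos (mul_nonneg hn'.le (by linarith))]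
        split_ifs <;> norm_num
    · rw [if_neg h]
      split_ifs <;> norm_num
  · rw [prodExp_add]
    linarith [key 1 (by norm_num), key (-1) (by norm_num)]

-- A union bound over the finitely many coordinates. In this form any condition valid near `π` can
-- be imposed on the empirical law at vanishing cost.
open Classical in
theorem tendsto_emp_not_mem {π : α → ℝ} (hπ : ∀ i, 0 ≤ π i) (hπ1 : ∑ i, π i = 1)
    {U : Set (α → ℝ)} (hU : U ∈ 𝓝 π) :
    Tendsto (fun n : ℕ => prodExp (ι := Fin n) π (fun σ => if emp σ ∈ U then (0 : ℝ) else 1))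
      atTop (𝓝 0) := by
  obtain ⟨δ, hδ, hδU⟩ := Metric.mem_nhds_iff.1 hU
  obtain ⟨r, hr0, hr1, hr⟩ := exists_emp_rate hπ hπ1 hδ
  have hlim : Tendsto (fun n : ℕ => (Fintype.card α : ℝ) * (2 * r ^ n)) atTop (𝓝 0) := by
    have := ((tendsto_pow_atTop_nhds_zero_of_lt_one hr0.le hr1).const_mul 2).const_mul
      (Fintype.card α : ℝ)
    simpa using this
  refine tendsto_of_tendsto_of_tendsto_of_le_of_le' tendsto_const_nhds hlim ?_ ?_
  · exact Eventually.of_forall fun n => prodExp_nonneg hπ fun σ => by split_ifs <;> norm_num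
  filter_upwards [eventually_gt_atTop 0] with n hn
  have h1 : ∀ σ : Fin n → α, (if emp σ ∈ U then (0 : ℝ) else 1) ≤
      ∑ i, if δ ≤ |emp σ i - π i| then (1 : ℝ) else 0 := by
    intro σ
    have h0 : ∀ i ∈ (Finset.univ : Finset α), 0 ≤ (if δ ≤ |emp σ i - π i| then (1 : ℝ) else 0) :=
      fun i _ => by split_ifs <;> norm_num
    split_ifs with h
    · exact Finset.sum_nonneg h0
    · obtain ⟨i, hi⟩ : ∃ i, δ ≤ |emp σ i - π i| := by
        by_contra! h'
        refine h (hδU ?_)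
        rw [Metric.mem_ball, dist_pi_lt_iff hδ]
        exact h'
      refine le_trans ?_ (Finset.single_le_sum h0 (Finset.mem_univ i))
      rw [if_pos hi]
  refine (prodExp_mono hπ h1).trans ?_
  rw [prodExp_sum]
  refine (Finset.sum_le_sum fun i _ => hr n hn i).trans_eq ?_
  rw [Finset.sum_const, Finset.card_univ, nsmul_eq_mul]

end Empirical

/-! ### The planted law as an iterated expectation, and bounds on the overlap -/

section Planted

variable {k q : ℕ} {Ψ : Finset (Weight k q)} {p : Weight k q → ℝ} {π : Fin q → ℝ} {n : ℕ}

theorem mean_eq_prodExp (π : Fin q → ℝ) (ψ : Weight k q) : mean π ψ = prodExp π ψ := rfl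

/-- The factor `π τ` cancels. Unlike the quotient, `pinned` is polynomial in the law, so it can be
evaluated at empirical laws, even with empty communities, and compared with its value at `π` by
continuity. -/
theorem condMean_eq_pinned (hπ : ∀ i, 0 < π i) (ψ : Weight k q) (s : Fin k) (i : Fin q) :
    condMean π ψ s i = pinned π s i ψ := by
  have := (hπ i).ne'
  rw [condMean, div_eq_iff this, pinned, Finset.sum_mul]
  refine Finset.sum_congr rfl fun x _ => ?_
  split_ifs with h
  · rw [← Finset.mul_prod_erase _ _ (Finset.mem_univ s), h]; ring
  · ring

theorem sum_mul_pinned (μ : Fin q → ℝ) (s : Fin k) (F : (Fin k → Fin q) → ℝ) :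
    ∑ i, μ i * pinned μ s i F = prodExp μ F := by
  simp only [pinned, Finset.mul_sum, prodExp]
  rw [Finset.sum_comm]
  refine Finset.sum_congr rfl fun x _ => ?_
  simp only [mul_ite, mul_zero, Finset.sum_ite_eq, Finset.mem_univ, if_true]
  rw [← Finset.mul_prod_erase _ _ (Finset.mem_univ s)]; ring

/-- The mean weight of a clause whose variables are independent of law `μ`. -/
def wmean (Ψ : Finset (Weight k q)) (p : Weight k q → ℝ) (μ : Fin q → ℝ) : ℝ :=
  ∑ ψ ∈ Ψ, p ψ * mean μ ψ

theorem continuous_wmean : Continuous (wmean Ψ p) := by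
  unfold wmean
  exact continuous_finsetSum _ fun ψ _ => (continuous_prodExp ψ).const_mul _

theorem IsWeightPrior.exists_bounds (hp : IsWeightPrior Ψ p) :
    ∃ lo hi : ℝ, 0 < lo ∧ lo ≤ hi ∧ ∀ ψ ∈ Ψ, ∀ x, lo ≤ ψ x ∧ ψ x ≤ hi := by
  have hne : Ψ.Nonempty := by
    by_contra h
    have := hp.sum_eq_one
    rw [Finset.not_nonempty_iff_eq_empty.1 h] at this
    simp at this
  rcases isEmpty_or_nonempty (Fin k → Fin q) with hE | hN
  · exact ⟨1, 1, one_pos, le_rfl, fun ψ _ x => (hE.false x).elim⟩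
  let s := Ψ ×ˢ (Finset.univ : Finset (Fin k → Fin q))
  have hs : s.Nonempty := hne.product Finset.univ_nonempty
  obtain ⟨a, ha, hamin⟩ := s.exists_min_image (fun z => z.1 z.2) hs
  obtain ⟨b, hb, hbmax⟩ := s.exists_max_image (fun z => z.1 z.2) hs
  refine ⟨a.1 a.2, b.1 b.2, hp.weight_pos _ (Finset.mem_product.1 ha).1 _, hamin b hb,
    fun ψ hψ x => ?_⟩
  have : (ψ, x) ∈ s := Finset.mem_product.2 ⟨hψ, Finset.mem_univ _⟩
  exact ⟨hamin _ this, hbmax _ this⟩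

theorem IsWeightPrior.le_wmean (hp : IsWeightPrior Ψ p) {lo : ℝ} (h : ∀ ψ ∈ Ψ, ∀ x, lo ≤ ψ x)
    {μ : Fin q → ℝ} (hμ : ∀ i, 0 ≤ μ i) (hμ1 : ∑ i, μ i = 1) : lo ≤ wmean Ψ p μ := by
  calc lo = ∑ ψ ∈ Ψ, p ψ * lo := by rw [← Finset.sum_mul, hp.sum_eq_one, one_mul]
    _ ≤ _ := Finset.sum_le_sum fun ψ hψ => mul_le_mul_of_nonneg_left
      (const_le_prodExp hμ hμ1 (h ψ hψ)) (hp.pos ψ hψ).le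

theorem IsWeightPrior.wmean_pos (hp : IsWeightPrior Ψ p) {μ : Fin q → ℝ} (hμ : ∀ i, 0 ≤ μ i)
    (hμ1 : ∑ i, μ i = 1) : 0 < wmean Ψ p μ := by
  obtain ⟨lo, hi, hlo, -, h⟩ := hp.exists_bounds
  exact hlo.trans_le (hp.le_wmean (fun ψ hψ x => (h ψ hψ x).1) hμ hμ1)

/-- The normalisation sees the assignment only through its empirical law. It is the only factor of
the likelihood that couples different components of the graph. -/
theorem clauseProb_denom (hn : 0 < n) (σ : Fin n → Fin q) :
    ∑ ψ ∈ Ψ, p ψ * ∑ v : Fin k → Fin n, ψ (fun s => σ (v s)) =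
      (n : ℝ) ^ k * wmean Ψ p (emp σ) := by
  rw [wmean, Finset.mul_sum]
  refine Finset.sum_congr rfl fun ψ _ => ?_
  rw [sum_comp_eq hn σ ψ, mean_eq_prodExp]; ring

theorem clauseProb_eq (hn : 0 < n) (σ : Fin n → Fin q) (c : Clause Ψ n) :
    clauseProb Ψ p σ c =
      p c.2.1 * c.2.1 (fun s => σ (c.1 s)) / ((n : ℝ) ^ k * wmean Ψ p (emp σ)) := by
  rw [clauseProb, clauseProb_denom hn]

theorem IsWeightPrior.clauseProb_nonneg (hp : IsWeightPrior Ψ p) (σ : Fin n → Fin q)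
    (c : Clause Ψ n) : 0 ≤ clauseProb Ψ p σ c := by
  refine div_nonneg (mul_nonneg (hp.pos _ c.2.2).le (hp.weight_pos _ c.2.2 _).le) ?_
  exact Finset.sum_nonneg fun ψ hψ => mul_nonneg (hp.pos _ hψ).le
    (Finset.sum_nonneg fun v _ => (hp.weight_pos _ hψ _).le)

/-- Expectations under the law of a clause. -/
theorem sum_clauseProb_mul (hn : 0 < n) (σ : Fin n → Fin q) (f : Clause Ψ n → ℝ) :
    ∑ c, clauseProb Ψ p σ c * f c = (∑ ψ : {ψ // ψ ∈ Ψ}, p ψ.1 * ∑ v : Fin k → Fin n,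
      ψ.1 (fun s => σ (v s)) * f (v, ψ)) / ((n : ℝ) ^ k * wmean Ψ p (emp σ)) := by
  rw [Fintype.sum_prod_type, Finset.sum_comm, Finset.sum_div]
  refine Finset.sum_congr rfl fun ψ _ => ?_
  rw [Finset.mul_sum, Finset.sum_div]
  refine Finset.sum_congr rfl fun v _ => ?_
  rw [clauseProb_eq hn]; ring

theorem IsWeightPrior.sum_clauseProb (hp : IsWeightPrior Ψ p) (hn : 0 < n) (σ : Fin n → Fin q) :
    ∑ c, clauseProb Ψ p σ c = 1 := by
  have h := sum_clauseProb_mul (Ψ := Ψ) (p := p) hn σ (fun _ => 1)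
  simp only [mul_one] at h
  have hpos := hp.wmean_pos (emp_nonneg σ) (sum_emp hn σ)
  have hn' : (0 : ℝ) < n := by exact_mod_cast hn
  rw [h, div_eq_one_iff_eq (by positivity), ← clauseProb_denom hn,
    ← Finset.sum_coe_sort Ψ (fun ψ => p ψ * ∑ v : Fin k → Fin n, ψ (fun s => σ (v s)))]

/-- The joint law of the planted assignment and of the clauses, as an iterated expectation. -/
theorem sum_plantedProb_mul {m : ℕ} (F : (Fin n → Fin q) → (Fin m → Clause Ψ n) → ℝ) :
    ∑ σ, ∑ g, plantedProb Ψ p π σ g * F σ g =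
      prodExp π (fun σ => prodExp (clauseProb Ψ p σ) (F σ)) := by
  simp only [plantedProb, prodExp, Finset.mul_sum, mul_assoc]

theorem overlap_nonneg (σ₁ σ₂ : Fin n → Fin q) : 0 ≤ overlap σ₁ σ₂ := by
  refine Real.iSup_nonneg fun Γ => ?_
  positivity

theorem le_overlap (σ₁ σ₂ : Fin n → Fin q) (Γ : Equiv.Perm (Fin q)) :
    (1 / (q : ℝ)) * ∑ i : Fin q,
      ((Finset.univ.filter fun v => σ₁ v = i ∧ σ₂ v = Γ i).card : ℝ) /
        ((Finset.univ.filter fun v => σ₁ v = i).card : ℝ) ≤ overlap σ₁ σ₂ :=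
  le_ciSup (f := fun Γ : Equiv.Perm (Fin q) => (1 / (q : ℝ)) * ∑ i : Fin q,
      ((Finset.univ.filter fun v => σ₁ v = i ∧ σ₂ v = Γ i).card : ℝ) /
        ((Finset.univ.filter fun v => σ₁ v = i).card : ℝ)) (Set.finite_range _).bddAbove Γ

theorem overlap_le_one (σ₁ σ₂ : Fin n → Fin q) : overlap σ₁ σ₂ ≤ 1 := by
  refine ciSup_le fun Γ => ?_
  have h : ∀ i ∈ (Finset.univ : Finset (Fin q)),
      ((Finset.univ.filter fun v => σ₁ v = i ∧ σ₂ v = Γ i).card : ℝ) /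
        ((Finset.univ.filter fun v => σ₁ v = i).card : ℝ) ≤ 1 := by
    intro i _
    refine div_le_one_of_le₀ ?_ (by positivity)
    exact_mod_cast Finset.card_le_card fun v hv => by
      simp only [Finset.mem_filter] at hv ⊢
      exact ⟨hv.1, hv.2.1⟩
  calc _ ≤ (1 / (q : ℝ)) * ∑ i : Fin q, (1 : ℝ) := by gcongr with i hi; exact h i hi
    _ = (1 / (q : ℝ)) * q := by simp
    _ ≤ 1 := by rw [one_div]; exact inv_mul_le_one

/-- The expected overlap for a given number `m` of clauses. -/
def overlapGiven (Ψ : Finset (Weight k q)) (p : Weight k q → ℝ) (π : Fin q → ℝ) (n : ℕ)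
    (est : FactorGraph Ψ n → (Fin n → Fin q)) (m : ℕ) : ℝ :=
  prodExp π (fun σ => prodExp (clauseProb Ψ p σ) (fun g : Fin m → Clause Ψ n =>
    overlap σ (est ⟨m, g⟩)))

theorem expectedOverlap_eq (d : ℝ) (est : FactorGraph Ψ n → (Fin n → Fin q)) :
    expectedOverlap Ψ p π d n est = ∫ m : ℕ, overlapGiven Ψ p π n est m
      ∂(ProbabilityTheory.poissonMeasure (d * n / k).toNNReal) := by
  unfold expectedOverlap overlapGiven
  congr 1
  ext m
  exact sum_plantedProb_mul (fun σ g => overlap σ (est ⟨m, g⟩))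

theorem overlapGiven_nonneg (hp : IsWeightPrior Ψ p) (hπ : IsCommunityPrior π)
    (est : FactorGraph Ψ n → (Fin n → Fin q)) (m : ℕ) : 0 ≤ overlapGiven Ψ p π n est m :=
  prodExp_nonneg (fun i => (hπ.pos i).le) fun σ => prodExp_nonneg (hp.clauseProb_nonneg σ)
    fun _ => overlap_nonneg _ _

theorem overlapGiven_le_one (hp : IsWeightPrior Ψ p) (hπ : IsCommunityPrior π) (hn : 0 < n)
    (est : FactorGraph Ψ n → (Fin n → Fin q)) (m : ℕ) : overlapGiven Ψ p π n est m ≤ 1 :=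
  prodExp_le_const (fun i => (hπ.pos i).le) hπ.sum_eq_one fun σ =>
    prodExp_le_const (hp.clauseProb_nonneg σ) (hp.sum_clauseProb hn σ) fun _ => overlap_le_one _ _

theorem integrable_overlapGiven (hp : IsWeightPrior Ψ p) (hπ : IsCommunityPrior π) (hn : 0 < n)
    (est : FactorGraph Ψ n → (Fin n → Fin q)) (l : NNReal) :
    MeasureTheory.Integrable (overlapGiven Ψ p π n est) (ProbabilityTheory.poissonMeasure l) :=
  integrable_poissonMeasure_of_abs_le (C := 1) l fun m => by
    rw [abs_of_nonneg (overlapGiven_nonneg hp hπ est m)]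
    exact overlapGiven_le_one hp hπ hn est m

theorem expectedOverlap_nonneg (hp : IsWeightPrior Ψ p) (hπ : IsCommunityPrior π) (d : ℝ)
    (est : FactorGraph Ψ n → (Fin n → Fin q)) : 0 ≤ expectedOverlap Ψ p π d n est := by
  rw [expectedOverlap_eq]
  exact MeasureTheory.integral_nonneg fun m => overlapGiven_nonneg hp hπ est m

theorem expectedOverlap_le_one (hp : IsWeightPrior Ψ p) (hπ : IsCommunityPrior π) (hn : 0 < n)
    (d : ℝ) (est : FactorGraph Ψ n → (Fin n → Fin q)) : expectedOverlap Ψ p π d n est ≤ 1 := by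
  rw [expectedOverlap_eq]
  refine (MeasureTheory.integral_mono (integrable_overlapGiven hp hπ hn est _)
    (MeasureTheory.integrable_const 1) (overlapGiven_le_one hp hπ hn est)).trans ?_
  simp

/-- Weak recovery is possible if the expected overlap exceeds a sequence with limit above `1/q`. -/
theorem weakRecoveryPossible_of_tendsto (hp : IsWeightPrior Ψ p) (hπ : IsCommunityPrior π) {d : ℝ}
    (est : ∀ n : ℕ, FactorGraph Ψ n → (Fin n → Fin q)) {u : ℕ → ℝ} {l : ℝ} (hl : 1 / (q : ℝ) < l)
    (hu : Tendsto u atTop (𝓝 l)) (h : ∀ᶠ n in atTop, u n ≤ expectedOverlap Ψ p π d n (est n)) :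
    WeakRecoveryPossible Ψ p π d := by
  refine ⟨(l - 1 / q) / 2, by linarith, est, ?_⟩
  have h1 : ∀ᶠ n in atTop, 1 / (q : ℝ) + (l - 1 / q) / 2 ≤
      expectedOverlap Ψ p π d n (est n) := by
    filter_upwards [h, hu.eventually_const_le (show 1 / (q : ℝ) + (l - 1 / q) / 2 < l by linarith)]
      with n h2 h3 using h3.trans h2
  refine le_limsup_of_frequently_le h1.frequently ?_
  -- A real `limsup` is meaningful only for bounded sequences; the overlap is at most `1`.
  refine ⟨1, eventually_map.2 ?_⟩
  filter_upwards [eventually_gt_atTop 0] with n hn using expectedOverlap_le_one hp hπ hn d _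

theorem toNNReal_rate {d : ℝ} (hd : 0 < d) (n : ℕ) :
    ((d * n / k).toNNReal : ℝ) = d * n / k :=
  Real.coe_toNNReal _ (by positivity)

end Planted

/-! ### Without symmetry, the degrees reveal the communities -/

section Degree

variable {k q : ℕ} {Ψ : Finset (Weight k q)} {p : Weight k q → ℝ} {π : Fin q → ℝ} {n : ℕ}

theorem integral_prodExp {ι α : Type*} [Fintype ι] [DecidableEq ι] [Fintype α] {w : α → ℝ}
    {μ : MeasureTheory.Measure ℕ} {F : (ι → α) → ℕ → ℝ}
    (hF : ∀ x, MeasureTheory.Integrable (F x) μ) :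
    ∫ m, prodExp w (fun x => F x m) ∂μ = prodExp w (fun x => ∫ m, F x m ∂μ) := by
  unfold prodExp
  rw [MeasureTheory.integral_finsetSum _ fun x _ => (hF x).const_mul _]
  exact Finset.sum_congr rfl fun x _ => MeasureTheory.integral_const_mul _ _

theorem integrable_prodExp {ι α : Type*} [Fintype ι] [DecidableEq ι] [Fintype α] {w : α → ℝ}
    {μ : MeasureTheory.Measure ℕ} {F : (ι → α) → ℕ → ℝ}
    (hF : ∀ x, MeasureTheory.Integrable (F x) μ) :
    MeasureTheory.Integrable (fun m => prodExp w (fun x => F x m)) μ :=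
  MeasureTheory.integrable_finsetSum _ fun x _ => (hF x).const_mul _

/-- The probability that the entry `s` of a clause with weight function `ψ` is a given variable of
community `i`. -/
def hitProb (p : Weight k q → ℝ) (ψ : {ψ // ψ ∈ Ψ}) (s : Fin k) (σ : Fin n → Fin q)
    (i : Fin q) : ℝ :=
  (p ψ.1 * pinned (emp σ) s i ψ.1 / wmean Ψ p (emp σ)) / n

open Classical in
theorem sum_clauseProb_hit (hn : 0 < n) (ψ : {ψ // ψ ∈ Ψ}) (s : Fin k) (σ : Fin n → Fin q)
    (v : Fin n) :
    ∑ c, clauseProb Ψ p σ c * (if c.2 = ψ ∧ c.1 s = v then (1 : ℝ) else 0) =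
      hitProb p ψ s σ (σ v) := by
  have hn' : (n : ℝ) ≠ 0 := by positivity
  rw [sum_clauseProb_mul hn, Finset.sum_eq_single ψ]
  · have h : ∑ x : Fin k → Fin n, ψ.1 (fun j => σ (x j)) *
        (if ψ = ψ ∧ x s = v then (1 : ℝ) else 0) =
        (n : ℝ) ^ k / n * pinned (emp σ) s (σ v) ψ.1 := by
      rw [← sum_pinned_comp_eq hn]
      refine Finset.sum_congr rfl fun x _ => ?_
      by_cases hx : x s = v <;> simp [hx]
    rw [h, hitProb]
    field_simp
  · intro ψ' _ h; simp [h]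
  · simp

open Classical in
theorem hitProb_le_one (hp : IsWeightPrior Ψ p) (hn : 0 < n) (ψ : {ψ // ψ ∈ Ψ}) (s : Fin k)
    (σ : Fin n → Fin q) (v : Fin n) : hitProb p ψ s σ (σ v) ≤ 1 := by
  rw [← sum_clauseProb_hit hn ψ s σ v]
  refine le_trans ?_ (hp.sum_clauseProb hn σ).le
  refine Finset.sum_le_sum fun c _ => mul_le_of_le_one_right (hp.clauseProb_nonneg σ c) ?_
  split_ifs <;> norm_num

open Classical in
/-- The probability that a given variable is in position `s` of no clause with weight `ψ`. -/
theorem prodExp_no_hit (hp : IsWeightPrior Ψ p) (hn : 0 < n) (ψ : {ψ // ψ ∈ Ψ}) (s : Fin k)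
    (σ : Fin n → Fin q) (v : Fin n) (m : ℕ) :
    prodExp (clauseProb Ψ p σ) (fun g : Fin m → Clause Ψ n =>
      if ∃ a, (g a).2 = ψ ∧ (g a).1 s = v then (0 : ℝ) else 1) =
      (1 - hitProb p ψ s σ (σ v)) ^ m := by
  have h : ∀ g : Fin m → Clause Ψ n, (if ∃ a, (g a).2 = ψ ∧ (g a).1 s = v then (0 : ℝ) else 1) =
      ∏ a, (1 - if (g a).2 = ψ ∧ (g a).1 s = v then (1 : ℝ) else 0) := by
    intro g
    split_ifs with h
    · obtain ⟨a, ha⟩ := h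
      rw [Finset.prod_eq_zero (Finset.mem_univ a)]
      rw [if_pos ha, sub_self]
    · push Not at h
      rw [Finset.prod_eq_one]
      intro a _
      rw [if_neg, sub_zero]
      exact fun h' => h a h'.1 h'.2
  simp only [h]
  rw [prodExp_prod (clauseProb Ψ p σ)
    (fun _ c => 1 - if c.2 = ψ ∧ c.1 s = v then (1 : ℝ) else 0)]
  simp only [mul_sub, mul_one, Finset.sum_sub_distrib, hp.sum_clauseProb hn,
    sum_clauseProb_hit hn, Finset.prod_const, Finset.card_univ, Fintype.card_fin]

open Classical in
/-- The estimator that assigns `i₂` to the variables in position `s` of some clause with weight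
function `ψ`, and `i₁` to the others. -/
def hitEst (ψ : {ψ // ψ ∈ Ψ}) (s : Fin k) (i₁ i₂ : Fin q) (n : ℕ) (g : FactorGraph Ψ n) :
    Fin n → Fin q :=
  fun v => if ∃ a, (g.2 a).2 = ψ ∧ (g.2 a).1 s = v then i₂ else i₁

-- The maximum is bounded below by its value at the identity permutation, and the communities other
-- than `i₁` and `i₂` contribute nonnegatively.
open Classical in
theorem le_overlap_hitEst (ψ : {ψ // ψ ∈ Ψ}) (s : Fin k) {i₁ i₂ : Fin q} (hi : i₁ ≠ i₂) {m : ℕ}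
    (σ : Fin n → Fin q) (g : Fin m → Clause Ψ n) :
    (1 / (q : ℝ)) *
      ((∑ v ∈ Finset.univ.filter fun v => σ v = i₁,
          if ∃ a, (g a).2 = ψ ∧ (g a).1 s = v then (0 : ℝ) else 1) /
          ((Finset.univ.filter fun v => σ v = i₁).card : ℝ) +
        (∑ v ∈ Finset.univ.filter fun v => σ v = i₂,
          (1 - if ∃ a, (g a).2 = ψ ∧ (g a).1 s = v then (0 : ℝ) else 1)) /
          ((Finset.univ.filter fun v => σ v = i₂).card : ℝ)) ≤
      overlap σ (hitEst ψ s i₁ i₂ n ⟨m, g⟩) := by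
  refine le_trans ?_ (le_overlap _ _ (Equiv.refl _))
  gcongr
  refine le_trans ?_ (Finset.sum_le_sum_of_subset_of_nonneg (Finset.subset_univ {i₁, i₂})
    fun i _ _ => by positivity)
  rw [Finset.sum_pair hi]
  refine le_of_eq ?_
  congr 2
  · rw [← Finset.filter_filter, ← Finset.sum_boole]
    refine Finset.sum_congr rfl fun v _ => ?_
    simp only [hitEst, Equiv.refl_apply]
    split_ifs with h h' h'
    · exact absurd h'.symm hi
    · rfl
    · rfl
    · exact absurd rfl h'
  · rw [← Finset.filter_filter, ← Finset.sum_boole]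
    refine Finset.sum_congr rfl fun v _ => ?_
    by_cases h : ∃ a, (g a).2 = ψ ∧ (g a).1 s = v
    · have hv : hitEst ψ s i₁ i₂ n ⟨m, g⟩ v = Equiv.refl (Fin q) i₂ := if_pos h
      rw [if_pos h, if_pos hv, sub_zero]
    · have hv : hitEst ψ s i₁ i₂ n ⟨m, g⟩ v = i₁ := if_neg h
      rw [if_neg h, if_neg (by rw [hv]; exact hi), sub_self]

/-- All variables of a community share the same no-hit probability, so averaging over the class
returns it. Positivity of `emp` excludes the convention `0/0 = 0`. -/
theorem le_prodExp_overlap_hitEst (hp : IsWeightPrior Ψ p) (hn : 0 < n) (ψ : {ψ // ψ ∈ Ψ})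
    (s : Fin k) {i₁ i₂ : Fin q} (hi : i₁ ≠ i₂) (σ : Fin n → Fin q) (h1 : 0 < emp σ i₁)
    (h2 : 0 < emp σ i₂) (m : ℕ) :
    (1 / (q : ℝ)) * ((1 - hitProb p ψ s σ i₁) ^ m + (1 - (1 - hitProb p ψ s σ i₂) ^ m)) ≤
      prodExp (clauseProb Ψ p σ) (fun g : Fin m → Clause Ψ n =>
        overlap σ (hitEst ψ s i₁ i₂ n ⟨m, g⟩)) := by
  classical
  refine le_trans (le_of_eq ?_) (prodExp_mono (hp.clauseProb_nonneg σ)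
    fun g => le_overlap_hitEst ψ s hi σ g)
  have hn' : (0 : ℝ) < n := by exact_mod_cast hn
  have hc1 : ((Finset.univ.filter fun v => σ v = i₁).card : ℝ) ≠ 0 := by
    rw [card_eq_mul_emp hn]; positivity
  have hc2 : ((Finset.univ.filter fun v => σ v = i₂).card : ℝ) ≠ 0 := by
    rw [card_eq_mul_emp hn]; positivity
  rw [prodExp_const_mul, prodExp_add]
  simp only [div_eq_mul_inv]
  rw [prodExp_mul_const, prodExp_mul_const, prodExp_sum, prodExp_sum]
  congr 2
  · rw [Finset.sum_congr rfl fun v hv => (prodExp_no_hit hp hn ψ s σ v m).trans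
      (by rw [(Finset.mem_filter.1 hv).2]), Finset.sum_const, nsmul_eq_mul]
    field_simp
  · rw [Finset.sum_congr rfl fun v hv => (prodExp_sub (w := clauseProb Ψ p σ) _ _).trans
      (by rw [prodExp_no_hit hp hn ψ s σ v m, (Finset.mem_filter.1 hv).2,
        prodExp_const (hp.sum_clauseProb hn σ)]), Finset.sum_const, nsmul_eq_mul]
    field_simp

/-- If the conditional means are not constant, the degrees reveal the communities. -/
theorem weakRecoveryPossible_of_not_sym (hk : 2 ≤ k) (hq : 2 ≤ q) (hp : IsWeightPrior Ψ p)
    (hπ : IsCommunityPrior π) (hS : ¬ SYM Ψ π) {d : ℝ} (hd : 0 < d) :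
    WeakRecoveryPossible Ψ p π d := by
  classical
  have hπ0 : ∀ i, 0 ≤ π i := fun i => (hπ.pos i).le
  have hk0 : (0 : ℝ) < k := by exact_mod_cast (by omega : 0 < k)
  have hq0 : (0 : ℝ) < q := by exact_mod_cast (by omega : 0 < q)
  -- If `pinned π s i ψ` never depended on `i`, it would equal its `π`-average, the mean, and (SYM)
  -- would hold.
  obtain ⟨ψ', hψ, s, i₁, i₂, hlt⟩ : ∃ ψ, ∃ _ : ψ ∈ Ψ, ∃ (s : Fin k) (i₁ i₂ : Fin q),
      pinned π s i₁ ψ < pinned π s i₂ ψ := by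
    by_contra! h
    refine hS fun ψ hψ s i => ?_
    rw [condMean_eq_pinned hπ.pos, mean_eq_prodExp, ← sum_mul_pinned π s ψ]
    rw [Finset.sum_congr rfl fun j _ => by rw [le_antisymm (h ψ hψ s i j) (h ψ hψ s j i)],
      ← Finset.sum_mul, hπ.sum_eq_one, one_mul]
  lift ψ' to {ψ // ψ ∈ Ψ} using hψ with ψ
  have hi : i₁ ≠ i₂ := fun h => by rw [h] at hlt; exact lt_irrefl _ hlt
  -- `A μ i` is the Poisson rate `l` times the hit probability of community `i`. So `exp (-A μ i)`
  -- is the no-hit probability, and `gap` is the excess of `q` times the overlap over `1`.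
  set A : (Fin q → ℝ) → Fin q → ℝ := fun μ i => d / k * (p ψ.1 * pinned μ s i ψ.1 / wmean Ψ p μ)
    with hA
  set gap : (Fin q → ℝ) → ℝ := fun μ => Real.exp (-A μ i₁) - Real.exp (-A μ i₂) with hgap
  have hw0 : 0 < wmean Ψ p π := hp.wmean_pos hπ0 hπ.sum_eq_one
  have hAc : ∀ i, ContinuousAt (fun μ => A μ i) π := fun i =>
    ((((continuous_pinned s i ψ.1).const_mul (p ψ.1)).continuousAt).div
      continuous_wmean.continuousAt hw0.ne').const_mul _
  have hgc : ContinuousAt gap π := (Real.continuous_exp.continuousAt.comp (hAc i₁).neg).sub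
    (Real.continuous_exp.continuousAt.comp (hAc i₂).neg)
  have hgpos : 0 < gap π := by
    simp only [hgap, sub_pos, Real.exp_lt_exp, neg_lt_neg_iff, hA]
    have := hp.pos _ ψ.2
    gcongr
  set γ := gap π / 2 with hγ
  have hγ0 : 0 < γ := by positivity
  set U : Set (Fin q → ℝ) := {μ | γ < gap μ ∧ 0 < μ i₁ ∧ 0 < μ i₂} with hU
  have hUn : U ∈ 𝓝 π := by
    have e1 : ∀ᶠ μ in 𝓝 π, γ < gap μ := hgc.eventually_const_lt (by rw [hγ]; linarith)
    have e2 : ∀ i, ∀ᶠ μ : Fin q → ℝ in 𝓝 π, 0 < μ i := fun i =>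
      (continuous_apply i).continuousAt.eventually_const_lt (hπ.pos i)
    filter_upwards [e1, e2 i₁, e2 i₂] with μ a b c using ⟨a, b, c⟩
  have hlim := tendsto_emp_not_mem hπ0 hπ.sum_eq_one hUn
  have hu := (hlim.const_sub 1).const_mul (1 / (q : ℝ) * (1 + γ))
  rw [sub_zero, mul_one] at hu
  refine weakRecoveryPossible_of_tendsto hp hπ (hitEst ψ s i₁ i₂) ?_ hu ?_
  · have : (0 : ℝ) < 1 / q := by positivity
    nlinarith
  filter_upwards [eventually_gt_atTop 0] with n hn
  have hn' : (0 : ℝ) < n := by exact_mod_cast hn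
  set l := (d * n / k).toNNReal with hl
  have hl' : (l : ℝ) = d * n / k := toNNReal_rate hd n
  rw [expectedOverlap_eq]
  set G : (Fin n → Fin q) → ℕ → ℝ := fun σ m => (if emp σ ∈ U then (1 : ℝ) else 0) *
    ((1 / (q : ℝ)) * ((1 - hitProb p ψ s σ i₁) ^ m + (1 - (1 - hitProb p ψ s σ i₂) ^ m))) with hG
  have hh : ∀ (σ : Fin n → Fin q) (i : Fin q), 0 < emp σ i → 0 ≤ 1 - hitProb p ψ s σ i := by
    intro σ i hpos
    obtain ⟨v, hv⟩ : ∃ v, σ v = i := by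
      by_contra! h
      have : emp σ i = 0 := by
        rw [emp, Finset.filter_false_of_mem fun v _ => h v]; simp
      rw [this] at hpos
      exact lt_irrefl _ hpos
    have := hitProb_le_one hp hn ψ s σ v
    rw [hv] at this
    linarith
  have hGint : ∀ σ, MeasureTheory.Integrable (G σ) (ProbabilityTheory.poissonMeasure l) := by
    intro σ
    by_cases h : emp σ ∈ U
    · refine ((MeasureTheory.Integrable.add
        (integrable_poissonMeasure_pow l (hh σ i₁ h.2.1)) ((MeasureTheory.integrable_const 1).sub
          (integrable_poissonMeasure_pow l (hh σ i₂ h.2.2)))).const_mul _).const_mul _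
    · simp only [hG, if_neg h, zero_mul]
      exact MeasureTheory.integrable_const 0
  have hGle : ∀ m, prodExp π (fun σ => G σ m) ≤ overlapGiven Ψ p π n (hitEst ψ s i₁ i₂ n) m := by
    intro m
    refine prodExp_mono hπ0 fun σ => ?_
    by_cases h : emp σ ∈ U
    · simp only [hG, if_pos h, one_mul]
      exact le_prodExp_overlap_hitEst hp hn ψ s hi σ h.2.1 h.2.2 m
    · simp only [hG, if_neg h, zero_mul]
      exact prodExp_nonneg (hp.clauseProb_nonneg σ) fun _ => overlap_nonneg _ _
  refine le_trans ?_ (MeasureTheory.integral_mono (integrable_prodExp hGint)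
    (integrable_overlapGiven hp hπ hn _ _) hGle)
  -- All constants are turned into expectations over `σ`, so that the inequality can be checked for
  -- each `σ` separately; atypical `σ` contribute `0` on both sides.
  rw [integral_prodExp hGint, ← prodExp_const (ι := Fin n) hπ.sum_eq_one (1 : ℝ), ← prodExp_sub,
    ← prodExp_const_mul, prodExp_const hπ.sum_eq_one]
  refine prodExp_mono hπ0 fun σ => ?_
  by_cases h : emp σ ∈ U
  · have hexp : ∀ i, Real.exp (l * (1 - hitProb p ψ s σ i - 1)) = Real.exp (-A (emp σ) i) := by
      intro i
      rw [hl', hA, hitProb]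
      congr 1
      field_simp
      ring
    simp only [hG, if_pos h, one_mul, sub_zero, mul_one]
    have hint : ∫ m : ℕ, ((1 - hitProb p ψ s σ i₁) ^ m + (1 - (1 - hitProb p ψ s σ i₂) ^ m))
        ∂(ProbabilityTheory.poissonMeasure l) =
        Real.exp (-A (emp σ) i₁) + (1 - Real.exp (-A (emp σ) i₂)) := by
      have e1 := integrable_poissonMeasure_pow l (hh σ i₁ h.2.1)
      have e2 := integrable_poissonMeasure_pow l (hh σ i₂ h.2.2)
      have e3 : MeasureTheory.Integrable (fun m : ℕ => 1 - (1 - hitProb p ψ s σ i₂) ^ m)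
        (ProbabilityTheory.poissonMeasure l) := (MeasureTheory.integrable_const 1).sub e2
      rw [MeasureTheory.integral_add e1 e3,
        MeasureTheory.integral_sub (MeasureTheory.integrable_const 1) e2,
        integral_poissonMeasure_pow, integral_poissonMeasure_pow, hexp, hexp]
      simp
    rw [MeasureTheory.integral_const_mul, hint]
    have : γ < gap (emp σ) := h.1
    simp only [hgap] at this
    exact mul_le_mul_of_nonneg_left (by linarith) (by positivity)
  · simp [hG, if_neg h]

end Degree

/-! ### Stochastic matrices with small permutation sums -/

section Matrix

variable {q : ℕ}

/-- A stochastic matrix all of whose permutation sums are at most `1 + δ` has almost equal rows. -/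
theorem abs_sub_le_of_perm_sum_le (M : Fin q → Fin q → ℝ) (hrow : ∀ i, ∑ j, M i j = 1) {δ : ℝ}
    (hδ : 0 ≤ δ) (h : ∀ Γ : Equiv.Perm (Fin q), ∑ i, M i (Γ i) ≤ 1 + δ) (i i' j : Fin q) :
    |M i j - M i' j| ≤ q * δ := by
  have : NeZero q := ⟨fun h0 => by subst h0; exact i.elim0⟩
  have hq : (0 : ℝ) < q := by exact_mod_cast Nat.pos_of_ne_zero (NeZero.ne q)
  -- The `q` cyclic shifts of `Γ` cover every matrix entry once and have total `q`. The other `q -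
  -- 1` shifts take at most `1 + δ` each, leaving at least `1 - (q - 1) * δ` for `Γ`.
  have hlow : ∀ Γ : Equiv.Perm (Fin q), 1 - (q - 1) * δ ≤ ∑ i, M i (Γ i) := by
    intro Γ
    have h1 : ∑ c : Fin q, ∑ i, M i ((Γ.trans (Equiv.addRight c)) i) = q := by
      rw [Finset.sum_comm]
      have : ∀ i, ∑ c : Fin q, M i ((Γ.trans (Equiv.addRight c)) i) = 1 := by
        intro i
        rw [← hrow i, ← Equiv.sum_comp (Equiv.addLeft (Γ i)) (M i)]
        rfl
      rw [Finset.sum_congr rfl fun i _ => this i]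
      simp
    rw [← Finset.add_sum_erase _ _ (Finset.mem_univ (0 : Fin q))] at h1
    have h2 : ∑ c ∈ Finset.univ.erase (0 : Fin q), ∑ i, M i ((Γ.trans (Equiv.addRight c)) i) ≤
        ∑ c ∈ Finset.univ.erase (0 : Fin q), (1 + δ) := Finset.sum_le_sum fun c _ => h _
    rw [Finset.sum_const, Finset.card_erase_of_mem (Finset.mem_univ _), Finset.card_univ,
      Fintype.card_fin, nsmul_eq_mul, Nat.cast_sub (Nat.pos_of_ne_zero (NeZero.ne q)),
      Nat.cast_one] at h2
    have h3 : ∑ i, M i ((Γ.trans (Equiv.addRight (0 : Fin q))) i) = ∑ i, M i (Γ i) := by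
      simp
    rw [h3] at h1
    linarith
  -- `Γ` and its composition with the swap of `i` and `i'` differ only in rows `i` and `i'`. Both
  -- sums lie in a window of length `q * δ`, which bounds the difference of the two row differences.
  have hswap : ∀ j', M i j - M i' j ≤ M i j' - M i' j' + q * δ ∧
      M i j' - M i' j' - q * δ ≤ M i j - M i' j := by
    intro j'
    rcases eq_or_ne i i' with rfl | hi
    · simp only [sub_self]; constructor <;> nlinarith
    rcases eq_or_ne j j' with rfl | hj
    · constructor <;> nlinarith
    obtain ⟨Γ, hΓi, hΓi'⟩ : ∃ Γ : Equiv.Perm (Fin q), Γ i = j ∧ Γ i' = j' := by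
      have hne : Equiv.swap i j i' ≠ j := fun hh => hi
        ((Equiv.swap i j).injective ((Equiv.swap_apply_left i j).trans hh.symm))
      refine ⟨(Equiv.swap i j).trans (Equiv.swap (Equiv.swap i j i') j'), ?_, ?_⟩
      · rw [Equiv.trans_apply, Equiv.swap_apply_left, Equiv.swap_apply_of_ne_of_ne hne.symm hj]
      · rw [Equiv.trans_apply, Equiv.swap_apply_left]
    have split : ∀ Γ' : Equiv.Perm (Fin q), ∑ l, M l (Γ' l) =
        M i (Γ' i) + M i' (Γ' i') + ∑ l ∈ (Finset.univ.erase i).erase i', M l (Γ' l) := by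
      intro Γ'
      rw [← Finset.add_sum_erase _ _ (Finset.mem_univ i),
        ← Finset.add_sum_erase _ _ (Finset.mem_erase.2 ⟨hi.symm, Finset.mem_univ i'⟩), add_assoc]
    have e1 := split Γ
    have e2 := split ((Equiv.swap i i').trans Γ)
    have e3 : ∑ l ∈ (Finset.univ.erase i).erase i', M l (((Equiv.swap i i').trans Γ) l) =
        ∑ l ∈ (Finset.univ.erase i).erase i', M l (Γ l) := by
      refine Finset.sum_congr rfl fun l hl => ?_
      rw [Equiv.trans_apply, Equiv.swap_apply_of_ne_of_ne]
      · exact Finset.ne_of_mem_erase (Finset.mem_of_mem_erase hl)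
      · exact Finset.ne_of_mem_erase hl
    rw [Equiv.trans_apply, Equiv.trans_apply, Equiv.swap_apply_left, Equiv.swap_apply_right, e3,
      hΓi, hΓi'] at e2
    rw [hΓi, hΓi'] at e1
    have a1 := h Γ
    have a2 := hlow Γ
    have a3 := h ((Equiv.swap i i').trans Γ)
    have a4 := hlow ((Equiv.swap i i').trans Γ)
    constructor <;> linarith
  -- Averaging over `j'` finishes: both rows sum to one, so the differences `M i j' - M i' j'` add
  -- up to zero.
  have hup : ∑ j' : Fin q, (M i j - M i' j) ≤ ∑ j', (M i j' - M i' j' + q * δ) :=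
    Finset.sum_le_sum fun j' _ => (hswap j').1
  have hdn : ∑ j' : Fin q, (M i j' - M i' j' - q * δ) ≤ ∑ j' : Fin q, (M i j - M i' j) :=
    Finset.sum_le_sum fun j' _ => (hswap j').2
  simp only [Finset.sum_add_distrib, Finset.sum_sub_distrib, hrow, Finset.sum_const,
    Finset.card_univ, Fintype.card_fin, nsmul_eq_mul] at hup hdn
  rw [abs_le]
  constructor <;> nlinarith

end Matrix

/-! ### Overlap near `1/q` means near independence -/

section Joint

variable {q n : ℕ}

/-- The joint empirical distribution of two assignments. -/
abbrev jemp (σ σ' : Fin n → Fin q) : Fin q × Fin q → ℝ := emp fun v => (σ v, σ' v)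

theorem jemp_eq (σ σ' : Fin n → Fin q) (i j : Fin q) : jemp σ σ' (i, j) =
    ((Finset.univ.filter fun v => σ v = i ∧ σ' v = j).card : ℝ) / n := by
  simp only [jemp, emp, Prod.mk.injEq]

theorem sum_jemp_right (σ σ' : Fin n → Fin q) (i : Fin q) :
    ∑ j, jemp σ σ' (i, j) = emp σ i := by
  simp only [jemp_eq, emp, ← Finset.sum_div]
  congr 1
  rw [Finset.card_eq_sum_card_fiberwise (f := σ') (t := Finset.univ) (fun _ _ => by simp)]
  simp only [Finset.filter_filter, Nat.cast_sum]

theorem sum_jemp_left (σ σ' : Fin n → Fin q) (j : Fin q) :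
    ∑ i, jemp σ σ' (i, j) = emp σ' j := by
  simp only [jemp_eq, emp, ← Finset.sum_div]
  congr 1
  rw [Finset.card_eq_sum_card_fiberwise (f := σ) (t := Finset.univ) (fun _ _ => by simp)]
  simp only [Finset.filter_filter, Nat.cast_sum, and_comm]

/-- The overlap terms in terms of empirical distributions. -/
theorem card_div_card_eq (hn : 0 < n) (σ σ' : Fin n → Fin q) (i j : Fin q) :
    ((Finset.univ.filter fun v => σ v = i ∧ σ' v = j).card : ℝ) /
      ((Finset.univ.filter fun v => σ v = i).card : ℝ) = jemp σ σ' (i, j) / emp σ i := by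
  have hn' : (n : ℝ) ≠ 0 := by positivity
  rw [jemp_eq, emp, div_div_div_cancel_right₀ hn']

/-- Assignments of small overlap are almost independent. -/
theorem abs_jemp_sub_le (hn : 0 < n) (hq : 0 < q) {σ σ' : Fin n → Fin q} (hσ : ∀ i, 0 < emp σ i)
    {ε : ℝ} (hε : 0 ≤ ε) (h : overlap σ σ' ≤ 1 / q + ε) (i j : Fin q) :
    |jemp σ σ' (i, j) - emp σ i * emp σ' j| ≤ q * (q * ε) := by
  have hq' : (0 : ℝ) < q := by exact_mod_cast hq
  have hM := abs_sub_le_of_perm_sum_le (fun i j => jemp σ σ' (i, j) / emp σ i) (fun i => by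
    rw [← Finset.sum_div, sum_jemp_right, div_self (hσ i).ne']) (δ := q * ε) (by positivity)
    (fun Γ => by
      have h1 := (le_overlap σ σ' Γ).trans h
      simp only [card_div_card_eq hn] at h1
      rw [one_div, inv_mul_le_iff₀ hq'] at h1
      refine h1.trans_eq ?_
      field_simp)
  -- `emp σ' j` is the `emp σ`-average of the conditional frequencies of `j`, so the discrepancy is
  -- an average of differences between rows of the conditional matrix.
  have e1 : jemp σ σ' (i, j) - emp σ i * emp σ' j = emp σ i * ∑ i', emp σ i' *
      (jemp σ σ' (i, j) / emp σ i - jemp σ σ' (i', j) / emp σ i') := by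
    simp only [mul_sub, Finset.sum_sub_distrib, ← Finset.sum_mul, sum_emp hn]
    rw [one_mul, mul_div_cancel₀ _ (hσ i).ne', ← sum_jemp_left σ σ' j]
    congr 2
    refine Finset.sum_congr rfl fun i' _ => ?_
    rw [mul_div_cancel₀ _ (hσ i').ne']
  rw [e1, abs_mul, abs_of_pos (hσ i)]
  have e2 : emp σ i ≤ 1 := sum_emp hn σ ▸
    Finset.single_le_sum (fun j _ => emp_nonneg σ j) (Finset.mem_univ i)
  refine (mul_le_of_le_one_left (abs_nonneg _) e2).trans ?_
  refine (Finset.abs_sum_le_sum_abs _ _).trans ?_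
  calc _ ≤ ∑ i', emp σ i' * (q * (q * ε)) := by
        refine Finset.sum_le_sum fun i' _ => ?_
        rw [abs_mul, abs_of_pos (hσ i')]
        exact mul_le_mul_of_nonneg_left (hM i i' j) (hσ i').le
    _ = _ := by rw [← Finset.sum_mul, sum_emp hn, one_mul]

end Joint

/-! ### Independent pairs and strict Jensen for the square -/

section Jensen

variable {k : ℕ} {α β : Type*} [Fintype α] [Fintype β]

theorem prodExp_prodMk (w : α → ℝ) (w' : β → ℝ) (F : (Fin k → α) → ℝ) (G : (Fin k → β) → ℝ) :
    prodExp (fun z : α × β => w z.1 * w' z.2) (fun z : Fin k → α × β =>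
      F (fun j => (z j).1) * G (fun j => (z j).2)) = prodExp w F * prodExp w' G := by
  simp only [prodExp, Finset.sum_mul_sum]
  rw [← Equiv.sum_comp (Equiv.arrowProdEquivProdArrow (Fin k) (fun _ => α) (fun _ => β)).symm,
    Fintype.sum_prod_type]
  refine Finset.sum_congr rfl fun x _ => Finset.sum_congr rfl fun y _ => ?_
  have : ∀ j, (Equiv.arrowProdEquivProdArrow (Fin k) (fun _ => α) (fun _ => β)).symm (x, y) j =
    (x j, y j) := fun _ => rfl
  simp only [this, Finset.prod_mul_distrib]
  ring

/-- The strict Jensen inequality for the square. -/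
theorem sq_prodExp_lt {w : α → ℝ} (hw : ∀ a, 0 < w a) (hw1 : ∑ a, w a = 1)
    {F : (Fin k → α) → ℝ} {x y : Fin k → α} (h : F x ≠ F y) :
    prodExp w F * prodExp w F < prodExp w (fun z => F z * F z) := by
  set M := prodExp w F with hM
  have e : prodExp w (fun z => (F z - M) * (F z - M)) = prodExp w (fun z => F z * F z) - M * M := by
    have : ∀ z, (F z - M) * (F z - M) = F z * F z - 2 * M * F z + M * M := fun z => by ring
    simp only [this]
    rw [prodExp_add, prodExp_sub, prodExp_const_mul, prodExp_const hw1, ← hM]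
    ring
  have hpos : 0 < prodExp w (fun z => (F z - M) * (F z - M)) := by
    obtain ⟨z, hz⟩ : ∃ z, F z ≠ M := by
      by_contra! h'
      exact h ((h' x).trans (h' y).symm)
    refine Finset.sum_pos' (fun z _ => mul_nonneg (Finset.prod_nonneg fun _ _ => (hw _).le)
      (mul_self_nonneg _)) ⟨z, Finset.mem_univ z, ?_⟩
    exact mul_pos (Finset.prod_pos fun _ _ => hw _) (mul_self_pos.2 (sub_ne_zero.2 hz))
  linarith

end Jensen

/-! ### Recovery at large degree by maximising a score -/

section Score

variable {k q : ℕ} {Ψ : Finset (Weight k q)} {p : Weight k q → ℝ} {π : Fin q → ℝ} {n : ℕ}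

open Classical in
/-- The score of an assignment on a clause. -/
def clauseScore (ψ : {ψ // ψ ∈ Ψ}) (σ : Fin n → Fin q) (c : Clause Ψ n) : ℝ :=
  if c.2 = ψ then ψ.1 (fun j => σ (c.1 j)) else 0

-- The positions of a clause are independent uniform draws tilted by the weight, so the expected
-- gain of a rival `σ'` on one clause depends only on the joint empirical law.
open Classical in
theorem sum_clauseProb_score (hn : 0 < n) (ψ : {ψ // ψ ∈ Ψ}) (σ σ' : Fin n → Fin q) :
    ∑ c, clauseProb Ψ p σ c * (clauseScore ψ σ' c - clauseScore ψ σ c) =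
      p ψ.1 * prodExp (jemp σ σ') (fun z => ψ.1 (fun j => (z j).1) *
        (ψ.1 (fun j => (z j).2) - ψ.1 (fun j => (z j).1))) / wmean Ψ p (emp σ) := by
  have hn' : (n : ℝ) ≠ 0 := by positivity
  rw [sum_clauseProb_mul hn, Finset.sum_eq_single ψ]
  · have := sum_comp_eq (k := k) hn (fun v => (σ v, σ' v)) (fun z => ψ.1 (fun j => (z j).1) *
        (ψ.1 (fun j => (z j).2) - ψ.1 (fun j => (z j).1)))
    have h : ∑ x : Fin k → Fin n, ψ.1 (fun j => σ (x j)) *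
        (clauseScore ψ σ' (x, ψ) - clauseScore ψ σ (x, ψ)) = (n : ℝ) ^ k *
        prodExp (jemp σ σ') (fun z => ψ.1 (fun j => (z j).1) *
        (ψ.1 (fun j => (z j).2) - ψ.1 (fun j => (z j).1))) := by
      rw [← this]
      exact Finset.sum_congr rfl fun x _ => by simp [clauseScore]
    rw [h]
    field_simp
  · intro ψ' _ h; simp [clauseScore, h]
  · simp

theorem IsWeightPrior.wmean_le (hp : IsWeightPrior Ψ p) {hi : ℝ} (h : ∀ ψ ∈ Ψ, ∀ x, ψ x ≤ hi)
    {μ : Fin q → ℝ} (hμ : ∀ i, 0 ≤ μ i) (hμ1 : ∑ i, μ i = 1) : wmean Ψ p μ ≤ hi := by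
  calc _ ≤ ∑ ψ ∈ Ψ, p ψ * hi := Finset.sum_le_sum fun ψ hψ => mul_le_mul_of_nonneg_left
        (prodExp_le_const hμ hμ1 (h ψ hψ)) (hp.pos ψ hψ).le
    _ = hi := by rw [← Finset.sum_mul, hp.sum_eq_one, one_mul]

/-- If the joint empirical distribution is almost a product, the score of the planted assignment
is exceeded with exponentially small probability only. -/
theorem exists_score_rate (hp : IsWeightPrior Ψ p) (hπ : IsCommunityPrior π) (ψ : {ψ // ψ ∈ Ψ})
    {x y : Fin k → Fin q} (hxy : ψ.1 x ≠ ψ.1 y) :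
    ∃ U ∈ 𝓝 (fun z : Fin q × Fin q => π z.1 * π z.2), ∃ r : ℝ, 0 < r ∧ r < 1 ∧
      ∀ (n : ℕ), 0 < n → ∀ σ σ' : Fin n → Fin q, jemp σ σ' ∈ U → ∀ m : ℕ,
        prodExp (clauseProb Ψ p σ) (fun g : Fin m → Clause Ψ n =>
          if ∑ a, clauseScore ψ σ (g a) ≤ ∑ a, clauseScore ψ σ' (g a) then (1 : ℝ) else 0) ≤
          r ^ m := by
  obtain ⟨lo, hi, hlo, hlohi, hb⟩ := hp.exists_bounds
  have hhi : 0 < hi := hlo.trans_le hlohi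
  have hpψ := hp.pos _ ψ.2
  set J : (Fin q × Fin q → ℝ) → ℝ := fun ρ => prodExp ρ (fun z : Fin k → Fin q × Fin q =>
    ψ.1 (fun j => (z j).1) * (ψ.1 (fun j => (z j).2) - ψ.1 (fun j => (z j).1))) with hJ
  have hJc : Continuous J := continuous_prodExp _
  -- At the product law, `J` equals `(E ψ) ^ 2 - E (ψ ^ 2)`.
  have hJneg : J (fun z => π z.1 * π z.2) < 0 := by
    have e : J (fun z => π z.1 * π z.2) = prodExp π ψ.1 * prodExp π ψ.1 -
        prodExp π (fun z => ψ.1 z * ψ.1 z) * prodExp (ι := Fin k) π (fun _ => 1) := by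
      rw [← prodExp_prodMk, ← prodExp_prodMk, ← prodExp_sub]
      simp only [hJ]
      congr 1
      ext z
      ring
    rw [e, prodExp_const hπ.sum_eq_one, mul_one, sub_neg]
    exact sq_prodExp_lt hπ.pos hπ.sum_eq_one hxy
  set j := -J (fun z => π z.1 * π z.2) / 2 with hj
  have hj0 : 0 < j := by rw [hj]; linarith
  -- On the neighbourhood `J < -j` the mean gain is at most `-p ψ * j / wmean`, and `wmean ≤ hi`
  -- makes this uniform in `σ`.
  obtain ⟨r, hr0, hr1, hr⟩ := exists_chernoff_rate hhi (c := p ψ.1 * j / hi) (by positivity)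
  refine ⟨{ρ | J ρ < -j}, hJc.continuousAt.eventually_lt_const (by rw [hj]; linarith), r, hr0, hr1,
    fun n hn σ σ' hU m => ?_⟩
  have hU' : J (jemp σ σ') < -j := hU
  refine le_trans (le_of_eq ?_) (hr (clauseProb Ψ p σ)
    (fun c => clauseScore ψ σ' c - clauseScore ψ σ c) (hp.clauseProb_nonneg σ)
    (hp.sum_clauseProb hn σ) ?_ ?_ m)
  · simp only [Finset.sum_sub_distrib, sub_nonneg]
  · intro c
    have h1 : ∀ τ : Fin n → Fin q, 0 ≤ clauseScore ψ τ c ∧ clauseScore ψ τ c ≤ hi := by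
      intro τ
      unfold clauseScore
      split_ifs
      · exact ⟨(hp.weight_pos _ ψ.2 _).le, (hb _ ψ.2 _).2⟩
      · exact ⟨le_rfl, hhi.le⟩
    rw [abs_le]
    have := h1 σ
    have := h1 σ'
    constructor <;> linarith
  · rw [sum_clauseProb_score hn]
    have hw := hp.wmean_pos (emp_nonneg σ) (sum_emp hn σ)
    have hw2 := hp.wmean_le (fun ψ hψ x => (hb ψ hψ x).2) (emp_nonneg σ) (sum_emp hn σ)
    calc _ ≤ p ψ.1 * (-j) / wmean Ψ p (emp σ) := by
          gcongr
      _ = -(p ψ.1 * j / wmean Ψ p (emp σ)) := by ring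
      _ ≤ _ := by
          gcongr

open Classical in
/-- Weak recovery is possible at some degree if some weight function is not constant. -/
theorem exists_weakRecoveryPossible (hk : 2 ≤ k) (hq : 2 ≤ q) (hp : IsWeightPrior Ψ p)
    (hπ : IsCommunityPrior π) (hne : ∃ ψ ∈ Ψ, ∃ x y, ψ x ≠ ψ y) :
    ∃ d : ℝ, 0 < d ∧ WeakRecoveryPossible Ψ p π d := by
  obtain ⟨ψ', hψ, x, y, hxy⟩ := hne
  lift ψ' to {ψ // ψ ∈ Ψ} using hψ with ψ
  have hπ0 : ∀ i, 0 ≤ π i := fun i => (hπ.pos i).le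
  have hk0 : (0 : ℝ) < k := by exact_mod_cast (by omega : 0 < k)
  have hq0 : (0 : ℝ) < q := by exact_mod_cast (by omega : 0 < q)
  obtain ⟨U, hU, r, hr0, hr1, hr⟩ := exists_score_rate hp hπ ψ hxy
  obtain ⟨κ, hκ, hκU⟩ := Metric.mem_nhds_iff.1 hU
  -- This makes the error `q * (q * ε)` of `abs_jemp_sub_le` equal to `κ / 4`. Replacing the two
  -- empirical marginals by `π` costs another `κ / 2`, so the total stays below `κ`.
  set ε := κ / (4 * q ^ 2) with hε
  have hε0 : 0 < ε := by positivity
  set V : Set (Fin q → ℝ) := {μ | ∀ i, 0 < μ i ∧ |μ i - π i| < κ / 4} with hV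
  have hVn : V ∈ 𝓝 π := by
    refine eventually_all.2 fun i => ?_
    have hc : ContinuousAt (fun μ : Fin q → ℝ => μ i) π := (continuous_apply i).continuousAt
    refine (hc.eventually_const_lt (hπ.pos i)).and ?_
    have hc' : ContinuousAt (fun μ : Fin q → ℝ => |μ i - π i|) π := (hc.sub_const _).abs
    exact hc'.eventually_lt_const (by simp; positivity)
  have hover : ∀ (n : ℕ), 0 < n → ∀ σ σ' : Fin n → Fin q, emp σ ∈ V → emp σ' ∈ V →
      jemp σ σ' ∉ U → 1 / q + ε ≤ overlap σ σ' := by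
    intro n hn σ σ' hσ hσ' hρ
    by_contra! hlt
    refine hρ (hκU ?_)
    rw [Metric.mem_ball, dist_pi_lt_iff hκ]
    rintro ⟨i, j⟩
    have h1 := abs_jemp_sub_le hn (by omega) (fun i => (hσ i).1) hε0.le hlt.le i j
    have h2 : (q : ℝ) * (q * ε) = κ / 4 := by rw [hε]; field_simp
    have h3 : |emp σ i * emp σ' j - π i * π j| ≤ κ / 4 + κ / 4 := by
      have e : emp σ i * emp σ' j - π i * π j =
        emp σ' j * (emp σ i - π i) + π i * (emp σ' j - π j) := by ring
      have a1 : emp σ' j ≤ 1 := sum_emp hn σ' ▸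
        Finset.single_le_sum (fun j _ => emp_nonneg σ' j) (Finset.mem_univ j)
      have a2 : π i ≤ 1 := hπ.sum_eq_one ▸
        Finset.single_le_sum (fun j _ => hπ0 j) (Finset.mem_univ i)
      rw [e]
      refine (abs_add_le _ _).trans ?_
      rw [abs_mul, abs_mul, abs_of_pos (hσ' j).1, abs_of_pos (hπ.pos i)]
      exact add_le_add ((mul_le_of_le_one_left (abs_nonneg _) a1).trans (hσ i).2.le)
        ((mul_le_of_le_one_left (abs_nonneg _) a2).trans (hσ' j).2.le)
    rw [h2] at h1
    rw [Real.dist_eq]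
    have h4 := abs_sub_le (jemp σ σ' (i, j)) (emp σ i * emp σ' j) (π i * π j)
    linarith
  -- The estimator maximises the score among balanced assignments; when the planted one is balanced
  -- it takes part in the competition. Without balanced assignments the claim is vacuous.
  have hest : ∀ (n : ℕ) (g : FactorGraph Ψ n), ∃ τ : Fin n → Fin q, ∀ σ, emp σ ∈ V →
      emp τ ∈ V ∧ ∑ a, clauseScore ψ σ (g.2 a) ≤ ∑ a, clauseScore ψ τ (g.2 a) := by
    intro n g
    rcases (Finset.univ.filter fun σ : Fin n → Fin q => emp σ ∈ V).eq_empty_or_nonempty with h | h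
    · refine ⟨fun _ => ⟨0, by omega⟩, fun σ hσ => ?_⟩
      have : σ ∈ (Finset.univ.filter fun σ : Fin n → Fin q => emp σ ∈ V) := by simp [hσ]
      rw [h] at this
      simp at this
    · obtain ⟨τ, hτ, hmax⟩ := Finset.exists_max_image _
        (fun σ => ∑ a, clauseScore ψ σ (g.2 a)) h
      exact ⟨τ, fun σ hσ => ⟨(Finset.mem_filter.1 hτ).2, hmax σ (by simp [hσ])⟩⟩
  choose est hestV using hest
  -- Chosen so that the union bound, averaged over the Poisson number of clauses, is `q ^ n * exp (l
  -- * (r - 1)) = exp (-n)`.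
  set d : ℝ := k * (Real.log q + 1) / (1 - r) with hd
  have hlog : 0 ≤ Real.log q := Real.log_nonneg (by exact_mod_cast (by omega : 1 ≤ q))
  have h1r : 0 < 1 - r := by linarith
  have hd0 : 0 < d := by positivity
  refine ⟨d, hd0, ?_⟩
  have hlim := tendsto_emp_not_mem hπ0 hπ.sum_eq_one hVn
  have hexp : Tendsto (fun n : ℕ => Real.exp (-(n : ℝ))) atTop (𝓝 0) :=
    Real.tendsto_exp_neg_atTop_nhds_zero.comp tendsto_natCast_atTop_atTop
  have hu := ((hlim.const_sub 1).mul (hexp.const_sub 1)).mul_const (1 / (q : ℝ) + ε)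
  rw [sub_zero, mul_one, one_mul] at hu
  refine weakRecoveryPossible_of_tendsto hp hπ est (by linarith) hu ?_
  filter_upwards [eventually_gt_atTop 0] with n hn
  have hn' : (0 : ℝ) < n := by exact_mod_cast hn
  set l := (d * n / k).toNNReal with hl
  have hl' : (l : ℝ) = d * n / k := toNNReal_rate hd0 n
  rw [expectedOverlap_eq]
  -- If the estimate is nearly independent of `σ`, it contributes `1` to the union sum and the left
  -- side is nonpositive. Otherwise `hover` bounds the overlap from below.
  have hpt : ∀ (m : ℕ) (σ : Fin n → Fin q), emp σ ∈ V → ∀ g : Fin m → Clause Ψ n,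
      (1 - ∑ σ' : Fin n → Fin q, (if jemp σ σ' ∈ U then (1 : ℝ) else 0) *
        (if ∑ a, clauseScore ψ σ (g a) ≤ ∑ a, clauseScore ψ σ' (g a) then (1 : ℝ) else 0)) *
        (1 / q + ε) ≤ overlap σ (est n ⟨m, g⟩) := by
    intro m σ hσ g
    have h0 : ∀ σ' ∈ (Finset.univ : Finset (Fin n → Fin q)),
        0 ≤ (if jemp σ σ' ∈ U then (1 : ℝ) else 0) *
        (if ∑ a, clauseScore ψ σ (g a) ≤ ∑ a, clauseScore ψ σ' (g a) then (1 : ℝ) else 0) :=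
      fun σ' _ => by split_ifs <;> norm_num
    obtain ⟨hτ, hτs⟩ := hestV n ⟨m, g⟩ σ hσ
    by_cases hJ : jemp σ (est n ⟨m, g⟩) ∈ U
    · have h1 := Finset.single_le_sum h0 (Finset.mem_univ (est n ⟨m, g⟩))
      rw [if_pos hJ, if_pos hτs, one_mul] at h1
      refine le_trans ?_ (overlap_nonneg _ _)
      exact mul_nonpos_of_nonpos_of_nonneg (by linarith) (by positivity)
    · refine le_trans ?_ (hover n hn σ _ hσ hτ hJ)
      exact mul_le_of_le_one_left (by positivity) (by linarith [Finset.sum_nonneg h0])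
  have hgiven : ∀ m, (1 - prodExp (ι := Fin n) π (fun σ => if emp σ ∈ V then (0 : ℝ) else 1)) *
      (1 - (q : ℝ) ^ n * r ^ m) * (1 / q + ε) ≤ overlapGiven Ψ p π n (est n) m := by
    intro m
    rw [← prodExp_const (ι := Fin n) hπ.sum_eq_one (1 : ℝ), ← prodExp_sub, ← prodExp_mul_const,
      ← prodExp_mul_const, prodExp_const hπ.sum_eq_one]
    refine prodExp_mono hπ0 fun σ => ?_
    by_cases hσ : emp σ ∈ V
    · rw [if_pos hσ, sub_zero, one_mul]
      refine le_trans ?_ (prodExp_mono (hp.clauseProb_nonneg σ) (hpt m σ hσ))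
      rw [prodExp_mul_const, prodExp_sub, prodExp_const (hp.sum_clauseProb hn σ), prodExp_sum]
      refine mul_le_mul_of_nonneg_right (sub_le_sub_left ?_ _) (by positivity)
      calc _ ≤ ∑ σ' : Fin n → Fin q, r ^ m := by
            refine Finset.sum_le_sum fun σ' _ => ?_
            rw [prodExp_const_mul]
            by_cases hJ : jemp σ σ' ∈ U
            · rw [if_pos hJ, one_mul]
              exact hr n hn σ σ' hJ m
            · rw [if_neg hJ, zero_mul]
              positivity
        _ = _ := by simp
    · rw [if_neg hσ, sub_self, zero_mul, zero_mul]
      exact prodExp_nonneg (hp.clauseProb_nonneg σ) fun _ => overlap_nonneg _ _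
  have hint : MeasureTheory.Integrable (fun m : ℕ => 1 - (q : ℝ) ^ n * r ^ m)
      (ProbabilityTheory.poissonMeasure l) := (MeasureTheory.integrable_const 1).sub
        ((integrable_poissonMeasure_pow l hr0.le).const_mul _)
  refine le_trans ?_ (MeasureTheory.integral_mono ((hint.const_mul _).mul_const _)
    (integrable_overlapGiven hp hπ hn _ _) hgiven)
  rw [MeasureTheory.integral_mul_const, MeasureTheory.integral_const_mul,
    MeasureTheory.integral_sub (MeasureTheory.integrable_const 1)
      ((integrable_poissonMeasure_pow l hr0.le).const_mul _),
    MeasureTheory.integral_const_mul, integral_poissonMeasure_pow]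
  simp only [MeasureTheory.integral_const, MeasureTheory.probReal_univ, smul_eq_mul, mul_one]
  have hfin : (q : ℝ) ^ n * Real.exp (l * (r - 1)) = Real.exp (-n) := by
    rw [← Real.exp_log hq0, ← Real.exp_nat_mul, ← Real.exp_add, hl', hd]
    congr 1
    field_simp
    ring
  rw [hfin]
  refine le_of_eq ?_
  congr!

end Score

/-! ### Subcritical components are small trees -/

section Components

variable {k q : ℕ} {Ψ : Finset (Weight k q)} {n m : ℕ}

/-- Two variables are connected in a factor graph. -/
def Conn (g : Fin m → Clause Ψ n) : Fin n → Fin n → Prop :=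
  Relation.ReflTransGen fun x y => ∃ a s t, (g a).1 s = x ∧ (g a).1 t = y

open Classical in
/-- The connected component of a variable. -/
def comp (g : Fin m → Clause Ψ n) (u : Fin n) : Finset (Fin n) :=
  Finset.univ.filter (Conn g u)

theorem mem_comp {g : Fin m → Clause Ψ n} {u v : Fin n} : v ∈ comp g u ↔ Conn g u v := by
  simp [comp]

/-- A path to another variable leaves through a clause that it does not use again. -/
theorem Conn.eq_or_exists {g : Fin (m + 1) → Clause Ψ n} {u v : Fin n} (h : Conn g u v) :
    v = u ∨ ∃ a s t, s ≠ t ∧ (g a).1 s = u ∧ Conn (a.removeNth g) ((g a).1 t) v := by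
  induction h with
  | refl => exact Or.inl rfl
  | tail _ hstep ih =>
    obtain ⟨b, s', t', rfl, rfl⟩ := hstep
    rcases ih with ih | ⟨a, s, t, hst, hs, hc⟩
    · by_cases hst : s' = t'
      · subst hst; exact Or.inl ih
      · exact Or.inr ⟨b, s', t', hst, ih, Relation.ReflTransGen.refl⟩
    -- If the last step reuses the first clause `a`, the path is shortcut: its endpoint lies on `a`,
    -- directly next to `u`.
    · by_cases hab : b = a
      · subst hab
        by_cases hst : s = t'
        · subst hst; exact Or.inl hs
        · exact Or.inr ⟨b, s, t', hst, hs, Relation.ReflTransGen.refl⟩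
      · obtain ⟨b', rfl⟩ := Fin.exists_succAbove_eq hab
        exact Or.inr ⟨a, s, t, hst, hs, hc.tail ⟨b', s', t', rfl, rfl⟩⟩

-- A branching recursion: any other variable is reached through a clause `a` at `u`, then within the
-- graph without `a`. Deleting `a` makes the remaining component independent of that clause.
open Classical in
theorem card_comp_le (g : Fin (m + 1) → Clause Ψ n) (u : Fin n) :
    ((comp g u).card : ℝ) ≤ 1 + ∑ a : Fin (m + 1), ∑ st ∈ (Finset.univ : Finset (Fin k)).offDiag,
      (if (g a).1 st.1 = u then (1 : ℝ) else 0) *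
        ((comp (a.removeNth g) ((g a).1 st.2)).card : ℝ) := by
  have hsub : comp g u ⊆ {u} ∪ (Finset.univ : Finset (Fin (m + 1))).biUnion fun a =>
      (Finset.univ : Finset (Fin k)).offDiag.biUnion fun st =>
        if (g a).1 st.1 = u then comp (a.removeNth g) ((g a).1 st.2) else ∅ := by
    intro v hv
    rcases (mem_comp.1 hv).eq_or_exists with rfl | ⟨a, s, t, hst, hs, hc⟩
    · simp
    · refine Finset.mem_union_right _ (Finset.mem_biUnion.2 ⟨a, Finset.mem_univ _,
        Finset.mem_biUnion.2 ⟨(s, t), by simpa using hst, ?_⟩⟩)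
      rw [if_pos hs]
      exact mem_comp.2 hc
  have h1 := (Finset.card_le_card hsub).trans ((Finset.card_union_le _ _).trans
    (add_le_add le_rfl (Finset.card_biUnion_le.trans
      (Finset.sum_le_sum fun a _ => Finset.card_biUnion_le))))
  rw [Finset.card_singleton] at h1
  refine (Nat.cast_le.2 h1).trans_eq ?_
  push_cast
  congr 1
  refine Finset.sum_congr rfl fun a _ => Finset.sum_congr rfl fun st _ => ?_
  split_ifs <;> simp

open Classical in
/-- Components are small on average if the mean offspring number is below one. -/
theorem prodExp_card_comp_le {w : Clause Ψ n → ℝ} (hw : ∀ c, 0 ≤ w c) (hw1 : ∑ c, w c = 1)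
    {M ρ : ℝ} (hM : ∀ (s : Fin k) (v : Fin n), ∑ c, w c * (if c.1 s = v then (1 : ℝ) else 0) ≤ M)
    (hM0 : 0 ≤ M) (hρ : ρ < 1) (m : ℕ) (hm : m * ((k * k - k : ℕ) * M) ≤ ρ) (u : Fin n) :
    prodExp w (fun g : Fin m → Clause Ψ n => ((comp g u).card : ℝ)) ≤ 1 / (1 - ρ) := by
  induction m generalizing u with
  | zero =>
    have h1 : ∀ g : Fin 0 → Clause Ψ n, ((comp g u).card : ℝ) ≤ 1 := by
      intro g
      have : comp g u ⊆ {u} := by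
        intro v hv
        have hc := mem_comp.1 hv
        induction hc with
        | refl => simp
        | tail _ hs _ => obtain ⟨a, _⟩ := hs; exact a.elim0
      exact_mod_cast (Finset.card_le_card this).trans_eq (Finset.card_singleton u)
    refine (prodExp_le_const hw hw1 h1).trans ?_
    have hρ0 : 0 ≤ ρ := by simpa using hm
    rw [le_div_iff₀ (by linarith)]; linarith
  | succ m ih =>
    have hkk : (0 : ℝ) ≤ (k * k - k : ℕ) * M := by positivity
    have hm' : m * ((k * k - k : ℕ) * M) ≤ ρ := by
      refine le_trans (mul_le_mul_of_nonneg_right ?_ hkk) hm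
      push_cast; linarith
    set B := 1 / (1 - ρ) with hB
    have hB0 : 0 < B := by rw [hB]; apply one_div_pos.2; linarith
    refine (prodExp_mono hw fun g => card_comp_le g u).trans ?_
    rw [prodExp_add, prodExp_const hw1, prodExp_sum]
    have h1 : ∀ a : Fin (m + 1), prodExp w (fun g : Fin (m + 1) → Clause Ψ n =>
        ∑ st ∈ (Finset.univ : Finset (Fin k)).offDiag, (if (g a).1 st.1 = u then (1 : ℝ) else 0) *
        ((comp (a.removeNth g) ((g a).1 st.2)).card : ℝ)) ≤ (k * k - k : ℕ) * (M * B) := by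
      intro a
      rw [prodExp_sum]
      refine (Finset.sum_le_sum (g := fun _ => M * B) fun st _ => ?_).trans_eq ?_
      -- Conditioning on clause `a` leaves `m` independent clauses, to which the induction
      -- hypothesis applies; the hit of `u` costs a factor `M`.
      · rw [prodExp_succAbove w a]
        simp only [Fin.insertNth_apply_same, Fin.removeNth_insertNth, prodExp_const_mul]
        calc _ ≤ ∑ c, w c * (if c.1 st.1 = u then (1 : ℝ) else 0) * B := by
              refine Finset.sum_le_sum fun c _ => ?_
              rw [mul_assoc]
              refine mul_le_mul_of_nonneg_left (mul_le_mul_of_nonneg_left (ih hm' _) ?_) (hw c)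
              split_ifs <;> norm_num
          _ ≤ M * B := by
              rw [← Finset.sum_mul]
              exact mul_le_mul_of_nonneg_right (hM _ _) hB0.le
      · rw [Finset.sum_const, Finset.offDiag_card, Finset.card_univ, Fintype.card_fin,
          nsmul_eq_mul]
    refine (add_le_add le_rfl (Finset.sum_le_sum fun a _ => h1 a)).trans ?_
    rw [Finset.sum_const, Finset.card_univ, Fintype.card_fin, nsmul_eq_mul]
    have h2 : ((m + 1 : ℕ) : ℝ) * ((k * k - k : ℕ) * (M * B)) ≤ ρ * B := by
      calc _ = ((m + 1 : ℕ) : ℝ) * ((k * k - k : ℕ) * M) * B := by ring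
        _ ≤ _ := mul_le_mul_of_nonneg_right hm hB0.le
    -- The bound `1 / (1 - ρ)` is the fixed point of the recursion.
    have h3 : B = 1 + ρ * B := by
      rw [hB]; field_simp [show (1 - ρ) ≠ 0 by linarith]; ring
    linarith

/-- A clause neighbourhood meets `C` but does not attach to it as a fresh hyperedge. -/
def Unclean (δ : Fin k → Fin n) (C : Finset (Fin n)) : Prop :=
  ∃ s t, s ≠ t ∧ δ s ∈ C ∧ (δ t ∈ C ∨ ∃ t', t' ≠ s ∧ t' ≠ t ∧ δ t = δ t')

theorem prodExp_prod_subset {ι α : Type*} [Fintype ι] [DecidableEq ι] [Fintype α] {w : α → ℝ}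
    (hw : ∑ a, w a = 1) (T : Finset ι) (h : ι → α → ℝ) :
    prodExp w (fun x : ι → α => ∏ i ∈ T, h i (x i)) = ∏ i ∈ T, ∑ a, w a * h i a := by
  have := prodExp_prod w (fun (i : ι) a => if i ∈ T then h i a else 1)
  have e1 : ∀ x : ι → α, ∏ i, (if i ∈ T then h i (x i) else 1) = ∏ i ∈ T, h i (x i) := fun x => by
    rw [Finset.prod_ite_mem, Finset.univ_inter]
  have e2 : ∏ i, ∑ a, w a * (if i ∈ T then h i a else 1) = ∏ i ∈ T, ∑ a, w a * h i a := by
    rw [← Finset.univ_inter T, ← Finset.prod_ite_mem, Finset.univ_inter]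
    refine Finset.prod_congr rfl fun i _ => ?_
    by_cases hi : i ∈ T <;> simp [hi, hw]
  simp only [e1] at this
  rw [this, e2]

open Classical in
/-- The probability that a uniformly random neighbourhood is not clean. -/
theorem prodExp_unclean_le (hn : 0 < n) (C : Finset (Fin n)) {L : ℝ} (hL : (C.card : ℝ) ≤ L) :
    prodExp (fun _ : Fin n => 1 / (n : ℝ)) (fun δ : Fin k → Fin n =>
      if Unclean δ C then (1 : ℝ) else 0) ≤ (k ^ 2 * L ^ 2 + k ^ 3 * L) / n ^ 2 := by
  have hn' : (0 : ℝ) < n := by exact_mod_cast hn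
  have hL0 : 0 ≤ L := (Nat.cast_nonneg _).trans hL
  set w : Fin n → ℝ := fun _ => 1 / (n : ℝ) with hw
  have hw0 : ∀ a, 0 ≤ w a := fun _ => by positivity
  have hw1 : ∑ a, w a = 1 := by simp [hw, hn'.ne']
  set I : Fin n → ℝ := fun x => if x ∈ C then (1 : ℝ) else 0 with hI
  have hsC : ∑ a, w a * I a ≤ L / n := by
    simp only [hw, hI, ← Finset.mul_sum]
    rw [Finset.sum_boole, Finset.filter_univ_mem, one_div, inv_mul_eq_div]
    gcongr
  have hsC0 : 0 ≤ ∑ a, w a * I a :=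
    Finset.sum_nonneg fun a _ => mul_nonneg (hw0 a) (by simp only [hI]; split_ifs <;> norm_num)
  have hsx : ∀ x : Fin n, ∑ a, w a * (if a = x then (1 : ℝ) else 0) = 1 / n := by
    intro x; simp [hw]
  have h2 : ∀ s t : Fin k, s ≠ t → prodExp w (fun δ : Fin k → Fin n => I (δ s) * I (δ t)) ≤
      L ^ 2 / n ^ 2 := by
    intro s t hst
    have := prodExp_prod_subset hw1 {s, t} (fun _ : Fin k => I)
    simp only [Finset.prod_pair hst] at this
    rw [this, ← div_pow, sq]
    gcongr
  have h3 : ∀ s t t' : Fin k, s ≠ t → t' ≠ s → t' ≠ t →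
      prodExp w (fun δ : Fin k → Fin n => ∑ x : Fin n, I (δ s) *
        ((if δ t = x then (1 : ℝ) else 0) * (if δ t' = x then (1 : ℝ) else 0))) ≤
      L / n ^ 2 := by
    intro s t t' hst hs ht
    rw [prodExp_sum]
    have hx : ∀ x : Fin n, prodExp w (fun δ : Fin k → Fin n => I (δ s) *
        ((if δ t = x then (1 : ℝ) else 0) * (if δ t' = x then (1 : ℝ) else 0))) ≤
        L / n * (1 / n * (1 / n)) := by
      intro x
      have := prodExp_prod_subset hw1 {s, t, t'}
        (fun j : Fin k => if j = s then I else fun a => if a = x then (1 : ℝ) else 0)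
      have hmem : s ∉ ({t, t'} : Finset (Fin k)) := by simp [hst, hs.symm]
      simp only [Finset.prod_insert hmem, Finset.prod_pair ht.symm, if_true, if_neg hst.symm,
        if_neg hs, hsx] at this
      rw [this]
      gcongr
    refine (Finset.sum_le_sum fun x _ => hx x).trans_eq ?_
    rw [Finset.sum_const, Finset.card_univ, Fintype.card_fin, nsmul_eq_mul]
    field_simp
  -- Union bound over two entries in `C`, of probability at most `(L / n) ^ 2` for each pair, and
  -- over one entry in `C` with a coincidence of two others, at most `L / n ^ 2` for each triple.
  have hpt : ∀ δ : Fin k → Fin n, (if Unclean δ C then (1 : ℝ) else 0) ≤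
      (∑ s : Fin k, ∑ t : Fin k, if s ≠ t then I (δ s) * I (δ t) else 0) +
      ∑ s : Fin k, ∑ t : Fin k, ∑ t' : Fin k, if s ≠ t ∧ t' ≠ s ∧ t' ≠ t then
        ∑ x : Fin n, I (δ s) *
          ((if δ t = x then (1 : ℝ) else 0) * (if δ t' = x then (1 : ℝ) else 0)) else 0 := by
    intro δ
    have I0 : ∀ x, 0 ≤ I x := fun x => by simp only [hI]; split_ifs <;> norm_num
    have p1 : ∀ s t, 0 ≤ if s ≠ t then I (δ s) * I (δ t) else 0 := fun s t => by
      split_ifs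
      · exact mul_nonneg (I0 _) (I0 _)
      · exact le_rfl
    have p2 : ∀ s t t', 0 ≤ if s ≠ t ∧ t' ≠ s ∧ t' ≠ t then
        ∑ x : Fin n, I (δ s) *
          ((if δ t = x then (1 : ℝ) else 0) * (if δ t' = x then (1 : ℝ) else 0)) else 0 := by
      intro s t t'
      split_ifs with h
      · refine Finset.sum_nonneg fun x _ => mul_nonneg (I0 _) ?_
        split_ifs <;> norm_num
      · exact le_rfl
    have q1 := Finset.sum_nonneg fun s (_ : s ∈ Finset.univ) =>
      Finset.sum_nonneg fun t (_ : t ∈ Finset.univ) => p1 s t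
    have q2 := Finset.sum_nonneg fun s (_ : s ∈ Finset.univ) =>
      Finset.sum_nonneg fun t (_ : t ∈ Finset.univ) =>
        Finset.sum_nonneg fun t' (_ : t' ∈ Finset.univ) => p2 s t t'
    by_cases hU : Unclean δ C
    · rw [if_pos hU]
      obtain ⟨s, t, hst, hs, ht | ⟨t', hs', ht', he⟩⟩ := hU
      · have a1 := Finset.single_le_sum (f := fun s => ∑ t, if s ≠ t then I (δ s) * I (δ t) else 0)
          (fun s _ => Finset.sum_nonneg fun t _ => p1 s t) (Finset.mem_univ s)
        have a2 := Finset.single_le_sum (f := fun t => if s ≠ t then I (δ s) * I (δ t) else 0)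
          (fun t _ => p1 s t) (Finset.mem_univ t)
        have a3 : (if s ≠ t then I (δ s) * I (δ t) else 0) = 1 := by
          rw [if_pos hst]; simp [hI, hs, ht]
        linarith
      · have a1 := Finset.single_le_sum (f := fun s => ∑ t, ∑ t', if s ≠ t ∧ t' ≠ s ∧ t' ≠ t then
          ∑ x : Fin n, I (δ s) *
            ((if δ t = x then (1 : ℝ) else 0) * (if δ t' = x then (1 : ℝ) else 0)) else 0)
          (fun s _ => Finset.sum_nonneg fun t _ => Finset.sum_nonneg fun t' _ => p2 s t t')
          (Finset.mem_univ s)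
        have a2 := Finset.single_le_sum (f := fun t => ∑ t', if s ≠ t ∧ t' ≠ s ∧ t' ≠ t then
          ∑ x : Fin n, I (δ s) *
            ((if δ t = x then (1 : ℝ) else 0) * (if δ t' = x then (1 : ℝ) else 0)) else 0)
          (fun t _ => Finset.sum_nonneg fun t' _ => p2 s t t')
          (Finset.mem_univ t)
        have a3 := Finset.single_le_sum (f := fun t' => if s ≠ t ∧ t' ≠ s ∧ t' ≠ t then
          ∑ x : Fin n, I (δ s) *
            ((if δ t = x then (1 : ℝ) else 0) * (if δ t' = x then (1 : ℝ) else 0)) else 0)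
          (fun t' _ => p2 s t t')
          (Finset.mem_univ t')
        have a4 : (if s ≠ t ∧ t' ≠ s ∧ t' ≠ t then
          ∑ x : Fin n, I (δ s) *
            ((if δ t = x then (1 : ℝ) else 0) * (if δ t' = x then (1 : ℝ) else 0)) else 0) = 1 := by
          rw [if_pos ⟨hst, hs', ht'⟩]; simp [hI, hs, he]
        linarith
    · rw [if_neg hU]
      linarith
  refine (prodExp_mono hw0 hpt).trans ?_
  rw [prodExp_add, add_div]
  refine add_le_add ?_ ?_
  · simp only [prodExp_sum]
    calc _ ≤ ∑ s : Fin k, ∑ t : Fin k, L ^ 2 / (n : ℝ) ^ 2 := by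
          refine Finset.sum_le_sum fun s _ => Finset.sum_le_sum fun t _ => ?_
          by_cases hst : s ≠ t
          · simp only [if_pos hst]; exact h2 s t hst
          · simp only [if_neg hst]; rw [prodExp_const hw1]; positivity
      _ = _ := by simp; ring
  · simp only [prodExp_sum (s := (Finset.univ : Finset (Fin k)))]
    calc _ ≤ ∑ s : Fin k, ∑ t : Fin k, ∑ t' : Fin k, L / (n : ℝ) ^ 2 := by
          refine Finset.sum_le_sum fun s _ => Finset.sum_le_sum fun t _ =>
            Finset.sum_le_sum fun t' _ => ?_
          by_cases hst : s ≠ t ∧ t' ≠ s ∧ t' ≠ t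
          · simp only [if_pos hst]; exact h3 s t t' hst.1 hst.2.1 hst.2.2
          · simp only [if_neg hst]; rw [prodExp_const hw1]; positivity
      _ = _ := by simp; ring

/-- `Explored g u S A`: the clauses `A` form a tree containing `u` with set of variables `S`, built
by attaching hyperedges with fresh variables. -/
inductive Explored (g : Fin m → Clause Ψ n) (u : Fin n) : Finset (Fin n) → Finset (Fin m) → Prop
  | root : Explored g u {u} ∅
  | attach (S : Finset (Fin n)) (A : Finset (Fin m)) (a : Fin m) (s : Fin k) :
      Explored g u S A → a ∉ A → (g a).1 s ∈ S → Function.Injective (g a).1 →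
      (∀ t, t ≠ s → (g a).1 t ∉ S) → Explored g u (S ∪ Finset.univ.image (g a).1) (insert a A)

/-- The component of `u` is a tree with at most `L` variables. -/
def IsTreeComp (g : Fin m → Clause Ψ n) (u : Fin n) (L : ℕ) (S : Finset (Fin n))
    (A : Finset (Fin m)) : Prop :=
  Explored g u S A ∧ S.card ≤ L ∧ ∀ a ∉ A, ∀ s, (g a).1 s ∉ S

theorem Explored.conn {g : Fin m → Clause Ψ n} {u : Fin n} {S : Finset (Fin n)}
    {A : Finset (Fin m)} (h : Explored g u S A) : ∀ v ∈ S, Conn g u v := by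
  induction h with
  | root =>
    intro v hv
    rw [Finset.mem_singleton.1 hv]
    exact Relation.ReflTransGen.refl
  | attach S A a s _ _ hs _ _ ih =>
    intro v hv
    rcases Finset.mem_union.1 hv with hv | hv
    · exact ih v hv
    · obtain ⟨t, _, rfl⟩ := Finset.mem_image.1 hv
      exact (ih _ hs).tail ⟨a, s, t, rfl, rfl⟩

/-- The paths within `S` use only clauses of `A`. Hence `S` lies in the component without `b`, the
set to which `Unclean` is applied. -/
theorem Explored.conn_removeNth {g : Fin (m + 1) → Clause Ψ n} {u : Fin n} {S : Finset (Fin n)}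
    {A : Finset (Fin (m + 1))} (h : Explored g u S A) {b : Fin (m + 1)} (hb : b ∉ A) :
    ∀ v ∈ S, Conn (b.removeNth g) u v := by
  induction h with
  | root =>
    intro v hv
    rw [Finset.mem_singleton.1 hv]
    exact Relation.ReflTransGen.refl
  | attach S A a s _ _ hs _ _ ih =>
    intro v hv
    rw [Finset.mem_insert, not_or] at hb
    rcases Finset.mem_union.1 hv with hv | hv
    · exact ih hb.2 v hv
    · obtain ⟨t, _, rfl⟩ := Finset.mem_image.1 hv
      obtain ⟨a', rfl⟩ := Fin.exists_succAbove_eq (Ne.symm hb.1)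
      exact (ih hb.2 _ hs).tail ⟨a', s, t, rfl, rfl⟩

/-- A small component is a tree unless some clause attaches to it in an unclean way. -/
theorem exists_isTreeComp {g : Fin (m + 1) → Clause Ψ n} {u : Fin n} {L : ℕ}
    (hL : (comp g u).card ≤ L) (h : ∀ a, ¬ Unclean (g a).1 (comp (a.removeNth g) u)) :
    ∃ S A, IsTreeComp g u L S A := by
  by_contra! hno
  -- An exploration that never closes up could be continued to any number of distinct clauses, but
  -- only `m + 1` exist. Cleanness supplies the freshness and injectivity of each attachment.
  have key : ∀ N : ℕ, ∃ S A, Explored g u S A ∧ A.card = N := by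
    intro N
    induction N with
    | zero => exact ⟨{u}, ∅, Explored.root, rfl⟩
    | succ N ih =>
      obtain ⟨S, A, hE, hA⟩ := ih
      have hS : S.card ≤ L :=
        (Finset.card_le_card fun v hv => mem_comp.2 (hE.conn v hv)).trans hL
      obtain ⟨a, ha, s, hs⟩ : ∃ a, a ∉ A ∧ ∃ s, (g a).1 s ∈ S := by
        by_contra! h'
        exact hno S A ⟨hE, hS, h'⟩
      have hsub : ∀ v ∈ S, v ∈ comp (a.removeNth g) u :=
        fun v hv => mem_comp.2 (hE.conn_removeNth ha v hv)
      have hfresh : ∀ t, t ≠ s → (g a).1 t ∉ S := fun t ht htS =>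
        h a ⟨s, t, ht.symm, hsub _ hs, Or.inl (hsub _ htS)⟩
      have hinj : Function.Injective (g a).1 := by
        intro t t' htt
        by_contra hne
        by_cases h1 : t = s
        · exact hfresh t' (fun h2 => hne (h1.trans h2.symm)) (htt ▸ h1 ▸ hs)
        · by_cases h2 : t' = s
          · exact hfresh t h1 (htt ▸ h2 ▸ hs)
          · exact h a ⟨s, t, Ne.symm h1, hsub _ hs, Or.inr ⟨t', h2, Ne.symm hne, htt⟩⟩
      exact ⟨_, _, Explored.attach S A a s hE ha hs hinj hfresh, by
        rw [Finset.card_insert_of_notMem ha, hA]⟩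
  obtain ⟨S, A, -, hA⟩ := key (m + 2)
  have := Finset.card_le_univ A
  rw [Fintype.card_fin] at this
  omega

open Classical in
/-- With high probability the component of a variable is a small tree. -/
theorem prodExp_not_isTreeComp_le (hn : 0 < n) {w : Clause Ψ n → ℝ} (hw : ∀ c, 0 ≤ w c)
    (hw1 : ∑ c, w c = 1) {M ρ R : ℝ}
    (hM : ∀ (s : Fin k) (v : Fin n), ∑ c, w c * (if c.1 s = v then (1 : ℝ) else 0) ≤ M)
    (hM0 : 0 ≤ M) (hρ : ρ < 1) (m : ℕ) (hm : m * ((k * k - k : ℕ) * M) ≤ ρ)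
    (hR : ∀ F : (Fin k → Fin n) → ℝ, (∀ δ, 0 ≤ F δ) →
      ∑ c, w c * F c.1 ≤ R * prodExp (fun _ : Fin n => 1 / (n : ℝ)) F) (hR0 : 0 ≤ R)
    (u : Fin n) {L : ℕ} (hL : 0 < L) :
    prodExp w (fun g : Fin m → Clause Ψ n => if ∃ S A, IsTreeComp g u L S A then (0 : ℝ) else 1) ≤
      1 / (1 - ρ) / L + m * (R * ((k ^ 2 * L ^ 2 + k ^ 3 * L) / n ^ 2)) := by
  have hL' : (0 : ℝ) < L := by exact_mod_cast hL
  have hρ' : 0 < 1 / (1 - ρ) := one_div_pos.2 (by linarith)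
  cases m with
  | zero =>
    refine (prodExp_le_const (c := 0) hw hw1 fun g => ?_).trans (by positivity)
    rw [if_pos]
    refine ⟨{u}, ∅, Explored.root, ?_, fun a => a.elim0⟩
    rw [Finset.card_singleton]; exact hL
  | succ m =>
    -- Either the component exceeds `L`, handled by Markov's inequality, or some clause is unclean
    -- relative to the component without it, which then has at most `L` variables.
    have hpt : ∀ g : Fin (m + 1) → Clause Ψ n,
        (if ∃ S A, IsTreeComp g u L S A then (0 : ℝ) else 1) ≤
        ((comp g u).card : ℝ) * (1 / L) + ∑ a : Fin (m + 1),
          (if Unclean (g a).1 (comp (a.removeNth g) u) ∧ (comp (a.removeNth g) u).card ≤ L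
            then (1 : ℝ) else 0) := by
      intro g
      have h0 : ∀ a ∈ (Finset.univ : Finset (Fin (m + 1))),
          0 ≤ (if Unclean (g a).1 (comp (a.removeNth g) u) ∧ (comp (a.removeNth g) u).card ≤ L
            then (1 : ℝ) else 0) := fun a _ => by split_ifs <;> norm_num
      have h1 := Finset.sum_nonneg h0
      have h2 : 0 ≤ ((comp g u).card : ℝ) * (1 / L) := by positivity
      split_ifs with hT
      · linarith
      · by_cases hc : (comp g u).card ≤ L
        · have : ∃ a, Unclean (g a).1 (comp (a.removeNth g) u) := by
            by_contra! h'
            exact hT (exists_isTreeComp hc h')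
          obtain ⟨a, ha⟩ := this
          have hle : (comp (a.removeNth g) u).card ≤ L := by
            refine (Finset.card_le_card fun v hv => mem_comp.2 ?_).trans hc
            have hv' := mem_comp.1 hv
            unfold Conn at hv' ⊢
            refine Relation.ReflTransGen.mono (fun x y hxy => ?_) _ _ hv'
            obtain ⟨b, s, t, h1, h2⟩ := hxy
            exact ⟨a.succAbove b, s, t, h1, h2⟩
          have h3 := Finset.single_le_sum h0 (Finset.mem_univ a)
          rw [if_pos ⟨ha, hle⟩] at h3
          linarith
        · have : (1 : ℝ) ≤ ((comp g u).card : ℝ) * (1 / L) := by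
            rw [mul_one_div, one_le_div hL']
            exact_mod_cast (not_le.1 hc).le
          linarith
    refine (prodExp_mono hw hpt).trans ?_
    rw [prodExp_add, prodExp_mul_const, prodExp_sum]
    refine add_le_add ?_ ?_
    · rw [mul_one_div]
      exact div_le_div_of_nonneg_right (prodExp_card_comp_le hw hw1 hM hM0 hρ _ hm u) hL'.le
    · refine (Finset.sum_le_sum (g := fun _ => R * ((k ^ 2 * L ^ 2 + k ^ 3 * L) / (n : ℝ) ^ 2))
        fun a _ => ?_).trans_eq (by
          rw [Finset.sum_const, Finset.card_univ, Fintype.card_fin, nsmul_eq_mul])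
      -- The component without `a` is independent of clause `a`; `hR` then compares the
      -- neighbourhood of `a` with a uniform one.
      rw [prodExp_succAbove w a]
      simp only [Fin.insertNth_apply_same, Fin.removeNth_insertNth, ← prodExp_const_mul]
      rw [← prodExp_sum]
      refine prodExp_le_const hw hw1 fun g => ?_
      by_cases hc : (comp g u).card ≤ L
      · simp only [hc, and_true]
        refine (hR (fun δ => if Unclean δ (comp g u) then (1 : ℝ) else 0)
          (fun δ => by split_ifs <;> norm_num)).trans ?_
        exact mul_le_mul_of_nonneg_left
          (prodExp_unclean_le hn _ (by exact_mod_cast hc)) hR0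
      · simp only [hc, and_false, if_false, mul_zero, Finset.sum_const_zero]
        positivity

end Components

/-! ### Under symmetry, tree components leave their root unbiased -/

section Tree

variable {k q : ℕ} {Ψ : Finset (Weight k q)} {p : Weight k q → ℝ} {π : Fin q → ℝ} {n m : ℕ}

/-- For independent coordinates, conditioning on an entry is the same as overwriting it. -/
theorem prodExp_comp_update (hπ : IsCommunityPrior π) (ψ : Weight k q) (s : Fin k) (i : Fin q) :
    prodExp π (fun y => ψ (Function.update y s i)) = pinned π s i ψ := by
  have h1 : prodExp π (fun y : Fin k → Fin q => if y s = i then ψ y else 0) =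
      π i * prodExp π (fun y => ψ (Function.update y s i)) := by
    rw [← prodExp_update hπ.sum_eq_one s, ← prodExp_const_mul]
    congr 1
    ext y
    simp
  have h2 := condMean_eq_pinned hπ.pos ψ s i
  rw [condMean, div_eq_iff (hπ.pos i).ne', mul_comm] at h2
  refine mul_left_cancel₀ (hπ.pos i).ne' (h1.symm.trans (Eq.trans ?_ h2))
  simp only [prodExp, mul_ite, mul_zero]

/-- Integrating out the fresh variables of a clause leaves its mean weight. -/
theorem prodExp_clause_mul (hπ : IsCommunityPrior π) {ψ : Weight k q} {s : Fin k} {c : ℝ}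
    (hc : ∀ i, pinned π s i ψ = c) {δ : Fin k → Fin n} (hδ : Function.Injective δ)
    {F : (Fin n → Fin q) → ℝ}
    (hF : ∀ σ t i, t ≠ s → F (Function.update σ (δ t) i) = F σ) :
    prodExp π (fun σ => ψ (fun j => σ (δ j)) * F σ) = c * prodExp π F := by
  -- The entries other than `s` are replaced one at a time by auxiliary independent communities `y`.
  -- Each replacement is legitimate because `δ` is injective and `F` ignores these variables. In the
  -- end only `σ (δ s)` is left, and by `hc` its value is immaterial.
  have key : ∀ J : Finset (Fin k), s ∉ J → prodExp π (fun σ => ψ (fun j => σ (δ j)) * F σ) =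
      prodExp π (fun σ => prodExp π (fun y : Fin k → Fin q =>
        ψ (fun j => if j ∈ J then y j else σ (δ j))) * F σ) := by
    intro J
    induction J using Finset.induction_on with
    | empty =>
      intro _
      simp only [Finset.notMem_empty, if_false, prodExp_const hπ.sum_eq_one]
    | insert t J ht ih =>
      intro hs
      rw [Finset.mem_insert, not_or] at hs
      rw [ih hs.2, ← prodExp_update hπ.sum_eq_one (δ t)]
      congr 1
      ext σ
      simp only [hF σ t _ (Ne.symm hs.1), ← mul_assoc, ← Finset.sum_mul, ← prodExp_const_mul]
      rw [← prodExp_sum, ← prodExp_update hπ.sum_eq_one t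
        (fun y : Fin k → Fin q => ψ (fun j => if j ∈ insert t J then y j else σ (δ j)))]
      congr 2
      ext y
      refine Finset.sum_congr rfl fun a _ => ?_
      congr 2
      ext j
      by_cases hj : j = t
      · subst hj; simp [ht]
      · by_cases hjJ : j ∈ J
        · simp [hjJ, hj]
        · simp [hjJ, hj, Function.update_of_ne (hδ.ne hj)]
  rw [key (Finset.univ.erase s) (Finset.notMem_erase s _), ← prodExp_const_mul]
  congr 1
  ext σ
  rw [← hc (σ (δ s)), ← prodExp_comp_update hπ ψ s]
  congr 2
  ext y
  congr 1
  ext j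
  by_cases hj : j = s
  · subst hj; simp
  · simp [hj]

theorem Explored.root_mem {g : Fin m → Clause Ψ n} {u : Fin n} {S : Finset (Fin n)}
    {A : Finset (Fin m)} (h : Explored g u S A) : u ∈ S := by
  induction h with
  | root => exact Finset.mem_singleton_self u
  | attach S A a s _ _ _ _ _ ih => exact Finset.mem_union_left _ ih

theorem Explored.clause_mem {g : Fin m → Clause Ψ n} {u : Fin n} {S : Finset (Fin n)}
    {A : Finset (Fin m)} (h : Explored g u S A) : ∀ b ∈ A, ∀ j, (g b).1 j ∈ S := by
  induction h with
  | root => simp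
  | attach S A a s _ _ _ _ _ ih =>
    intro b hb j
    rcases Finset.mem_insert.1 hb with rfl | hb
    · exact Finset.mem_union_right _ (Finset.mem_image_of_mem _ (Finset.mem_univ j))
    · exact Finset.mem_union_left _ (ih b hb j)

/-- Under the symmetry condition the root of a tree is independent of everything outside it. -/
theorem Explored.prodExp_eq_zero (hπ : IsCommunityPrior π) (hS : SYM Ψ π)
    {g : Fin m → Clause Ψ n} {u : Fin n} {S : Finset (Fin n)} {A : Finset (Fin m)}
    (h : Explored g u S A) {f : Fin q → ℝ} (hf : ∑ i, π i * f i = 0) (H : (Fin n → Fin q) → ℝ)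
    (hH : ∀ σ v i, v ∈ S → H (Function.update σ v i) = H σ) :
    prodExp π (fun σ => f (σ u) * (∏ a ∈ A, (g a).2.1 (fun j => σ ((g a).1 j))) * H σ) = 0 := by
  -- Clauses are peeled off in reverse order of attachment, each contributing its mean as a constant
  -- factor; at the root the assumption `∑ i, π i * f i = 0` remains.
  induction h generalizing H with
  | root =>
    rw [← prodExp_update hπ.sum_eq_one u]
    simp only [Finset.prod_empty, mul_one, Function.update_self,
      hH _ u _ (Finset.mem_singleton_self u), ← mul_assoc, ← Finset.sum_mul, hf, zero_mul]
    exact prodExp_const hπ.sum_eq_one 0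
  | attach S A a s hE ha hs hinj hfresh ih =>
    have hc : ∀ i, pinned π s i (g a).2.1 = mean π (g a).2.1 := fun i => by
      rw [← condMean_eq_pinned hπ.pos]; exact hS _ (g a).2.2 s i
    have hu := hE.root_mem
    have hAS := hE.clause_mem
    have := prodExp_clause_mul hπ hc hinj
      (F := fun σ => f (σ u) * (∏ a ∈ A, (g a).2.1 (fun j => σ ((g a).1 j))) * H σ) ?_
    · rw [ih H fun σ v i hv => hH σ v i (Finset.mem_union_left _ hv), mul_zero] at this
      rw [← this]
      congr 1
      ext σ
      rw [Finset.prod_insert ha]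
      ring
    · intro σ t i ht
      have hne : ∀ v ∈ S, v ≠ (g a).1 t := fun v hv h' => hfresh t ht (h' ▸ hv)
      have e1 : H (Function.update σ ((g a).1 t) i) = H σ :=
        hH σ _ i (Finset.mem_union_right _ (Finset.mem_image_of_mem _ (Finset.mem_univ t)))
      simp only [e1, Function.update_of_ne (hne u hu)]
      congr 2
      refine Finset.prod_congr rfl fun b hb => ?_
      exact congrArg _ (funext fun j => Function.update_of_ne (hne _ (hAS b hb j)) _ _)

end Tree

/-! ### Stability of the normalisation under few changes -/

section Ratio

variable {k q : ℕ} {Ψ : Finset (Weight k q)} {p : Weight k q → ℝ} {π : Fin q → ℝ}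

/-- Under the symmetry condition the mean weight is stationary at the prior. -/
theorem exists_nhds_abs_wmean_sub_le (hπ : IsCommunityPrior π) (hS : SYM Ψ π) {c : ℝ}
    (hc : 0 < c) :
    ∃ δ : ℝ, 0 < δ ∧ ∀ μ ∈ Metric.ball π δ, ∀ ν ∈ Metric.ball π δ, ∑ i, μ i = ∑ i, ν i →
      |wmean Ψ p μ - wmean Ψ p ν| ≤ c * ‖μ - ν‖ := by
  set D : (Fin q → ℝ) →L[ℝ] ℝ := ∑ ψ ∈ Ψ, p ψ • ∑ x : Fin k → Fin q,
    ψ x • ∑ s : Fin k, (∏ j ∈ Finset.univ.erase s, π (x j)) •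
      ContinuousLinearMap.proj (R := ℝ) (φ := fun _ : Fin q => ℝ) (x s) with hD
  have hder : HasStrictFDerivAt (wmean Ψ p) D π := by
    unfold wmean mean
    refine HasStrictFDerivAt.fun_sum fun ψ _ => HasStrictFDerivAt.const_mul
      (HasStrictFDerivAt.fun_sum fun x _ => HasStrictFDerivAt.mul_const ?_ _) _
    exact HasStrictFDerivAt.finsetProd fun s _ => hasStrictFDerivAt_apply (x s) π
  -- The derivative pairs `h` with the conditional means, which (SYM) makes constant in the
  -- community, so it vanishes in directions of total mass zero. Strict differentiability then
  -- compares any two nearby laws.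
  have hD0 : ∀ h : Fin q → ℝ, ∑ i, h i = 0 → D h = 0 := by
    intro h hh
    have e : ∀ ψ ∈ Ψ, ∑ x : Fin k → Fin q, ψ x * ∑ s : Fin k,
        (∏ j ∈ Finset.univ.erase s, π (x j)) * h (x s) = 0 := by
      intro ψ hψ
      have : ∑ x : Fin k → Fin q, ψ x * ∑ s : Fin k,
          (∏ j ∈ Finset.univ.erase s, π (x j)) * h (x s) =
          ∑ s : Fin k, ∑ i, h i * pinned π s i ψ := by
        simp only [Finset.mul_sum, pinned]
        rw [Finset.sum_comm]
        refine Finset.sum_congr rfl fun s _ => ?_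
        rw [Finset.sum_comm]
        refine Finset.sum_congr rfl fun x _ => ?_
        simp only [mul_ite, mul_zero, Finset.sum_ite_eq, Finset.mem_univ, if_true]
        ring
      rw [this]
      refine Finset.sum_eq_zero fun s _ => ?_
      have e2 : ∀ i, pinned π s i ψ = mean π ψ := fun i => by
        rw [← condMean_eq_pinned hπ.pos]; exact hS ψ hψ s i
      simp only [e2, ← Finset.sum_mul, hh, zero_mul]
    simp only [hD, _root_.sum_apply, _root_.smul_apply, smul_eq_mul,
      ContinuousLinearMap.proj_apply]
    exact Finset.sum_eq_zero fun ψ hψ => by rw [e ψ hψ, mul_zero]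
  have := hder.isLittleO.def hc
  obtain ⟨δ, hδ, hb⟩ := Metric.eventually_nhds_iff_ball.1 this
  refine ⟨δ, hδ, fun μ hμ ν hν hs => ?_⟩
  have h1 := hb (μ, ν) (by rw [← ball_prod_same]; exact ⟨hμ, hν⟩)
  simp only [Real.norm_eq_abs] at h1
  rw [hD0 (μ - ν) (by simp [hs]), sub_zero] at h1
  exact h1

/-- Changing few entries of an assignment changes the empirical distribution little. -/
theorem norm_emp_sub_le {n : ℕ} (hn : 0 < n) {σ τ : Fin n → Fin q} {S : Finset (Fin n)}
    (h : ∀ v ∉ S, σ v = τ v) : ‖emp σ - emp τ‖ ≤ S.card / n := by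
  have hn' : (0 : ℝ) < n := by exact_mod_cast hn
  refine (pi_norm_le_iff_of_nonneg (by positivity)).2 fun i => ?_
  rw [Pi.sub_apply, Real.norm_eq_abs, le_div_iff₀ hn', ← abs_of_pos hn', ← abs_mul,
    mul_comm, mul_sub, mul_emp hn, mul_emp hn, ← Finset.sum_sub_distrib]
  refine (Finset.abs_sum_le_sum_abs _ _).trans ?_
  calc _ ≤ ∑ v, if v ∈ S then (1 : ℝ) else 0 := by
        refine Finset.sum_le_sum fun v _ => ?_
        by_cases hv : v ∈ S
        · rw [if_pos hv]; split_ifs <;> norm_num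
        · rw [if_neg hv, h v hv, sub_self, abs_zero]
    _ = S.card := by simp

/-- The normalisation of the planted model hardly depends on few variables. -/
theorem exists_ratio_bound (hp : IsWeightPrior Ψ p) (hπ : IsCommunityPrior π) (hS : SYM Ψ π)
    {C η : ℝ} (hC : 0 < C) (hη : 0 < η) (L : ℕ) :
    ∃ δ : ℝ, 0 < δ ∧ ∀ n : ℕ, 0 < n → ∀ m : ℕ, m ≤ C * n → ∀ σ τ : Fin n → Fin q,
      ∀ S : Finset (Fin n), S.card ≤ L → (∀ v ∉ S, σ v = τ v) → emp σ ∈ Metric.ball π δ →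
        emp τ ∈ Metric.ball π δ →
          |(wmean Ψ p (emp σ) / wmean Ψ p (emp τ)) ^ m - 1| ≤ η := by
  obtain ⟨lo, hi, hlo, -, hb⟩ := hp.exists_bounds
  obtain ⟨t, ht0, ht1, htη⟩ : ∃ t : ℝ, 0 < t ∧ t ≤ 1 ∧ 2 * t ≤ η :=
    ⟨min 1 (η / 2), lt_min one_pos (by positivity), min_le_left _ _,
      by linarith [min_le_right 1 (η / 2)]⟩
  -- Moving `L` entries shifts the empirical law by at most `L / n`, so this slope keeps the ratio
  -- within `t / (C * n)` of `1`. Using `L + 1` keeps the slope well defined for `L = 0`.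
  obtain ⟨δ, hδ, hδb⟩ := exists_nhds_abs_wmean_sub_le (p := p) hπ hS
    (c := t * lo / (C * (L + 1))) (by positivity)
  refine ⟨δ, hδ, fun n hn m hm σ τ S hSL hστ hσ hτ => ?_⟩
  have hn' : (0 : ℝ) < n := by exact_mod_cast hn
  have hwτ : lo ≤ wmean Ψ p (emp τ) :=
    hp.le_wmean (fun ψ hψ x => (hb ψ hψ x).1) (emp_nonneg τ) (sum_emp hn τ)
  have hwτ0 := hlo.trans_le hwτ
  set x := wmean Ψ p (emp σ) / wmean Ψ p (emp τ) with hx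
  have hx0 : 0 < x := div_pos (hp.wmean_pos (emp_nonneg σ) (sum_emp hn σ)) hwτ0
  set b := t / (C * n) with hbdef
  have hb0 : 0 < b := by positivity
  have hx1 : |x - 1| ≤ b := by
    have h1 := hδb _ hσ _ hτ (by rw [sum_emp hn, sum_emp hn])
    have h2 := (norm_emp_sub_le hn hστ).trans
      (div_le_div_of_nonneg_right (Nat.cast_le.2 hSL) hn'.le)
    have h3 : x - 1 = (wmean Ψ p (emp σ) - wmean Ψ p (emp τ)) / wmean Ψ p (emp τ) := by
      rw [hx]; field_simp
    rw [h3, abs_div, abs_of_pos hwτ0, div_le_iff₀ hwτ0]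
    have h4 : ‖emp σ - emp τ‖ ≤ (L + 1) / n := h2.trans (by gcongr; linarith)
    calc _ ≤ t * lo / (C * (L + 1)) * ((L + 1) / n) := h1.trans (by gcongr)
      _ = b * lo := by rw [hbdef]; field_simp
      _ ≤ _ := by gcongr
  have hmb : m * b ≤ t := by
    calc m * b ≤ C * n * b := by gcongr
      _ = t := by rw [hbdef]; field_simp
  rw [abs_le] at hx1 ⊢
  constructor
  -- Bernoulli's inequality gives the lower bound; the upper bound is `exp t ≤ 1 + t + t ^ 2 ≤ 1 + 2
  -- * t`.
  · have := one_add_mul_le_pow (show (-2 : ℝ) ≤ x - 1 by linarith) m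
    rw [add_sub_cancel] at this
    have h5 : (m : ℝ) * (-b) ≤ m * (x - 1) := mul_le_mul_of_nonneg_left hx1.1 (Nat.cast_nonneg m)
    linarith
  · have h6 : x ^ m ≤ Real.exp t := by
      calc x ^ m ≤ Real.exp b ^ m :=
            pow_le_pow_left₀ hx0.le (by linarith [Real.add_one_le_exp b]) m
        _ = Real.exp (m * b) := (Real.exp_nat_mul b m).symm
        _ ≤ _ := Real.exp_le_exp.2 hmb
    have h7 := (abs_le.1 (Real.abs_exp_sub_one_sub_id_le (x := t) (by rwa [abs_of_pos ht0]))).2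
    nlinarith

end Ratio

/-! ### Asymptotic decorrelation given the graph -/

section Correlation

variable {k q : ℕ} {Ψ : Finset (Weight k q)} {p : Weight k q → ℝ} {π : Fin q → ℝ} {n m : ℕ}

/-- The likelihood splits into a factor free of `σ`, a product of local weights, and a global factor
depending on `emp σ`. -/
theorem prod_clauseProb (hn : 0 < n) (σ : Fin n → Fin q) (g : Fin m → Clause Ψ n) :
    ∏ a, clauseProb Ψ p σ (g a) = (∏ a, p (g a).2.1 / (n : ℝ) ^ k) *
      (∏ a, (g a).2.1 (fun j => σ ((g a).1 j))) * (1 / wmean Ψ p (emp σ)) ^ m := by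
  have : ∀ a, clauseProb Ψ p σ (g a) = p (g a).2.1 / (n : ℝ) ^ k *
      (g a).2.1 (fun j => σ ((g a).1 j)) * (1 / wmean Ψ p (emp σ)) := by
    intro a
    rw [clauseProb_eq hn, div_mul_eq_mul_div, div_mul_div_comm, mul_one]
  rw [Finset.prod_congr rfl fun a _ => this a, Finset.prod_mul_distrib, Finset.prod_mul_distrib,
    Finset.prod_const, Finset.card_univ, Fintype.card_fin]

open Classical in
/-- Given the factor graph, the communities of the root of a small tree component and of a variable
outside it are almost uncorrelated. -/
theorem IsTreeComp.abs_corr_le (hp : IsWeightPrior Ψ p) (hπ : IsCommunityPrior π) (hS : SYM Ψ π)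
    (hn : 0 < n) {L : ℕ} {δ η : ℝ} (hLn : L / n < δ / 4)
    (hratio : ∀ σ τ : Fin n → Fin q, ∀ S : Finset (Fin n), S.card ≤ L → (∀ v ∉ S, σ v = τ v) →
      emp σ ∈ Metric.ball π δ → emp τ ∈ Metric.ball π δ →
        |(wmean Ψ p (emp σ) / wmean Ψ p (emp τ)) ^ m - 1| ≤ η) (hη : 0 ≤ η)
    {g : Fin m → Clause Ψ n} {u v : Fin n} {S : Finset (Fin n)} {A : Finset (Fin m)}
    (hT : IsTreeComp g u L S A) (hv : v ∉ S) {f : Fin q → ℝ} (hf : ∑ i, π i * f i = 0)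
    (hf1 : ∀ i, |f i| ≤ 1) :
    |prodExp π (fun σ => (∏ a, clauseProb Ψ p σ (g a)) * (f (σ u) * f (σ v)))| ≤
      prodExp π (fun σ => (∏ a, clauseProb Ψ p σ (g a)) *
        (η + if emp σ ∈ Metric.ball π (δ / 2) then 0 else 1)) := by
  obtain ⟨hE, hSL, hclosed⟩ := hT
  have hπ0 : ∀ i, 0 ≤ π i := fun i => (hπ.pos i).le
  rcases isEmpty_or_nonempty (Fin q) with hq | ⟨⟨c₀⟩⟩
  · exact absurd hπ.sum_eq_one (by simp)
  set Q : (Fin n → Fin q) → ℝ := fun σ => ∏ a, clauseProb Ψ p σ (g a) with hQ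
  have hQ0 : ∀ σ, 0 ≤ Q σ := fun σ => Finset.prod_nonneg fun a _ => hp.clauseProb_nonneg σ _
  -- `z σ` freezes the communities on the tree. The cut-off `T` and the substitute normalisation at
  -- `z σ` are therefore functions of the outside only; `x` converts one normalisation into the
  -- other.
  set z : (Fin n → Fin q) → (Fin n → Fin q) := fun σ w => if w ∈ S then c₀ else σ w with hz
  have hzS : ∀ σ, ∀ w ∉ S, σ w = z σ w := fun σ w hw => by simp [hz, hw]
  set T : (Fin n → Fin q) → ℝ := fun σ =>
    if emp (z σ) ∈ Metric.ball π (3 * δ / 4) then 1 else 0 with hTdef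
  set x : (Fin n → Fin q) → ℝ := fun σ =>
    (wmean Ψ p (emp σ) / wmean Ψ p (emp (z σ))) ^ m with hx
  have hδ : 0 < δ := by
    have : (0 : ℝ) ≤ L / n := by positivity
    linarith
  have hdist : ∀ σ, dist (emp σ) (emp (z σ)) < δ / 4 := fun σ => by
    rw [dist_eq_norm]
    refine ((norm_emp_sub_le hn (hzS σ)).trans ?_).trans_lt hLn
    gcongr
  -- After the substitution the integrand is the tree weight times a function of the outside, so the
  -- root averages out exactly.
  have hzero : prodExp π (fun σ => Q σ * x σ * T σ * (f (σ u) * f (σ v))) = 0 := by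
    have h1 := hE.prodExp_eq_zero hπ hS hf (fun σ => (∏ a ∈ Aᶜ, (g a).2.1
      (fun j => σ ((g a).1 j))) * ((1 / wmean Ψ p (emp (z σ))) ^ m * T σ * f (σ v))) ?_
    · rw [← mul_zero (∏ a, p (g a).2.1 / (n : ℝ) ^ k), ← h1, ← prodExp_const_mul]
      congr 1
      ext σ
      have hw := (hp.wmean_pos (emp_nonneg σ) (sum_emp hn σ)).ne'
      have e : (1 / wmean Ψ p (emp σ)) ^ m * x σ = (1 / wmean Ψ p (emp (z σ))) ^ m := by
        rw [hx, ← mul_pow]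
        congr 1
        field_simp
      rw [← e]
      simp only [hQ, prod_clauseProb hn, ← Finset.prod_mul_prod_compl A
        (fun a => (g a).2.1 (fun j => σ ((g a).1 j)))]
      ring
    · intro σ w i hw
      have ez : z (Function.update σ w i) = z σ := by
        ext1 w'
        by_cases hw' : w' ∈ S
        · simp [hz, hw']
        · have : w' ≠ w := fun h => hw' (h ▸ hw)
          simp [hz, hw', this]
      have hvw : v ≠ w := fun h => hv (h ▸ hw)
      simp only [hTdef, ez, Function.update_of_ne hvw]
      congr 1
      refine Finset.prod_congr rfl fun a ha => ?_
      refine congrArg _ (funext fun j => Function.update_of_ne (fun h => ?_) _ _)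
      exact hclosed a (Finset.mem_compl.1 ha) j (h ▸ hw)
  -- What survives is `1 - x * T`. It is at most `η` in size where `T = 1`, and equals `1` where `T
  -- = 0`. The radius `3 * δ / 4` leaves room `δ / 4` on both sides for passing between `σ` and `z
  -- σ`.
  have e2 : prodExp π (fun σ => Q σ * (f (σ u) * f (σ v))) =
      prodExp π (fun σ => Q σ * ((1 - x σ * T σ) * (f (σ u) * f (σ v)))) := by
    rw [← sub_zero (prodExp π (fun σ => Q σ * (f (σ u) * f (σ v)))), ← hzero, ← prodExp_sub]
    congr 1
    ext σ
    ring
  rw [e2]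
  refine (abs_prodExp_le hπ0 _).trans (prodExp_mono hπ0 fun σ => ?_)
  rw [abs_mul, abs_of_nonneg (hQ0 σ)]
  refine mul_le_mul_of_nonneg_left ?_ (hQ0 σ)
  rw [abs_mul]
  have hff : |f (σ u) * f (σ v)| ≤ 1 := by
    rw [abs_mul]; exact mul_le_one₀ (hf1 _) (abs_nonneg _) (hf1 _)
  refine (mul_le_of_le_one_right (abs_nonneg _) hff).trans ?_
  by_cases hz1 : emp (z σ) ∈ Metric.ball π (3 * δ / 4)
  · have hσ : emp σ ∈ Metric.ball π δ := by
      rw [Metric.mem_ball] at hz1 ⊢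
      linarith [dist_triangle (emp σ) (emp (z σ)) π, hdist σ]
    have h3 := hratio σ (z σ) S hSL (hzS σ) hσ (Metric.ball_subset_ball (by linarith) hz1)
    simp only [hTdef, if_pos hz1, mul_one]
    rw [abs_sub_comm]
    refine h3.trans ?_
    split_ifs <;> linarith
  · have hσ : emp σ ∉ Metric.ball π (δ / 2) := by
      intro h
      apply hz1
      rw [Metric.mem_ball] at h ⊢
      have := hdist σ
      rw [dist_comm] at this
      linarith [dist_triangle (emp (z σ)) (emp σ) π]
    simp only [hTdef, if_neg hz1, mul_zero, sub_zero, abs_one, if_neg hσ]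
    linarith

open Classical in
theorem sum_clauseProb_marginal (hn : 0 < n) (σ : Fin n → Fin q) (s : Fin k) (v : Fin n) :
    ∑ c, clauseProb Ψ p σ c * (if c.1 s = v then (1 : ℝ) else 0) =
      (∑ ψ ∈ Ψ, p ψ * pinned (emp σ) s (σ v) ψ) / wmean Ψ p (emp σ) / n := by
  have hn' : (n : ℝ) ≠ 0 := by positivity
  rw [sum_clauseProb_mul hn, ← Finset.sum_coe_sort Ψ (fun ψ => p ψ * pinned (emp σ) s (σ v) ψ),
    Finset.sum_div, Finset.sum_div, Finset.sum_div]
  refine Finset.sum_congr rfl fun ψ _ => ?_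
  have h : ∑ x : Fin k → Fin n, ψ.1 (fun j => σ (x j)) *
      (if x s = v then (1 : ℝ) else 0) = (n : ℝ) ^ k / n * pinned (emp σ) s (σ v) ψ.1 := by
    rw [← sum_pinned_comp_eq hn]
    exact Finset.sum_congr rfl fun x _ => by simp
  rw [h]
  field_simp

/-- Under the symmetry condition the marginals of a clause are almost uniform. -/
theorem eventually_marginal_le (hp : IsWeightPrior Ψ p) (hπ : IsCommunityPrior π) (hS : SYM Ψ π)
    {η : ℝ} (hη : 0 < η) :
    ∀ᶠ μ in 𝓝 π, ∀ (s : Fin k) (i : Fin q),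
      (∑ ψ ∈ Ψ, p ψ * pinned μ s i ψ) / wmean Ψ p μ < 1 + η := by
  refine eventually_all.2 fun s => eventually_all.2 fun i => ?_
  have hw0 : 0 < wmean Ψ p π := hp.wmean_pos (fun i => (hπ.pos i).le) hπ.sum_eq_one
  have hc : ContinuousAt (fun μ => (∑ ψ ∈ Ψ, p ψ * pinned μ s i ψ) / wmean Ψ p μ) π :=
    (continuous_finsetSum _ fun ψ _ =>
      (continuous_pinned s i ψ).const_mul _).continuousAt.div
      continuous_wmean.continuousAt hw0.ne'
  refine hc.eventually_lt_const ?_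
  have : ∑ ψ ∈ Ψ, p ψ * pinned π s i ψ = wmean Ψ p π :=
    Finset.sum_congr rfl fun ψ hψ => by rw [← condMean_eq_pinned hπ.pos, hS ψ hψ s i]
  beta_reduce
  rw [this, div_self hw0.ne']
  linarith

/-- The law of a clause neighbourhood has density at most `hi / lo` with respect to the uniform one.
-/
theorem IsWeightPrior.sum_clauseProb_le (hp : IsWeightPrior Ψ p) {lo hi : ℝ} (hlo : 0 < lo)
    (hb : ∀ ψ ∈ Ψ, ∀ x, lo ≤ ψ x ∧ ψ x ≤ hi) (hn : 0 < n) (σ : Fin n → Fin q)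
    (F : (Fin k → Fin n) → ℝ) (hF : ∀ δ, 0 ≤ F δ) :
    ∑ c, clauseProb Ψ p σ c * F c.1 ≤ hi / lo * prodExp (fun _ : Fin n => 1 / (n : ℝ)) F := by
  have hn' : (0 : ℝ) < n := by exact_mod_cast hn
  have hw : lo ≤ wmean Ψ p (emp σ) :=
    hp.le_wmean (fun ψ hψ x => (hb ψ hψ x).1) (emp_nonneg σ) (sum_emp hn σ)
  have hw0 := hlo.trans_le hw
  have hhi : 0 ≤ hi := hlo.le.trans (hw.trans
    (hp.wmean_le (fun ψ hψ x => (hb ψ hψ x).2) (emp_nonneg σ) (sum_emp hn σ)))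
  have hF0 : 0 ≤ ∑ δ, F δ := Finset.sum_nonneg fun δ _ => hF δ
  have e : prodExp (fun _ : Fin n => 1 / (n : ℝ)) F = (∑ δ, F δ) / (n : ℝ) ^ k := by
    simp only [prodExp, Finset.prod_const, Finset.card_univ, Fintype.card_fin, ← Finset.mul_sum,
      div_pow, one_pow]
    rw [one_div_mul_eq_div]
  rw [sum_clauseProb_mul hn, e]
  have h1 : ∑ ψ : {ψ // ψ ∈ Ψ}, p ψ.1 * ∑ v : Fin k → Fin n, ψ.1 (fun s => σ (v s)) * F v ≤
      ∑ ψ : {ψ // ψ ∈ Ψ}, p ψ.1 * (hi * ∑ δ, F δ) := by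
    refine Finset.sum_le_sum fun ψ _ => mul_le_mul_of_nonneg_left ?_ (hp.pos _ ψ.2).le
    rw [Finset.mul_sum]
    exact Finset.sum_le_sum fun v _ => mul_le_mul_of_nonneg_right (hb _ ψ.2 _).2 (hF v)
  rw [← Finset.sum_mul, Finset.sum_coe_sort Ψ p, hp.sum_eq_one, one_mul] at h1
  calc _ ≤ hi * (∑ δ, F δ) / ((n : ℝ) ^ k * lo) := by gcongr
    _ = _ := by field_simp

/-- Once the graph is summed last, an estimator is a fixed assignment inside each term. -/
theorem prodExp_prodExp_comm {w : (Fin n → Fin q) → Clause Ψ n → ℝ}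
    (F : (Fin n → Fin q) → (Fin m → Clause Ψ n) → ℝ) :
    prodExp π (fun σ => prodExp (w σ) (F σ)) =
      ∑ g, prodExp π (fun σ => (∏ a, w σ (g a)) * F σ g) := by
  simp only [prodExp, Finset.mul_sum]
  exact Finset.sum_comm

open Classical in
/-- The second moment given the factor graph. -/
theorem prodExp_sq_le (hp : IsWeightPrior Ψ p) (hπ : IsCommunityPrior π) (hS : SYM Ψ π)
    (hn : 0 < n) {L : ℕ} {δ η : ℝ} (hLn : L / n < δ / 4)
    (hratio : ∀ σ τ : Fin n → Fin q, ∀ S : Finset (Fin n), S.card ≤ L → (∀ v ∉ S, σ v = τ v) →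
      emp σ ∈ Metric.ball π δ → emp τ ∈ Metric.ball π δ →
        |(wmean Ψ p (emp σ) / wmean Ψ p (emp τ)) ^ m - 1| ≤ η) (hη : 0 ≤ η)
    (g : Fin m → Clause Ψ n) (B : Finset (Fin n)) {f : Fin q → ℝ} (hf : ∑ i, π i * f i = 0)
    (hf1 : ∀ i, |f i| ≤ 1) :
    prodExp π (fun σ => (∏ a, clauseProb Ψ p σ (g a)) * (∑ v ∈ B, f (σ v)) ^ 2) ≤
      prodExp π (fun σ => (∏ a, clauseProb Ψ p σ (g a)) * ∑ u : Fin n,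
        (n * (η + if emp σ ∈ Metric.ball π (δ / 2) then 0 else 1) +
          (L + n * if ∃ S A, IsTreeComp g u L S A then (0 : ℝ) else 1))) := by
  have hπ0 : ∀ i, 0 ≤ π i := fun i => (hπ.pos i).le
  set Q : (Fin n → Fin q) → ℝ := fun σ => ∏ a, clauseProb Ψ p σ (g a) with hQ
  have hQ0 : ∀ σ, 0 ≤ Q σ := fun σ => Finset.prod_nonneg fun a _ => hp.clauseProb_nonneg σ _
  set D := prodExp π (fun σ => Q σ * (η + if emp σ ∈ Metric.ball π (δ / 2) then (0 : ℝ) else 1))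
    with hD
  have hD0 : 0 ≤ D := prodExp_nonneg hπ0 fun σ => mul_nonneg (hQ0 σ) (by split_ifs <;> linarith)
  have hQE : 0 ≤ prodExp π Q := prodExp_nonneg hπ0 hQ0
  have htriv : ∀ u v, |prodExp π (fun σ => Q σ * (f (σ u) * f (σ v)))| ≤ prodExp π Q := by
    intro u v
    refine (abs_prodExp_le hπ0 _).trans (prodExp_mono hπ0 fun σ => ?_)
    rw [abs_mul, abs_of_nonneg (hQ0 σ), abs_mul]
    exact mul_le_of_le_one_right (hQ0 σ) (mul_le_one₀ (hf1 _) (abs_nonneg _) (hf1 _))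
  -- For a tree root, variables outside the tree cost `D` each and the at most `L` inside are
  -- bounded trivially; for any other `u` all `n` terms are.
  have hu : ∀ u, ∑ v ∈ B, |prodExp π (fun σ => Q σ * (f (σ u) * f (σ v)))| ≤
      n * D + (L + n * if ∃ S A, IsTreeComp g u L S A then (0 : ℝ) else 1) * prodExp π Q := by
    intro u
    refine (Finset.sum_le_sum_of_subset_of_nonneg (Finset.subset_univ B)
      fun _ _ _ => abs_nonneg _).trans ?_
    split_ifs with hT
    · obtain ⟨S, A, hT⟩ := hT
      calc _ ≤ ∑ v, (D + (if v ∈ S then (1 : ℝ) else 0) * prodExp π Q) := by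
            refine Finset.sum_le_sum fun v _ => ?_
            by_cases hv : v ∈ S
            · rw [if_pos hv, one_mul]; linarith [htriv u v]
            · rw [if_neg hv, zero_mul, add_zero]
              exact hT.abs_corr_le hp hπ hS hn hLn hratio hη hv hf hf1
        _ = n * D + S.card * prodExp π Q := by
            rw [Finset.sum_add_distrib, ← Finset.sum_mul]; simp
        _ ≤ _ := by
            rw [mul_zero, add_zero]
            gcongr
            exact hT.2.1
    · calc _ ≤ ∑ v : Fin n, prodExp π Q := Finset.sum_le_sum fun v _ => htriv u v
        _ = n * prodExp π Q := by simp
        _ ≤ _ := by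
            have : 0 ≤ n * D := by positivity
            have : 0 ≤ L * prodExp π Q := by positivity
            nlinarith
  calc prodExp π (fun σ => Q σ * (∑ v ∈ B, f (σ v)) ^ 2)
      = ∑ u ∈ B, ∑ v ∈ B, prodExp π (fun σ => Q σ * (f (σ u) * f (σ v))) := by
        simp only [← prodExp_sum, ← Finset.mul_sum]
        congr 1
        ext σ
        rw [sq, Finset.sum_mul_sum]
        simp only [Finset.mul_sum]
    _ ≤ ∑ u ∈ B, ∑ v ∈ B, |prodExp π (fun σ => Q σ * (f (σ u) * f (σ v)))| :=
        Finset.sum_le_sum fun u _ => Finset.sum_le_sum fun v _ => le_abs_self _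
    _ ≤ ∑ u, ∑ v ∈ B, |prodExp π (fun σ => Q σ * (f (σ u) * f (σ v)))| :=
        Finset.sum_le_sum_of_subset_of_nonneg (Finset.subset_univ B)
          fun _ _ _ => Finset.sum_nonneg fun _ _ => abs_nonneg _
    _ ≤ ∑ u, (n * D + (L + n * if ∃ S A, IsTreeComp g u L S A then (0 : ℝ) else 1) *
          prodExp π Q) := Finset.sum_le_sum fun u _ => hu u
    _ = _ := by
        simp only [hD, ← prodExp_const_mul, ← prodExp_add, ← prodExp_sum]
        congr 1
        ext σ
        rw [Finset.mul_sum]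
        exact Finset.sum_congr rfl fun u _ => by ring

open Classical in
/-- Below the branching threshold, every estimated class is asymptotically uncorrelated with the
planted assignment. -/
theorem eventually_second_moment_le (hp : IsWeightPrior Ψ p) (hπ : IsCommunityPrior π)
    (hS : SYM Ψ π) {C : ℝ} (hC : 0 < C) (hCk : C * (k * k - k : ℕ) < 1) {κ : ℝ} (hκ : 0 < κ) :
    ∀ᶠ n : ℕ in atTop, ∀ m : ℕ, m ≤ C * n → ∀ B : (Fin m → Clause Ψ n) → Finset (Fin n),
      ∀ f : Fin q → ℝ, ∑ i, π i * f i = 0 → (∀ i, |f i| ≤ 1) →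
        prodExp π (fun σ => prodExp (clauseProb Ψ p σ) (fun g => (∑ v ∈ B g, f (σ v)) ^ 2)) ≤
          κ * n ^ 2 := by
  have hπ0 : ∀ i, 0 ≤ π i := fun i => (hπ.pos i).le
  obtain ⟨lo, hi, hlo, hlohi, hb⟩ := hp.exists_bounds
  have hhi : 0 < hi := hlo.trans_le hlohi
  set N : ℝ := ((k * k - k : ℕ) : ℝ) with hN
  have hN0 : 0 ≤ N := Nat.cast_nonneg _
  -- The clause marginals are below `(1 + θ) / n` for typical `σ`; `θ` is the slack that keeps the
  -- branching number `ρ` below one.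
  obtain ⟨θ, hθ0, hθ⟩ : ∃ θ : ℝ, 0 < θ ∧ C * N * (1 + θ) < 1 := by
    refine ⟨(1 - C * N) / 2, by linarith, ?_⟩
    have : 0 ≤ C * N := by positivity
    nlinarith
  set ρ := C * N * (1 + θ) with hρ
  have hρ1 : 0 < 1 - ρ := by linarith
  obtain ⟨L, hL⟩ := exists_nat_gt (1 / (1 - ρ) / (κ / 6))
  have hLpos : (0 : ℝ) < L := lt_trans (by positivity) hL
  have hLρ : 1 / (1 - ρ) / L ≤ κ / 6 := by
    rw [div_le_iff₀ hLpos, mul_comm]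
    exact ((div_lt_iff₀ (by positivity)).1 hL).le
  obtain ⟨δ, hδ, hratio⟩ := exists_ratio_bound hp hπ hS hC (show (0 : ℝ) < κ / 6 by positivity) L
  have hV := tendsto_emp_not_mem hπ0 hπ.sum_eq_one
    (Metric.ball_mem_nhds π (show (0 : ℝ) < δ / 2 by positivity))
  obtain ⟨V', hV'n, hV'⟩ : ∃ V' ∈ 𝓝 π, ∀ μ ∈ V', ∀ (s : Fin k) (i : Fin q),
      (∑ ψ ∈ Ψ, p ψ * pinned μ s i ψ) / wmean Ψ p μ < 1 + θ :=
    ⟨_, eventually_marginal_le hp hπ hS hθ0, fun _ h => h⟩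
  have hV'n := tendsto_emp_not_mem hπ0 hπ.sum_eq_one hV'n
  have hinv : ∀ c : ℝ, Tendsto (fun n : ℕ => c / n) atTop (𝓝 0) :=
    fun c => tendsto_const_div_atTop_nhds_zero_nat c
  set K : ℝ := C * (hi / lo * (k ^ 2 * L ^ 2 + k ^ 3 * L)) with hK
  filter_upwards [eventually_gt_atTop 0, hV.eventually_le_const (show (0 : ℝ) < κ / 6 by positivity),
    hV'n.eventually_le_const (show (0 : ℝ) < κ / 6 by positivity),
    (hinv L).eventually_le_const (show (0 : ℝ) < κ / 6 by positivity),
    (hinv L).eventually_lt_const (show (0 : ℝ) < δ / 4 by positivity),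
    (hinv K).eventually_le_const (show (0 : ℝ) < κ / 6 by positivity)]
    with n hn hVn hV'n hLn hLn' hKn m hm B f hf hf1
  have hn' : (0 : ℝ) < n := by exact_mod_cast hn
  -- The three sixths pay for large components, unclean attachments and atypical empirical laws. In
  -- `hterm`, the other three pay for the ratio error, the cut-off and the variables inside the
  -- tree.
  have htree : ∀ u : Fin n, prodExp π (fun σ => prodExp (clauseProb Ψ p σ)
      (fun g : Fin m → Clause Ψ n => if ∃ S A, IsTreeComp g u L S A then (0 : ℝ) else 1)) ≤
      κ / 6 + κ / 6 + κ / 6 := by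
    intro u
    have hσ : ∀ σ : Fin n → Fin q, prodExp (clauseProb Ψ p σ)
        (fun g : Fin m → Clause Ψ n => if ∃ S A, IsTreeComp g u L S A then (0 : ℝ) else 1) ≤
        κ / 6 + κ / 6 + if emp σ ∈ V' then (0 : ℝ) else 1 := by
      intro σ
      by_cases h : emp σ ∈ V'
      · rw [if_pos h, add_zero]
        refine (prodExp_not_isTreeComp_le hn (hp.clauseProb_nonneg σ) (hp.sum_clauseProb hn σ)
          (M := (1 + θ) / n) (ρ := ρ) (R := hi / lo) ?_ (by positivity) (by linarith) m ?_
          (hp.sum_clauseProb_le hlo hb hn σ) (by positivity) u (by exact_mod_cast hLpos)).trans ?_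
        · intro s v
          have := sum_clauseProb_marginal (Ψ := Ψ) (p := p) hn σ s v
          refine le_trans (le_of_eq ?_) (this.le.trans
            (div_le_div_of_nonneg_right (hV' _ h s (σ v)).le hn'.le))
          congr!
        · calc (m : ℝ) * (N * ((1 + θ) / n)) ≤ C * n * (N * ((1 + θ) / n)) := by gcongr
            _ = ρ := by rw [hρ]; field_simp
        · refine add_le_add hLρ (le_trans ?_ hKn)
          calc (m : ℝ) * (hi / lo * ((k ^ 2 * L ^ 2 + k ^ 3 * L) / n ^ 2)) ≤
                C * n * (hi / lo * ((k ^ 2 * L ^ 2 + k ^ 3 * L) / n ^ 2)) := by gcongr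
            _ = K / n := by rw [hK]; field_simp
      · rw [if_neg h]
        refine (prodExp_le_const (c := 1) (hp.clauseProb_nonneg σ) (hp.sum_clauseProb hn σ)
          fun g => ?_).trans (by linarith)
        split_ifs <;> norm_num
    refine (prodExp_mono hπ0 hσ).trans ?_
    rw [prodExp_add, prodExp_const hπ.sum_eq_one]
    exact add_le_add le_rfl hV'n
  rw [prodExp_prodExp_comm]
  refine (Finset.sum_le_sum fun g _ => prodExp_sq_le hp hπ hS hn hLn' (hratio n hn m hm)
    (by positivity) g (B g) hf hf1).trans ?_
  rw [← prodExp_prodExp_comm (w := clauseProb Ψ p) (F := fun σ (g : Fin m → Clause Ψ n) =>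
    ∑ u : Fin n, (n * (κ / 6 + if emp σ ∈ Metric.ball π (δ / 2) then 0 else 1) +
      (L + n * if ∃ S A, IsTreeComp g u L S A then (0 : ℝ) else 1)))]
  simp only [prodExp_sum]
  have hterm : ∀ u : Fin n, prodExp π (fun σ => prodExp (clauseProb Ψ p σ)
      (fun g : Fin m → Clause Ψ n =>
        (n * (κ / 6 + if emp σ ∈ Metric.ball π (δ / 2) then 0 else 1) +
        (L + n * if ∃ S A, IsTreeComp g u L S A then (0 : ℝ) else 1)))) ≤ κ * n := by
    intro u
    simp only [prodExp_add, prodExp_const_mul, prodExp_const (hp.sum_clauseProb hn _)]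
    simp only [prodExp_const hπ.sum_eq_one]
    have h1 : (n : ℝ) * prodExp π (fun σ : Fin n → Fin q =>
        if emp σ ∈ Metric.ball π (δ / 2) then (0 : ℝ) else 1) ≤ n * (κ / 6) := by gcongr
    have h2 := mul_le_mul_of_nonneg_left (htree u) hn'.le
    have h3 : (L : ℝ) ≤ κ / 6 * n := by rwa [div_le_iff₀ hn'] at hLn
    linarith
  refine (Finset.sum_le_sum fun u _ => hterm u).trans_eq ?_
  rw [Finset.sum_const, Finset.card_univ, Fintype.card_fin, nsmul_eq_mul]
  ring

end Correlation

/-! ### From decorrelation to the failure of weak recovery -/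

section Impossibility

variable {k q : ℕ} {Ψ : Finset (Weight k q)} {p : Weight k q → ℝ} {π : Fin q → ℝ} {n m : ℕ}

/-- The indicator of a community, centred under the prior. -/
def centred (π : Fin q → ℝ) (i a : Fin q) : ℝ := (if a = i then 1 else 0) - π i

theorem sum_mul_centred (hπ : IsCommunityPrior π) (i : Fin q) : ∑ a, π a * centred π i a = 0 := by
  simp [centred, mul_sub, Finset.sum_sub_distrib, ← Finset.sum_mul, hπ.sum_eq_one]

theorem abs_centred_le (hπ : IsCommunityPrior π) (i a : Fin q) : |centred π i a| ≤ 1 := by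
  have h0 := hπ.pos i
  have h1 : π i ≤ 1 := hπ.sum_eq_one ▸
    Finset.single_le_sum (fun j _ => (hπ.pos j).le) (Finset.mem_univ i)
  unfold centred
  rw [abs_le]
  split_ifs <;> constructor <;> linarith

theorem mul_jemp_eq (hn : 0 < n) (π : Fin q → ℝ) (σ τ : Fin n → Fin q) (i j : Fin q) :
    n * jemp σ τ (i, j) =
      ∑ v ∈ Finset.univ.filter (fun v => τ v = j), centred π i (σ v) + π i * (n * emp τ j) := by
  have hn' : (n : ℝ) ≠ 0 := by positivity
  simp only [centred, Finset.sum_sub_distrib, Finset.sum_const, nsmul_eq_mul]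
  rw [card_eq_mul_emp hn, Finset.sum_boole, Finset.filter_filter, jemp_eq,
    mul_div_cancel₀ _ hn']
  simp only [and_comm]
  ring

/-- The overlap is at most `1/q` up to the correlations of the classes with the communities. -/
theorem overlap_le_of_emp (hn : 0 < n) (hq : 0 < q) {σ : Fin n → Fin q}
    (τ : Fin n → Fin q) {c δ t : ℝ} (hc : 0 < c) (hδ : 0 ≤ δ) (ht : 0 < t)
    (hσc : ∀ i, c ≤ emp σ i) (hσδ : ∀ i, |emp σ i - π i| ≤ δ) :
    overlap σ τ ≤ 1 / q + 1 / c * (δ + ∑ i, ∑ j, (t +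
      (∑ v ∈ Finset.univ.filter (fun v => τ v = j), centred π i (σ v)) ^ 2 / (t * n ^ 2))) := by
  have hn' : (0 : ℝ) < n := by exact_mod_cast hn
  have hq' : (1 : ℝ) ≤ q := by exact_mod_cast hq
  have hq0 : (0 : ℝ) < q := by linarith
  have : Nonempty (Equiv.Perm (Fin q)) := ⟨Equiv.refl _⟩
  set X : Fin q → Fin q → ℝ := fun i j =>
    ∑ v ∈ Finset.univ.filter (fun v => τ v = j), centred π i (σ v) with hX
  -- A weighted arithmetic-geometric mean inequality trades `|X|` for `X ^ 2`, so that a second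
  -- moment bound suffices.
  have hXt : ∀ i j, |X i j| / n ≤ t + (X i j) ^ 2 / (t * n ^ 2) := by
    intro i j
    have e : t + (X i j) ^ 2 / (t * n ^ 2) - |X i j| / n =
        ((t - |X i j| / n) ^ 2 + t * (|X i j| / n)) / t := by
      rw [← sq_abs (X i j)]
      field_simp
      ring
    have : 0 ≤ ((t - |X i j| / n) ^ 2 + t * (|X i j| / n)) / t := by positivity
    linarith
  set W := ∑ i, ∑ j, (t + (X i j) ^ 2 / (t * n ^ 2)) with hW
  have hW0 : ∀ i j, 0 ≤ t + (X i j) ^ 2 / (t * n ^ 2) := fun i j => by positivity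
  refine ciSup_le fun Γ => ?_
  simp only [card_div_card_eq hn]
  -- The main term is `emp τ (Γ i)`; summed over `i` it gives `1` for every `Γ`, whence the `1/q`.
  have hterm : ∀ i, jemp σ τ (i, Γ i) / emp σ i ≤
      emp τ (Γ i) + (δ + ∑ j, (t + (X i j) ^ 2 / (t * n ^ 2))) / c := by
    intro i
    have hi := hc.trans_le (hσc i)
    have h1 := mul_jemp_eq hn π σ τ i (Γ i)
    have h2 : jemp σ τ (i, Γ i) / emp σ i = emp τ (Γ i) +
        (X i (Γ i) / n + (π i - emp σ i) * emp τ (Γ i)) / emp σ i := by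
      have : jemp σ τ (i, Γ i) = X i (Γ i) / n + π i * emp τ (Γ i) := by
        have : jemp σ τ (i, Γ i) = (n * jemp σ τ (i, Γ i)) / n := by field_simp
        rw [this, h1]
        field_simp
        rfl
      rw [this]
      field_simp
      ring
    have h3 : X i (Γ i) / n + (π i - emp σ i) * emp τ (Γ i) ≤
        δ + ∑ j, (t + (X i j) ^ 2 / (t * n ^ 2)) := by
      have a1 : X i (Γ i) / n ≤ ∑ j, (t + (X i j) ^ 2 / (t * n ^ 2)) :=
        ((div_le_div_of_nonneg_right (le_abs_self _) hn'.le).trans (hXt i (Γ i))).trans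
          (Finset.single_le_sum (f := fun j => t + (X i j) ^ 2 / (t * n ^ 2))
            (fun j _ => hW0 i j) (Finset.mem_univ (Γ i)))
      have a2 : (π i - emp σ i) * emp τ (Γ i) ≤ δ := by
        have b1 : emp τ (Γ i) ≤ 1 := sum_emp hn τ ▸
          Finset.single_le_sum (fun j _ => emp_nonneg τ j) (Finset.mem_univ (Γ i))
        have b2 : π i - emp σ i ≤ δ := by
          have := (abs_le.1 (hσδ i)).1
          linarith
        calc _ ≤ δ * emp τ (Γ i) := mul_le_mul_of_nonneg_right b2 (emp_nonneg τ _)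
          _ ≤ δ := mul_le_of_le_one_right hδ b1
      linarith
    rw [h2]
    have h4 : 0 ≤ δ + ∑ j, (t + (X i j) ^ 2 / (t * n ^ 2)) :=
      add_nonneg hδ (Finset.sum_nonneg fun j _ => hW0 i j)
    refine add_le_add le_rfl ?_
    calc _ ≤ (δ + ∑ j, (t + (X i j) ^ 2 / (t * n ^ 2))) / emp σ i := by gcongr
      _ ≤ _ := div_le_div_of_nonneg_left h4 hc (hσc i)
  have hsum := Finset.sum_le_sum fun i (_ : i ∈ Finset.univ) => hterm i
  rw [Finset.sum_add_distrib, Equiv.sum_comp Γ (emp τ), sum_emp hn, ← Finset.sum_div,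
    Finset.sum_add_distrib, Finset.sum_const, Finset.card_univ, Fintype.card_fin,
    nsmul_eq_mul] at hsum
  have hWn : 0 ≤ W := Finset.sum_nonneg fun i _ => Finset.sum_nonneg fun j _ => hW0 i j
  calc _ ≤ 1 / (q : ℝ) * (1 + (q * δ + W) / c) := by gcongr
    _ = 1 / q + 1 / c * (δ + W / q) := by field_simp
    _ ≤ _ := by
      gcongr
      exact div_le_self hWn hq'

/-- Below the branching threshold no estimator beats a random guess asymptotically. -/
theorem eventually_overlapGiven_le (hq : 2 ≤ q) (hp : IsWeightPrior Ψ p) (hπ : IsCommunityPrior π)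
    (hS : SYM Ψ π) {C : ℝ} (hC : 0 < C) (hCk : C * (k * k - k : ℕ) < 1) {κ : ℝ} (hκ : 0 < κ) :
    ∀ᶠ n : ℕ in atTop, ∀ m : ℕ, m ≤ C * n → ∀ est : FactorGraph Ψ n → (Fin n → Fin q),
      overlapGiven Ψ p π n est m ≤ 1 / q + κ := by
  classical
  have hπ0 : ∀ i, 0 ≤ π i := fun i => (hπ.pos i).le
  have hq0 : (0 : ℝ) < q := by exact_mod_cast (by omega : 0 < q)
  obtain ⟨c, hc, hcπ⟩ : ∃ c : ℝ, 0 < c ∧ ∀ i, 2 * c ≤ π i := by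
    have : Nonempty (Fin q) := ⟨⟨0, by omega⟩⟩
    obtain ⟨i₀, hi₀⟩ := Finite.exists_min π
    exact ⟨π i₀ / 2, by linarith [hπ.pos i₀], fun i => by linarith [hi₀ i]⟩
  -- `δ ≤ c` keeps every community frequency above `c`. The terms `δ / c`, `2 * q ^ 2 * t / c` and
  -- the atypical `σ` take at most `κ / 4` each; the second moment is requested at level `t ^ 2` so
  -- that dividing by `t` returns `t`.
  set δ := min c (c * κ / 4) with hδ
  have hδ0 : 0 < δ := lt_min hc (by positivity)
  set t := c * κ / (8 * q ^ 2) with ht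
  have ht0 : 0 < t := by positivity
  have hV := tendsto_emp_not_mem hπ0 hπ.sum_eq_one (Metric.ball_mem_nhds π hδ0)
  filter_upwards [eventually_gt_atTop 0,
    eventually_second_moment_le hp hπ hS hC hCk (show (0 : ℝ) < t ^ 2 by positivity),
    hV.eventually_le_const (show (0 : ℝ) < κ / 4 by positivity)] with n hn hX hVn m hm est
  have hn' : (0 : ℝ) < n := by exact_mod_cast hn
  set X : Fin q → Fin q → (Fin n → Fin q) → (Fin m → Clause Ψ n) → ℝ := fun i j σ g =>
    ∑ v ∈ Finset.univ.filter (fun v => est ⟨m, g⟩ v = j), centred π i (σ v) with hXdef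
  have hpt : ∀ (σ : Fin n → Fin q) (g : Fin m → Clause Ψ n), overlap σ (est ⟨m, g⟩) ≤
      1 / q + 1 / c * (δ + ∑ i, ∑ j, (t + (X i j σ g) ^ 2 * (1 / (t * n ^ 2)))) +
        if emp σ ∈ Metric.ball π δ then (0 : ℝ) else 1 := by
    intro σ g
    have hW : 0 ≤ 1 / c * (δ + ∑ i, ∑ j, (t + (X i j σ g) ^ 2 * (1 / (t * n ^ 2)))) := by
      have : 0 ≤ ∑ i, ∑ j, (t + (X i j σ g) ^ 2 * (1 / (t * n ^ 2))) :=
        Finset.sum_nonneg fun i _ => Finset.sum_nonneg fun j _ => by positivity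
      positivity
    by_cases h : emp σ ∈ Metric.ball π δ
    · rw [if_pos h, add_zero]
      rw [Metric.mem_ball, dist_pi_lt_iff hδ0] at h
      have h1 : ∀ i, |emp σ i - π i| ≤ δ := fun i => (h i).le
      have h2 : ∀ i, c ≤ emp σ i := fun i => by
        have := (abs_le.1 (h1 i)).1
        have := min_le_left c (c * κ / 4)
        linarith [hcπ i]
      have := overlap_le_of_emp hn (by omega) (est ⟨m, g⟩) hc hδ0.le ht0 h2 h1
      simpa only [div_eq_mul_one_div (_ ^ 2) (t * (n : ℝ) ^ 2)] using this
    · rw [if_neg h]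
      have : 0 ≤ 1 / (q : ℝ) := by positivity
      linarith [overlap_le_one σ (est ⟨m, g⟩)]
  refine (prodExp_mono hπ0 fun σ => prodExp_mono (hp.clauseProb_nonneg σ) (hpt σ)).trans ?_
  simp only [prodExp_add, prodExp_const_mul, prodExp_mul_const, prodExp_sum,
    prodExp_const (hp.sum_clauseProb hn _), prodExp_const hπ.sum_eq_one]
  have hXE : ∀ i j, prodExp π (fun σ => prodExp (clauseProb Ψ p σ) (fun g => X i j σ g ^ 2)) *
      (1 / (t * n ^ 2)) ≤ t := by
    intro i j
    have := hX m hm (fun g => Finset.univ.filter (fun v => est ⟨m, g⟩ v = j)) (centred π i)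
      (sum_mul_centred hπ i) (abs_centred_le hπ i)
    rw [mul_one_div, div_le_iff₀ (by positivity)]
    refine this.trans_eq ?_
    ring
  have hsum : ∑ i, ∑ j, (t + prodExp π (fun σ => prodExp (clauseProb Ψ p σ)
      (fun g => X i j σ g ^ 2)) * (1 / (t * n ^ 2))) ≤ q * (q * (t + t)) := by
    refine (Finset.sum_le_sum fun i _ => Finset.sum_le_sum fun j _ =>
      add_le_add le_rfl (hXE i j)).trans_eq ?_
    simp only [Finset.sum_const, Finset.card_univ, Fintype.card_fin, nsmul_eq_mul]
  have hδc : 1 / c * δ ≤ κ / 4 := by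
    calc 1 / c * δ ≤ 1 / c * (c * κ / 4) := by gcongr; exact min_le_right _ _
      _ = κ / 4 := by field_simp
  have htc : 1 / c * (q * (q * (t + t))) = κ / 4 := by
    rw [ht]; field_simp; ring
  have h3 := mul_le_mul_of_nonneg_left hsum (show 0 ≤ 1 / c by positivity)
  rw [mul_add]
  linarith

/-- Strict inequality leaves room for a slack `η`: graphs with up to `(1 + η) * l` clauses are still
subcritical, and the Poisson count exceeds this with exponentially small probability. -/
theorem not_weakRecoveryPossible (hk : 2 ≤ k) (hq : 2 ≤ q) (hp : IsWeightPrior Ψ p)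
    (hπ : IsCommunityPrior π) (hS : SYM Ψ π) {d : ℝ} (hd : 0 < d) (hdk : d < 1 / ((k : ℝ) - 1)) :
    ¬ WeakRecoveryPossible Ψ p π d := by
  rintro ⟨ε, hε, est, hlim⟩
  have hk1 : (0 : ℝ) < (k : ℝ) - 1 := by
    have : (2 : ℝ) ≤ k := by exact_mod_cast hk
    linarith
  have hk0 : (0 : ℝ) < k := by linarith
  rw [lt_div_iff₀ hk1] at hdk
  obtain ⟨η, hη, hηd⟩ : ∃ η : ℝ, 0 < η ∧ (1 + η) * (d * ((k : ℝ) - 1)) < 1 := by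
    refine ⟨(1 - d * (k - 1)) / 2, by linarith, ?_⟩
    have : 0 < d * ((k : ℝ) - 1) := by positivity
    nlinarith
  set C := (1 + η) * (d / k) with hC
  have hC0 : 0 < C := by positivity
  have hCk : C * (k * k - k : ℕ) < 1 := by
    rw [Nat.cast_sub (Nat.le_mul_self k), Nat.cast_mul]
    refine lt_of_eq_of_lt ?_ hηd
    rw [hC]; field_simp
  obtain ⟨c, hc, htail⟩ := exists_poisson_tail hη
  have hexp : Tendsto (fun n : ℕ => Real.exp (-(c * (d * n / k)))) atTop (𝓝 0) := by
    have h1 : Tendsto (fun n : ℕ => c * d / k * (n : ℝ)) atTop atTop :=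
      tendsto_natCast_atTop_atTop.const_mul_atTop (by positivity)
    refine (Real.tendsto_exp_neg_atTop_nhds_zero.comp h1).congr fun n => ?_
    simp only [Function.comp]
    congr 2
    ring
  have hev : ∀ᶠ n in atTop, expectedOverlap Ψ p π d n (est n) ≤ 1 / q + ε / 2 := by
    filter_upwards [eventually_gt_atTop 0,
      eventually_overlapGiven_le hq hp hπ hS hC0 hCk (show (0 : ℝ) < ε / 4 by positivity),
      hexp.eventually_le_const (show (0 : ℝ) < ε / 4 by positivity)] with n hn hgiven hsmall
    rw [expectedOverlap_eq]
    set l := (d * n / k).toNNReal with hl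
    have hl' : (l : ℝ) = d * n / k := toNNReal_rate hd n
    have hint : MeasureTheory.Integrable (fun m : ℕ => if (1 + η) * l < m then (1 : ℝ) else 0)
        (ProbabilityTheory.poissonMeasure l) :=
      integrable_poissonMeasure_of_abs_le (C := 1) l fun m => by split_ifs <;> simp
    have hle : ∀ m : ℕ, overlapGiven Ψ p π n (est n) m ≤
        (1 / q + ε / 4) + if (1 + η) * l < m then (1 : ℝ) else 0 := by
      intro m
      split_ifs with h
      · have : 0 ≤ 1 / (q : ℝ) := by positivity
        linarith [overlapGiven_le_one hp hπ hn (est n) m]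
      · rw [add_zero]
        refine hgiven m ((not_lt.1 h).trans_eq ?_) (est n)
        rw [hl', hC]; ring
    have hint' : MeasureTheory.Integrable (fun m : ℕ => (1 / (q : ℝ) + ε / 4) +
        if (1 + η) * l < m then (1 : ℝ) else 0) (ProbabilityTheory.poissonMeasure l) :=
      (MeasureTheory.integrable_const _).add hint
    refine (MeasureTheory.integral_mono (integrable_overlapGiven hp hπ hn _ _) hint' hle).trans ?_
    rw [MeasureTheory.integral_add (MeasureTheory.integrable_const _) hint]
    have := htail l
    rw [hl'] at this
    simp only [MeasureTheory.integral_const, MeasureTheory.probReal_univ, smul_eq_mul, one_mul]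
    rw [hl']
    linarith
  -- Nonnegativity of the overlap supplies the lower bound that a real `limsup` requires.
  have hub := limsup_le_of_le (isCoboundedUnder_le_of_le atTop (x := 0)
    fun n => expectedOverlap_nonneg hp hπ d (est n)) hev
  linarith

theorem weakRecoveryThreshold_le {d : ℝ} (hd : 0 < d) (hW : WeakRecoveryPossible Ψ p π d) :
    weakRecoveryThreshold Ψ p π ≤ d :=
  sInf_le ⟨d, ⟨hd, hW⟩, rfl⟩

end Impossibility

end PlantedFactor

end

/-! ### Assembly of the two regimes -/

theorem proposition3p1 {k q : ℕ} (hk : 2 ≤ k) (hq : 2 ≤ q)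
    (Ψ : Finset (PlantedFactor.Weight k q)) (p : PlantedFactor.Weight k q → ℝ) (π : Fin q → ℝ)
    (hp : PlantedFactor.IsWeightPrior Ψ p) (hπ : PlantedFactor.IsCommunityPrior π) :
    (¬ PlantedFactor.SYM Ψ π →
      (∀ d : ℝ, 0 < d → PlantedFactor.WeakRecoveryPossible Ψ p π d) ∧
        PlantedFactor.weakRecoveryThreshold Ψ p π = 0) ∧
    (PlantedFactor.SYM Ψ π → (∃ ψ ∈ Ψ, ∃ x y, ψ x ≠ ψ y) →
      ((1 / ((k : ℝ) - 1) : ℝ) : EReal) ≤ PlantedFactor.weakRecoveryThreshold Ψ p π ∧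
        PlantedFactor.weakRecoveryThreshold Ψ p π < ⊤) := by
  open PlantedFactor in
  refine ⟨fun hS => ?_, fun hS hne => ⟨?_, ?_⟩⟩
  · have hall : ∀ d : ℝ, 0 < d → WeakRecoveryPossible Ψ p π d :=
      fun d hd => weakRecoveryPossible_of_not_sym hk hq hp hπ hS hd
    refine ⟨hall, le_antisymm ?_ ?_⟩
    · refine EReal.le_of_forall_lt_iff_le.1 fun z hz => ?_
      have hz' : 0 < z := EReal.coe_pos.1 hz
      exact weakRecoveryThreshold_le hz' (hall z hz')
    · refine le_sInf ?_
      rintro _ ⟨d, ⟨hd, -⟩, rfl⟩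
      exact EReal.coe_nonneg.2 hd.le
  · refine le_sInf ?_
    rintro _ ⟨d, ⟨hd, hW⟩, rfl⟩
    refine EReal.coe_le_coe_iff.2 ?_
    by_contra! hlt
    exact not_weakRecoveryPossible hk hq hp hπ hS hd hlt hW
  · obtain ⟨d, hd, hW⟩ := exists_weakRecoveryPossible hk hq hp hπ hne
    exact (weakRecoveryThreshold_le hd hW).trans_lt (EReal.coe_lt_top d)
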